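/- Let $\Gamma$ be the honeycomb lattice, with vertices $A_q, B_q$ ($q\in\mathbb Z^2$), where $A_q$ is joined to $B_q$, $B_{q+(1,0)}$ and $B_{q+(0,1)}$. For a subgroup $L\subset\mathbb Z^2$ of finite index, let $\Gamma_L=\Gamma/L$ be the finite honeycomb lattice with periodic boundary conditions obtained by identifying vertices that differ by a translation in $L$; assume that $\Gamma_L$ has no multiple edges, that is, that the three neighbours of each vertex remain distinct modulo $L$. For $n\ge 1$ let $\Gamma_L^{(n)}$ be the graph obtained by replacing each edge of $\Gamma_L$ by a path with $n$ additional interior vertices. Place a spin $3/2$ (the space $\mathbb C^4$) at each original vertex and a spin $1$ (the space $\mathbb C^3$) at each additional vertex, and define the AKLT Hamiltonian on the tensor product of these spaces by $$H_L^{(n)}=\sum_{e} P_e^{(z(e)/2)},$$ where the sum is over all edges $e$ of $\Gamma_L^{(n)}$, $z(e)$ is the sum of the degrees of the two end points of $e$, and $P^{(j)}_e$ is the orthogonal projection onto the space of vectors for which the two spins at the end points of $e$ have total spin $j$ (that is, the eigenspace for the eigenvalue $j(j+1)$ of the square of the sum of these two spins). Let $\mathrm{gap}(H)$ denote the difference between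 the second smallest and the smallest of the distinct eigenvalues of a self-adjoint operator $H$ on a finite-dimensional space. Then for every $n\ge 3$ there is a constant $\gamma_n>0$ such that $$\mathrm{gap}\big(H_L^{(n)}\big)\ \ge\ \gamma_n$$ for every subgroup $L\subset\mathbb Z^2$ of finite index for which $\Gamma_L$ has no multiple edges. -/

import Mathlib

noncomputable section

/-! ### Quantum spin systems on finite graphs

`twoS : V → ℕ` gives twice the spin at each site, so the site `v` carries `ℂ ^ (twoS v + 1)`. -/

/-- Spin configurations: basis vector `k` at the site `v` is the eigenvector of the third
component of the spin for the eigenvalue `twoS v / 2 - k`. -/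
abbrev SpinConfig {V : Type*} (twoS : V → ℕ) : Type _ := (v : V) → Fin (twoS v + 1)

/-- The Hilbert space `⨂ v, ℂ ^ (twoS v + 1)`, written in its product basis. -/
abbrev SpinSpace {V : Type*} (twoS : V → ℕ) : Type _ := EuclideanSpace ℂ (SpinConfig twoS)

/-- Third component of the spin, for spin `d / 2`. -/
def spinZ (d : ℕ) : Matrix (Fin (d + 1)) (Fin (d + 1)) ℂ :=
  Matrix.diagonal fun k => (d : ℂ) / 2 - (k : ℕ)

/-- Raising operator for spin `s = d / 2`: for `m = s - k`, it sends the basis vector `k` to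
`√(s (s + 1) - m (m + 1)) = √(k (d + 1 - k))` times the basis vector `k - 1`. -/
def spinRaise (d : ℕ) : Matrix (Fin (d + 1)) (Fin (d + 1)) ℂ :=
  Matrix.of fun j k =>
    if (j : ℕ) + 1 = (k : ℕ) then ((Real.sqrt ((k : ℕ) * ((d : ℝ) + 1 - (k : ℕ))) : ℝ) : ℂ) else 0

/-- The spin matrices `S^X, S^Y, S^Z` for spin `d / 2`. -/
def spinMatrix (d : ℕ) : Fin 3 → Matrix (Fin (d + 1)) (Fin (d + 1)) ℂ :=
  ![(1 / 2 : ℂ) • (spinRaise d + (spinRaise d).conjTranspose),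
    (1 / (2 * Complex.I) : ℂ) • (spinRaise d - (spinRaise d).conjTranspose),
    spinZ d]

section General

variable {V : Type*} [Fintype V] [DecidableEq V]

/-- The operator `A` at the site `v`, tensored with the identity at all other sites. -/
def siteOp (twoS : V → ℕ) (v : V) (A : Matrix (Fin (twoS v + 1)) (Fin (twoS v + 1)) ℂ) :
    Matrix (SpinConfig twoS) (SpinConfig twoS) ℂ :=
  Matrix.of fun σ τ => if ∀ w, w ≠ v → σ w = τ w then A (σ v) (τ v) else 0

/-- The square `∑ₐ (∑_{v ∈ e} Sᵃ_v)²` of the total spin of the two end points of the edge `e`. -/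
def edgeTotalSpinSq (twoS : V → ℕ) (e : Sym2 V) :
    Matrix (SpinConfig twoS) (SpinConfig twoS) ℂ :=
  ∑ a : Fin 3, (∑ v : V with v ∈ e, siteOp twoS v (spinMatrix (twoS v) a)) ^ 2

/-- The space of vectors for which the end points of `e` have total spin `j`. -/
def edgeSpinSubspace (twoS : V → ℕ) (e : Sym2 V) (j : ℝ) : Submodule ℂ (SpinSpace twoS) :=
  Module.End.eigenspace (Matrix.toEuclideanLin (edgeTotalSpinSq twoS e)) ((j * (j + 1) : ℝ) : ℂ)

/-- The sum `z(e)` of the degrees of the end points of `e`. -/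
def edgeDegreeSum (G : SimpleGraph V) (e : Sym2 V) : ℕ :=
  ∑ v : V with v ∈ e, Nat.card (G.neighborSet v)

open Classical in
/-- The AKLT Hamiltonian: the sum over the edges `e` of the graph of the orthogonal projections
onto the space of total spin `z(e) / 2` of the end points of `e`. -/
def akltHamiltonian (G : SimpleGraph V) (twoS : V → ℕ) : SpinSpace twoS →L[ℂ] SpinSpace twoS :=
  ∑ e : Sym2 V with e ∈ G.edgeSet,
    (edgeSpinSubspace twoS e ((edgeDegreeSum G e : ℝ) / 2)).starProjection

end General

/-- The lowest point of the spectrum. -/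
def groundEnergy {E : Type*} [NormedAddCommGroup E] [NormedSpace ℂ E] (H : E →L[ℂ] E) : ℝ :=
  sInf (spectrum ℝ H)

/-- The spectral gap above the ground state: the distance from the lowest point of the spectrum
to the rest of the spectrum. It is `0` by convention if there is no other point of the spectrum,
so a positive lower bound on it says in particular that there is one. -/
def spectralGap {E : Type*} [NormedAddCommGroup E] [NormedSpace ℂ E] (H : E →L[ℂ] E) : ℝ :=
  sInf {δ : ℝ | ∃ x ∈ spectrum ℝ H, x ≠ groundEnergy H ∧ δ = x - groundEnergy H}

/-! ### The edge-decorated honeycomb lattice on a torus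

The honeycomb lattice has the vertices `A q` and `B q` for `q ∈ ℤ²` (two per unit cell), and `A q`
is joined to `B q`, `B (q + (1, 0))` and `B (q + (0, 1))`. Periodic boundary conditions are given
by a subgroup `L` of finite index in the group `ℤ²` of translations; all is taken modulo `L`. -/

/-- The unit cells of the honeycomb lattice modulo `L`. -/
abbrev HexCell (L : AddSubgroup (ℤ × ℤ)) : Type := (ℤ × ℤ) ⧸ L

instance instFintypeHexCell (L : AddSubgroup (ℤ × ℤ)) [L.FiniteIndex] : Fintype (HexCell L) :=
  Fintype.ofFinite _

instance instDecidableEqHexCell (L : AddSubgroup (ℤ × ℤ)) : DecidableEq (HexCell L) :=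
  Classical.decEq _

/-- The edge number `i` at `A q` ends at `B (q + hexShift i)`. -/
def hexShift : Fin 3 → ℤ × ℤ := ![(0, 0), (1, 0), (0, 1)]

/-- The torus is wide enough for the three neighbours of each vertex to be distinct, so that the
honeycomb lattice modulo `L` has no multiple edges. -/
def NoMultipleEdges (L : AddSubgroup (ℤ × ℤ)) : Prop :=
  Function.Injective fun i : Fin 3 => (QuotientAddGroup.mk (hexShift i) : HexCell L)

/-- The sites of the decorated lattice: `Sum.inl (q, false)` is the vertex `A q`,
`Sum.inl (q, true)` is the vertex `B q`, and `Sum.inr (q, i, k)` is the site number `k`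
on the edge number `i` at `A q`. -/
abbrev DecoratedSite (L : AddSubgroup (ℤ × ℤ)) (n : ℕ) : Type :=
  (HexCell L × Bool) ⊕ (HexCell L × Fin 3 × Fin n)

/-- The chain that replaces the edge number `i` at `A q`: the vertex `A q`, the `n` sites on the
edge in order, and the vertex `B (q + hexShift i)`. -/
def decoratedEdge (L : AddSubgroup (ℤ × ℤ)) (n : ℕ) (q : HexCell L) (i : Fin 3) :
    Fin (n + 2) → DecoratedSite L n :=
  Fin.cons (Sum.inl (q, false))
    (Fin.snoc (fun k : Fin n => (Sum.inr (q, i, k) : DecoratedSite L n))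
      (Sum.inl (q + QuotientAddGroup.mk (hexShift i), true)))

/-- The decorated honeycomb lattice modulo `L`: neighbours are the consecutive sites
of the chains that replace the edges. -/
def decoratedHoneycomb (L : AddSubgroup (ℤ × ℤ)) (n : ℕ) : SimpleGraph (DecoratedSite L n) :=
  SimpleGraph.fromRel fun x y => ∃ (q : HexCell L) (i : Fin 3) (k : Fin (n + 1)),
    x = decoratedEdge L n q i k.castSucc ∧ y = decoratedEdge L n q i k.succ

/-- Twice the spin: spin `3 / 2` at the vertices of the honeycomb lattice,
spin `1` at the added sites. -/
def decoratedTwoSpin (L : AddSubgroup (ℤ × ℤ)) (n : ℕ) : DecoratedSite L n → ℕ :=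
  Sum.elim (fun _ => 3) (fun _ => 2)

/-- The AKLT Hamiltonian on the decorated honeycomb lattice with `n` sites on each edge and
periodic boundary conditions given by `L`. -/
def decoratedAKLT (L : AddSubgroup (ℤ × ℤ)) [L.FiniteIndex] (n : ℕ) :
    SpinSpace (decoratedTwoSpin L n) →L[ℂ] SpinSpace (decoratedTwoSpin L n) :=
  akltHamiltonian (decoratedHoneycomb L n) (decoratedTwoSpin L n)

end

/-!
The Hamiltonian is a sum of orthogonal projections `edgeProj` which have a common kernel vector, so
its smallest eigenvalue is zero and the gap is its smallest nonzero eigenvalue. The kernel vector is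
the valence bond state: in the model where a spin `d / 2` at `x` is a polynomial of degree at most `d` in
`X x`, it is the product of the differences `X y - X x` over the edges
(`exists_ne_zero_edgeProj_mulVec_eq_zero`).

The edges are grouped into stars: the star of a vertex of the honeycomb lattice consists of this
vertex and the `n` spins 1 on each of its three edges. An edge lies in one or two stars, and the
Hamiltonian of a star has a gap `g` that does not depend on its place nor on `L`
(`exists_starHam_gap`). So the Hamiltonian is at least `g / 2` times the sum of the projections
`P w` onto the orthogonal complements of the ground spaces of the stars, with the same kernel
(`two_smul_hamMatrix_sub_posSemidef`, `sum_kerProjCompl_mulVec_eq_zero_iff`). It remains to bound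
the gap of `∑ w, P w` from below, and for this it suffices that its square is at least a positive
multiple of it (`gap_of_sq`). In the square, stars that are not neighbours have no common site, so
their projections commute and contribute a nonnegative term. Two neighbouring stars share one leg,
and satisfy `P * Q + Q * P ≥ - ε * (P + Q)` with `ε = 3 / 10`. Each star has three neighbours, hence
`(∑ w, P w) ^ 2 ≥ (1 - 3 * ε) * ∑ w, P w` (`sq_sub_smul_posSemidef`), and `3 * ε < 1`.

The bound for neighbouring stars is a bound for the cosine of the angle between their ground spaces
outside the intersection (`anticommutator_starProjection`). The kernel of an edge projection is
described by explicit linear equations (`edgeProj_mulVec_eq_zero`); solving them shows that the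
ground states of a leg are the AKLT matrix product states (`ChainCond.exists_eq_sum`), and that the
ground states of a star are obtained by joining three of these with the symmetric tensor of three
spins 1/2 at the centre (`StarCond.exists_eq_starState`). The transfer operator of the matrix product
states has the eigenvalues `3` and `-1`, so a leg of `n ≥ 3` sites maps the spins 1/2 at its two
ends isometrically, up to a scalar and a rank one correction with a coefficient of at most `1 / 13`
(`gramCond_chainTensor`, `abs_chainRatio_le`). Consequently the remainder of a star, its centre
with the two legs that are not shared, is nearly an isometry (`nearIsometry_cornerTensor`). If all
these maps were exact isometries, the ground spaces would be orthogonal outside their intersection;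
with the errors above, the cosine is at most `3 / 10` (`norm_inner_leftMap_rightMap_le`).
-/

open Matrix
open scoped ComplexOrder InnerProductSpace ComplexConjugate

/-! ### Projections onto kernels -/

section LinearAlgebra

variable {ι : Type*} [Fintype ι] [DecidableEq ι]

/-- The matrix of the orthogonal projection onto the kernel of `h`. -/
noncomputable def kerProj (h : Matrix ι ι ℂ) : Matrix ι ι ℂ :=
  (toEuclideanCLM (n := ι) (𝕜 := ℂ)).symm (LinearMap.ker (toEuclideanLin h)).starProjection

theorem toEuclideanCLM_kerProj (h : Matrix ι ι ℂ) :
    toEuclideanCLM (n := ι) (𝕜 := ℂ) (kerProj h) =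
      (LinearMap.ker (toEuclideanLin h)).starProjection := by
  simp [kerProj]

theorem kerProj_isHermitian (h : Matrix ι ι ℂ) : (kerProj h).IsHermitian := by
  have h1 : IsSelfAdjoint ((LinearMap.ker (toEuclideanLin h)).starProjection) :=
    isSelfAdjoint_starProjection _
  have h2 : toEuclideanCLM (n := ι) (𝕜 := ℂ) (star (kerProj h)) =
      toEuclideanCLM (n := ι) (𝕜 := ℂ) (kerProj h) := by
    rw [map_star, toEuclideanCLM_kerProj]
    exact h1
  exact (toEuclideanCLM (n := ι) (𝕜 := ℂ)).injective h2

theorem kerProj_mul_self (h : Matrix ι ι ℂ) : kerProj h * kerProj h = kerProj h := by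
  have h2 : toEuclideanCLM (n := ι) (𝕜 := ℂ) (kerProj h * kerProj h) =
      toEuclideanCLM (n := ι) (𝕜 := ℂ) (kerProj h) := by
    rw [map_mul, toEuclideanCLM_kerProj]
    exact (LinearMap.ker (toEuclideanLin h)).isIdempotentElem_starProjection
  exact (toEuclideanCLM (n := ι) (𝕜 := ℂ)).injective h2

theorem kerProj_mulVec_eq_self (h : Matrix ι ι ℂ) (x : ι → ℂ) :
    kerProj h *ᵥ x = x ↔ h *ᵥ x = 0 := by
  have h1 : (LinearMap.ker (toEuclideanLin h)).starProjection (WithLp.toLp 2 x) =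
      WithLp.toLp 2 (kerProj h *ᵥ x) := by
    rw [← toEuclideanCLM_kerProj, toEuclideanCLM_toLp]
  have h2 : WithLp.toLp 2 x ∈ LinearMap.ker (toEuclideanLin h) ↔ h *ᵥ x = 0 := by
    rw [LinearMap.mem_ker, ← coe_toEuclideanCLM_eq_toEuclideanLin]
    simp [toEuclideanCLM_toLp]
  rw [← h2, ← Submodule.starProjection_eq_self_iff, h1]
  exact (WithLp.toLp_injective 2).eq_iff.symm

theorem mul_kerProj (h : Matrix ι ι ℂ) : h * kerProj h = 0 := by
  refine Matrix.ext_of_mulVec_single fun i => ?_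
  rw [← mulVec_mulVec, (kerProj_mulVec_eq_self h _).1, zero_mulVec]
  rw [mulVec_mulVec, kerProj_mul_self]

/-- An orthogonal projection is determined by the space it fixes. -/
theorem eq_kerProj {h E : Matrix ι ι ℂ} (hE : E.IsHermitian) (hEE : E * E = E)
    (hfix : ∀ x, E *ᵥ x = x ↔ h *ᵥ x = 0) : E = kerProj h := by
  have h1 : kerProj h * E = E := by
    refine Matrix.ext_of_mulVec_single fun i => ?_
    rw [← mulVec_mulVec, kerProj_mulVec_eq_self, ← hfix, mulVec_mulVec, hEE]
  have h2 : E * kerProj h = kerProj h := by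
    refine Matrix.ext_of_mulVec_single fun i => ?_
    rw [← mulVec_mulVec, hfix, ← kerProj_mulVec_eq_self, mulVec_mulVec, kerProj_mul_self]
  have h3 := congrArg conjTranspose h1
  rw [conjTranspose_mul, hE.eq, (kerProj_isHermitian h).eq, h2] at h3
  exact h3.symm

/-- If the nonzero eigenvalues of `h` are at least `g`, then `h` is at least `g` on the orthogonal
complement of its kernel. -/
theorem posSemidef_sub_smul_of_eigenvalues {h : Matrix ι ι ℂ} (hh : h.IsHermitian) {g : ℝ}
    (hg : ∀ i, hh.eigenvalues i ≠ 0 → g ≤ hh.eigenvalues i) :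
    (h - (g : ℂ) • (1 - kerProj h)).PosSemidef := by
  set U : Matrix ι ι ℂ := (hh.eigenvectorUnitary : Matrix ι ι ℂ) with hU
  have hUU : star U * U = 1 := by
    simp [hU]
  have hUU' : U * star U = 1 := by
    simp [hU]
  have hs : h = U * diagonal (fun i => (hh.eigenvalues i : ℂ)) * star U := by
    have := hh.spectral_theorem
    rw [Unitary.conjStarAlgAut_apply] at this
    exact this
  obtain ⟨d, hd⟩ : ∃ d, d = hh.eigenvalues := ⟨_, rfl⟩
  rw [← hd] at hs hg
  have hE : U * diagonal (fun i => if d i = 0 then (1 : ℂ) else 0) * star U =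
      kerProj h := by
    refine eq_kerProj ?_ ?_ fun x => ?_
    · unfold IsHermitian
      rw [conjTranspose_mul, conjTranspose_mul, diagonal_conjTranspose, ← star_eq_conjTranspose,
        ← star_eq_conjTranspose, star_star, Matrix.mul_assoc]
      congr 3
      ext i
      simp only [Pi.star_apply]
      split_ifs <;> simp
    · calc _ = U * diagonal (fun i => if d i = 0 then (1 : ℂ) else 0) *
            (star U * U) * diagonal (fun i => if d i = 0 then (1 : ℂ) else 0) *
            star U := by simp only [Matrix.mul_assoc]
        _ = _ := by
          rw [hUU, Matrix.mul_one, Matrix.mul_assoc U, diagonal_mul_diagonal]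
          congr 3
          ext i
          split_ifs <;> simp
    · have key : ∀ y : ι → ℂ, U *ᵥ y = 0 ↔ y = 0 := fun y => by
        constructor
        · intro hy
          have := congrArg (star U *ᵥ ·) hy
          simpa [mulVec_mulVec, hUU] using this
        · rintro rfl; simp
      have e1 : x = U *ᵥ (star U *ᵥ x) := by rw [mulVec_mulVec, hUU', one_mulVec]
      rw [← sub_eq_zero, hs]
      nth_rewrite 2 [e1]
      simp only [← mulVec_mulVec]
      rw [← mulVec_sub, key, key, funext_iff, funext_iff]
      refine forall_congr' fun i => ?_
      simp only [Pi.sub_apply, mulVec_diagonal, Pi.zero_apply]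
      by_cases h0 : d i = 0 <;> simp [h0]
  have e : h - (g : ℂ) • (1 - kerProj h) = U * diagonal (fun i => (d i : ℂ) -
      (g : ℂ) * (1 - if d i = 0 then (1 : ℂ) else 0)) * Uᴴ := by
    rw [← star_eq_conjTranspose, ← diagonal_sub, Matrix.mul_sub, Matrix.sub_mul, ← hs, ← hE]
    congr 1
    have : diagonal (fun i => (g : ℂ) * (1 - if d i = 0 then (1 : ℂ) else 0)) =
        (g : ℂ) • (1 - diagonal (fun i => if d i = 0 then (1 : ℂ) else 0)) := by
      rw [← diagonal_one, diagonal_sub, ← diagonal_smul]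
      rfl
    rw [this, Matrix.mul_smul, Matrix.smul_mul, Matrix.mul_sub, Matrix.sub_mul, Matrix.mul_one,
      hUU']
  rw [e]
  refine PosSemidef.mul_mul_conjTranspose_same (PosSemidef.diagonal fun i => ?_) U
  by_cases h0 : d i = 0
  · simp [h0]
  · have := hg i h0
    simp only [h0, if_false, sub_zero, mul_one, Pi.zero_apply]
    rw [sub_nonneg]
    exact_mod_cast this

/-- A positive semidefinite matrix has a gap above its kernel: the smallest nonzero eigenvalue, or `1`
if there is none. -/
theorem exists_gap {h : Matrix ι ι ℂ} (hh : h.PosSemidef) :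
    ∃ g : ℝ, 0 < g ∧ (h - (g : ℂ) • (1 - kerProj h)).PosSemidef := by
  have hpos : ∀ i, 0 ≤ hh.1.eigenvalues i := hh.eigenvalues_nonneg
  let s : Finset ℝ := insert 1 ((Finset.univ.image hh.1.eigenvalues).filter (0 < ·))
  have hs : s.Nonempty := Finset.insert_nonempty _ _
  refine ⟨s.min' hs, ?_, posSemidef_sub_smul_of_eigenvalues hh.1 fun i hi => ?_⟩
  · rw [Finset.lt_min'_iff]
    intro y hy
    simp only [s, Finset.mem_insert, Finset.mem_filter] at hy
    rcases hy with rfl | hy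
    · exact one_pos
    · exact hy.2
  · apply Finset.min'_le
    simp only [s, Finset.mem_insert, Finset.mem_filter, Finset.mem_image, Finset.mem_univ,
      true_and]
    exact Or.inr ⟨⟨i, rfl⟩, lt_of_le_of_ne (hpos i) (Ne.symm hi)⟩

theorem exists_unit_eigenvector {h : Matrix ι ι ℂ} (hh : h.IsHermitian) (i : ι) :
    ∃ v : ι → ℂ, star v ⬝ᵥ v = 1 ∧ h *ᵥ v = (hh.eigenvalues i : ℂ) • v := by
  refine ⟨hh.eigenvectorBasis i, ?_, ?_⟩
  · have := hh.eigenvectorBasis.orthonormal.1 i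
    rw [EuclideanSpace.norm_eq] at this
    have h3 : ∑ j, ‖hh.eigenvectorBasis i j‖ ^ 2 = 1 := by
      have := congrArg (· ^ 2) this
      rwa [Real.sq_sqrt (by positivity), one_pow] at this
    simp only [dotProduct, Pi.star_apply]
    have : ∀ j, star (hh.eigenvectorBasis i j) * hh.eigenvectorBasis i j =
        ((‖hh.eigenvectorBasis i j‖ ^ 2 : ℝ) : ℂ) := fun j => by
      rw [RCLike.star_def, Complex.conj_mul']; push_cast; rfl
    simp_rw [this]
    exact_mod_cast h3
  · rw [hh.mulVec_eigenvectorBasis i]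
    ext j
    simp

/-- If `h ^ 2 ≥ g h` for a positive semidefinite `h`, then the nonzero eigenvalues of `h` are at
least `g`. -/
theorem gap_of_sq {h : Matrix ι ι ℂ} (hh : h.PosSemidef) {g : ℝ}
    (h2 : (h * h - (g : ℂ) • h).PosSemidef) : (h - (g : ℂ) • (1 - kerProj h)).PosSemidef := by
  refine posSemidef_sub_smul_of_eigenvalues hh.1 fun i hi => ?_
  have hpos : 0 < hh.1.eigenvalues i := lt_of_le_of_ne (hh.eigenvalues_nonneg i) (Ne.symm hi)
  obtain ⟨v, hvv, hev⟩ := exists_unit_eigenvector hh.1 i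
  have := h2.dotProduct_mulVec_nonneg v
  rw [sub_mulVec, ← mulVec_mulVec, smul_mulVec, hev, mulVec_smul, hev, smul_smul, smul_smul,
    ← sub_smul, dotProduct_smul, hvv, smul_eq_mul, mul_one] at this
  have h4 : (0 : ℝ) ≤ hh.1.eigenvalues i * hh.1.eigenvalues i - g * hh.1.eigenvalues i := by
    exact_mod_cast this
  nlinarith

end LinearAlgebra

/-! ### Angles between subspaces -/

section Angles

variable {E F H : Type*} [NormedAddCommGroup E] [InnerProductSpace ℂ E]
  [NormedAddCommGroup F] [InnerProductSpace ℂ F] [NormedAddCommGroup H] [InnerProductSpace ℂ H]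

/-- Polarization: a bound on a hermitian quadratic form bounds the sesquilinear form. -/
theorem norm_inner_map_sub_le (B : E →ₗ[ℂ] F) {κ δ : ℝ}
    (hB : ∀ v, |‖B v‖ ^ 2 - κ * ‖v‖ ^ 2| ≤ δ * ‖v‖ ^ 2) (x y : E) :
    ‖⟪B x, B y⟫_ℂ - κ * ⟪x, y⟫_ℂ‖ ≤ δ * (‖x‖ * ‖y‖) := by
  have re_le : ∀ x y : E,
      (⟪B x, B y⟫_ℂ - κ * ⟪x, y⟫_ℂ).re ≤ δ * ((‖x‖ ^ 2 + ‖y‖ ^ 2) / 2) := by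
    intro x y
    have h1 := (abs_le.1 (hB (x + y))).2
    have h2 := (abs_le.1 (hB (x - y))).1
    have e1 := @norm_add_sq ℂ E _ _ _ x y
    have e2 := @norm_sub_sq ℂ E _ _ _ x y
    have e3 := @norm_add_sq ℂ F _ _ _ (B x) (B y)
    have e4 := @norm_sub_sq ℂ F _ _ _ (B x) (B y)
    rw [map_add] at h1
    rw [map_sub] at h2
    rw [e1, e3] at h1
    rw [e2, e4] at h2
    simp only [RCLike.re_to_complex] at *
    rw [Complex.sub_re, Complex.re_ofReal_mul]
    linarith
  have norm_le : ∀ x y : E,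
      ‖⟪B x, B y⟫_ℂ - κ * ⟪x, y⟫_ℂ‖ ≤ δ * ((‖x‖ ^ 2 + ‖y‖ ^ 2) / 2) := by
    intro x y
    set z := ⟪B x, B y⟫_ℂ - κ * ⟪x, y⟫_ℂ with hz
    obtain ⟨c, hc, hcz⟩ := RCLike.exists_norm_eq_mul_self z
    have h1 := re_le x (c • y)
    have h2 : ⟪B x, B (c • y)⟫_ℂ - κ * ⟪x, c • y⟫_ℂ = c * z := by
      rw [map_smul, inner_smul_right, inner_smul_right, hz]; ring
    rw [h2, ← hcz, norm_smul, hc, one_mul] at h1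
    simpa using h1
  by_cases hx : x = 0
  · simp [hx]
  by_cases hy : y = 0
  · simp [hy]
  have hx' : 0 < ‖x‖ := norm_pos_iff.2 hx
  have hy' : 0 < ‖y‖ := norm_pos_iff.2 hy
  have h := norm_le ((‖x‖⁻¹ : ℂ) • x) ((‖y‖⁻¹ : ℂ) • y)
  have h2 : ⟪B ((‖x‖⁻¹ : ℂ) • x), B ((‖y‖⁻¹ : ℂ) • y)⟫_ℂ -
      κ * ⟪(‖x‖⁻¹ : ℂ) • x, (‖y‖⁻¹ : ℂ) • y⟫_ℂ =
      (‖x‖⁻¹ : ℂ) * (‖y‖⁻¹ : ℂ) * (⟪B x, B y⟫_ℂ - κ * ⟪x, y⟫_ℂ) := by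
    simp only [map_smul, inner_smul_right, inner_smul_left, map_inv₀, Complex.conj_ofReal]
    ring
  rw [h2] at h
  simp only [norm_mul, norm_inv, norm_smul, Complex.norm_real, norm_norm,
    inv_mul_cancel₀ hx'.ne', inv_mul_cancel₀ hy'.ne'] at h
  have h3 : ‖x‖⁻¹ * ‖y‖⁻¹ * ‖⟪B x, B y⟫_ℂ - κ * ⟪x, y⟫_ℂ‖ ≤ δ := by
    simpa using h
  calc _ = (‖x‖ * ‖y‖) * (‖x‖⁻¹ * ‖y‖⁻¹ * ‖⟪B x, B y⟫_ℂ - κ * ⟪x, y⟫_ℂ‖) := by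
        field_simp
    _ ≤ (‖x‖ * ‖y‖) * δ := by gcongr
    _ = _ := mul_comm _ _

/-- The angle between the ranges of two maps `A` and `B` which are nearly multiples of isometries,
when `⟪A ξ, B η⟫` is nearly `⟪G ξ, η⟫` and `B η` is orthogonal to `B (G ξ)`. -/
theorem norm_inner_le_of_near_isometry (A : E →ₗ[ℂ] H) (B : F →ₗ[ℂ] H) (G : E → F)
    {δ c₁ c₂ : ℝ} (hδ : δ < 2) (hδ0 : 0 ≤ δ) (hc₁ : 0 ≤ c₁) (hc₂ : 0 ≤ c₂)
    (hA : ∀ v, |‖A v‖ ^ 2 - 2 * ‖v‖ ^ 2| ≤ δ * ‖v‖ ^ 2)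
    (hB : ∀ v, |‖B v‖ ^ 2 - 2 * ‖v‖ ^ 2| ≤ δ * ‖v‖ ^ 2)
    (hG : ∀ v, ‖G v‖ ≤ c₂ * ‖v‖)
    (hAB : ∀ v w, ‖⟪A v, B w⟫_ℂ - ⟪G v, w⟫_ℂ‖ ≤ c₁ * (‖v‖ * ‖w‖))
    (v : E) (w : F) (h0 : ⟪B (G v), B w⟫_ℂ = 0) :
    ‖⟪A v, B w⟫_ℂ‖ ≤ (c₁ + c₂ * δ / 2) / (2 - δ) * (‖A v‖ * ‖B w‖) := by
  have h1 := norm_inner_map_sub_le B (κ := 2) hB (G v) w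
  rw [h0, zero_sub, norm_neg, norm_mul] at h1
  have h1' : 2 * ‖⟪G v, w⟫_ℂ‖ ≤ δ * (‖G v‖ * ‖w‖) := by simpa using h1
  have h2 : δ * (‖G v‖ * ‖w‖) ≤ δ * (c₂ * ‖v‖ * ‖w‖) := by gcongr; exact hG v
  have h3 : ‖⟪A v, B w⟫_ℂ‖ ≤ (c₁ + c₂ * δ / 2) * (‖v‖ * ‖w‖) := by
    have := norm_le_norm_add_norm_sub' (⟪A v, B w⟫_ℂ) (⟪G v, w⟫_ℂ)
    have := hAB v w
    nlinarith
  have hv := (abs_le.1 (hA v)).1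
  have hw := (abs_le.1 (hB w)).1
  have h4 : (2 - δ) * (‖v‖ * ‖w‖) ≤ ‖A v‖ * ‖B w‖ := by
    have hd : 0 < 2 - δ := by linarith
    refine le_of_sq_le_sq ?_ (by positivity)
    calc ((2 - δ) * (‖v‖ * ‖w‖)) ^ 2 = ((2 - δ) * ‖v‖ ^ 2) * ((2 - δ) * ‖w‖ ^ 2) := by ring
      _ ≤ ‖A v‖ ^ 2 * ‖B w‖ ^ 2 := by
        apply mul_le_mul <;> first | positivity | linarith
      _ = _ := by ring
  calc _ ≤ _ := h3
    _ = (c₁ + c₂ * δ / 2) / (2 - δ) * ((2 - δ) * (‖v‖ * ‖w‖)) := by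
      have : 2 - δ ≠ 0 := by linarith
      field_simp
    _ ≤ _ := by
      have : 0 < 2 - δ := by linarith
      gcongr

/-- If `U` and `W` form an angle with cosine at most `ε` apart from their intersection, then the
complementary projections `P` and `Q` satisfy `P Q + Q P ≥ - ε (P + Q)`. -/
theorem anticommutator_starProjection (U W : Submodule ℂ E) [FiniteDimensional ℂ E] {ε : ℝ}
    (hε : 0 ≤ ε)
    (h : ∀ x ∈ U, ∀ y ∈ W, (∀ k ∈ U, k ∈ W → ⟪k, y⟫_ℂ = 0) → ‖⟪x, y⟫_ℂ‖ ≤ ε * (‖x‖ * ‖y‖))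
    (z : E) :
    0 ≤ 2 * (⟪z - U.starProjection z, z - W.starProjection z⟫_ℂ).re +
      ε * (‖z - U.starProjection z‖ ^ 2 + ‖z - W.starProjection z‖ ^ 2) := by
  -- both projections fix `U ⊓ W`, so only its orthogonal complement matters
  have key : ∀ z : E, z ∈ (U ⊓ W)ᗮ →
      0 ≤ 2 * (⟪z - U.starProjection z, z - W.starProjection z⟫_ℂ).re +
      ε * (‖z - U.starProjection z‖ ^ 2 + ‖z - W.starProjection z‖ ^ 2) := by
    intro z hz
    set u := U.starProjection z with hu
    set w := W.starProjection z with hw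
    have huU : u ∈ U := Submodule.starProjection_apply_mem _ _
    have hwW : w ∈ W := Submodule.starProjection_apply_mem _ _
    have hzu : ⟪z, u⟫_ℂ = ⟪u, u⟫_ℂ := by
      have : ⟪z - u, u⟫_ℂ = 0 := by
        rw [hu]; exact Submodule.starProjection_inner_eq_zero z _ huU
      rwa [inner_sub_left, sub_eq_zero] at this
    have hzw : ⟪z, w⟫_ℂ = ⟪w, w⟫_ℂ := by
      have : ⟪z - w, w⟫_ℂ = 0 := by
        rw [hw]; exact Submodule.starProjection_inner_eq_zero z _ hwW
      rwa [inner_sub_left, sub_eq_zero] at this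
    have hort : ∀ k ∈ U, k ∈ W → ⟪k, w⟫_ℂ = 0 := by
      intro k hkU hkW
      have h1 : ⟪z - w, k⟫_ℂ = 0 := Submodule.starProjection_inner_eq_zero z _ hkW
      have h2 : ⟪k, z⟫_ℂ = 0 := hz k ⟨hkU, hkW⟩
      rw [← inner_conj_symm, map_eq_zero, inner_sub_right, h2, zero_sub, neg_eq_zero] at h1
      exact h1
    have huw := h u huU w hwW hort
    set a := ‖u‖ ^ 2 with ha
    set b := ‖w‖ ^ 2 with hb
    set Z := ‖z‖ ^ 2 with hZ
    set c := (⟪u, w⟫_ℂ).re with hc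
    have hruu : (⟪u, u⟫_ℂ).re = a := by rw [ha, ← inner_self_eq_norm_sq (𝕜 := ℂ)]; rfl
    have hrww : (⟪w, w⟫_ℂ).re = b := by rw [hb, ← inner_self_eq_norm_sq (𝕜 := ℂ)]; rfl
    have hrzz : (⟪z, z⟫_ℂ).re = Z := by rw [hZ, ← inner_self_eq_norm_sq (𝕜 := ℂ)]; rfl
    have e1 : ‖z - u‖ ^ 2 = Z - a := by
      rw [@norm_sub_sq ℂ E, hzu, RCLike.re_to_complex, hruu]; ring
    have e2 : ‖z - w‖ ^ 2 = Z - b := by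
      rw [@norm_sub_sq ℂ E, hzw, RCLike.re_to_complex, hrww]; ring
    have e3 : (⟪z - u, z - w⟫_ℂ).re = Z - a - b + c := by
      rw [inner_sub_left, inner_sub_right, inner_sub_right, hzw, ← inner_conj_symm u z, hzu]
      simp only [Complex.sub_re, Complex.conj_re, hruu, hrww, hrzz]
      rw [← hc]; ring
    have e4 : ‖u + w‖ ^ 2 = a + b + 2 * c := by
      rw [@norm_add_sq ℂ E, RCLike.re_to_complex]; ring
    have e5 : (⟪z, u + w⟫_ℂ).re = a + b := by
      rw [inner_add_right, hzu, hzw, Complex.add_re, hruu, hrww]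
    have hc1 : |c| ≤ ε * ((a + b) / 2) := by
      calc |c| ≤ ‖⟪u, w⟫_ℂ‖ := Complex.abs_re_le_norm _
        _ ≤ ε * (‖u‖ * ‖w‖) := huw
        _ ≤ _ := by
          gcongr
          nlinarith [sq_nonneg (‖u‖ - ‖w‖)]
    have hc2 : c ≤ ε * ((a + b) / 2) := (abs_le.1 hc1).2
    have cs : (a + b) ^ 2 ≤ Z * (a + b + 2 * c) := by
      rw [← e4, ← e5, hZ, ← mul_pow, ← sq_abs]
      gcongr
      exact (Complex.abs_re_le_norm _).trans (norm_inner_le_norm _ _)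
    have ha0 : 0 ≤ a := sq_nonneg _
    have hb0 : 0 ≤ b := sq_nonneg _
    have hZ0 : 0 ≤ Z := sq_nonneg _
    have hZa : 0 ≤ Z - a := by rw [← e1]; positivity
    have hZb : 0 ≤ Z - b := by rw [← e2]; positivity
    rw [e1, e2, e3]
    -- With `s = a + b`, Cauchy–Schwarz says `s ^ 2 ≤ Z * (s + 2 * c)` and the angle bound says
    -- `2 * c ≤ ε * s`, whence `s ≤ (1 + ε) * Z`. The claim times `Z` follows from
    -- `(2 * Z - s) * ((1 + ε) * Z - s) ≥ 0` and the first of these inequalities.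
    set s := a + b with hs
    have hs0 : 0 ≤ s := by positivity
    have hs2 : s ≤ 2 * Z := by linarith
    rcases eq_or_lt_of_le hZ0 with hZ0 | hZ0
    · have h1 : a = 0 := by linarith
      have h2 : b = 0 := by linarith
      have h3 : c = 0 := by
        have : s = 0 := by linarith
        rw [this] at hc1
        simpa using hc1
      rw [h1, h2, h3, ← hZ0]; simp
    · have h1 : s ≤ (1 + ε) * Z := by
        rcases eq_or_lt_of_le hs0 with h0 | h0
        · rw [← h0]; positivity
        · have : s * s ≤ s * ((1 + ε) * Z) := by nlinarith
          exact le_of_mul_le_mul_left this h0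
      have h2 : 0 ≤ (2 * Z - s) * ((1 + ε) * Z - s) :=
        mul_nonneg (by linarith) (by linarith)
      have h3 : 0 ≤ Z * (2 * (Z - a - b + c) + ε * (Z - a + (Z - b))) := by
        have : b = s - a := by rw [hs]; ring
        rw [this]
        nlinarith
      exact nonneg_of_mul_nonneg_right h3 hZ0
  set k := (U ⊓ W).starProjection z with hk
  have hkm : k ∈ U ⊓ W := Submodule.starProjection_apply_mem _ _
  have hz' : z - k ∈ (U ⊓ W)ᗮ := Submodule.sub_starProjection_mem_orthogonal z
  have := key (z - k) hz'
  rw [map_sub, map_sub, Submodule.starProjection_eq_self_iff.2 hkm.1,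
    Submodule.starProjection_eq_self_iff.2 hkm.2, sub_sub_sub_cancel_right,
    sub_sub_sub_cancel_right] at this
  exact this

end Angles

section LinearAlgebra

variable {ι : Type*} [Fintype ι] [DecidableEq ι]

theorem mem_ker_toEuclideanLin (h : Matrix ι ι ℂ) (x : EuclideanSpace ℂ ι) :
    x ∈ LinearMap.ker (toEuclideanLin h) ↔ h *ᵥ x.ofLp = 0 := by
  rw [LinearMap.mem_ker, ← coe_toEuclideanCLM_eq_toEuclideanLin]
  exact (WithLp.ofLp_injective 2).eq_iff.symm

/-- The matrix of the orthogonal projection onto the orthogonal complement of the kernel of `h`. -/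
noncomputable def kerProjCompl (h : Matrix ι ι ℂ) : Matrix ι ι ℂ := 1 - kerProj h

theorem kerProjCompl_isHermitian (h : Matrix ι ι ℂ) : (kerProjCompl h).IsHermitian :=
  isHermitian_one.sub (kerProj_isHermitian h)

theorem kerProjCompl_mul_self (h : Matrix ι ι ℂ) :
    kerProjCompl h * kerProjCompl h = kerProjCompl h := by
  rw [kerProjCompl, Matrix.sub_mul, Matrix.mul_sub (kerProj h), kerProj_mul_self]
  simp

theorem kerProjCompl_posSemidef (h : Matrix ι ι ℂ) : (kerProjCompl h).PosSemidef := by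
  rw [← kerProjCompl_mul_self]
  nth_rewrite 1 [← (kerProjCompl_isHermitian h).eq]
  exact posSemidef_conjTranspose_mul_self _

theorem kerProjCompl_mulVec_eq_zero (h : Matrix ι ι ℂ) (x : ι → ℂ) :
    kerProjCompl h *ᵥ x = 0 ↔ h *ᵥ x = 0 := by
  rw [kerProjCompl, sub_mulVec, one_mulVec, sub_eq_zero, eq_comm, kerProj_mulVec_eq_self]

/-- An angle bound for the kernels of two matrices, turned into a bound on the anticommutator of the
complementary projections. -/
theorem anticommutator_kerProjCompl (h₁ h₂ : Matrix ι ι ℂ) {ε : ℝ} (hε : 0 ≤ ε)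
    (h : ∀ x y : EuclideanSpace ℂ ι, h₁ *ᵥ x.ofLp = 0 → h₂ *ᵥ y.ofLp = 0 →
      (∀ k : EuclideanSpace ℂ ι, h₁ *ᵥ k.ofLp = 0 → h₂ *ᵥ k.ofLp = 0 → ⟪k, y⟫_ℂ = 0) →
      ‖⟪x, y⟫_ℂ‖ ≤ ε * (‖x‖ * ‖y‖)) :
    (kerProjCompl h₁ * kerProjCompl h₂ + kerProjCompl h₂ * kerProjCompl h₁ +
      (ε : ℂ) • (kerProjCompl h₁ + kerProjCompl h₂)).PosSemidef := by
  set P := kerProjCompl h₁ with hP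
  set Q := kerProjCompl h₂ with hQ
  have hPs : ∀ z : EuclideanSpace ℂ ι, toEuclideanLin P z =
      z - (LinearMap.ker (toEuclideanLin h₁)).starProjection z := fun z => by
    rw [← toEuclideanCLM_kerProj, hP, kerProjCompl, map_sub]
    rw [LinearMap.sub_apply, ← coe_toEuclideanCLM_eq_toEuclideanLin,
      ← coe_toEuclideanCLM_eq_toEuclideanLin, map_one]
    rfl
  have hQs : ∀ z : EuclideanSpace ℂ ι, toEuclideanLin Q z =
      z - (LinearMap.ker (toEuclideanLin h₂)).starProjection z := fun z => by
    rw [← toEuclideanCLM_kerProj, hQ, kerProjCompl, map_sub]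
    rw [LinearMap.sub_apply, ← coe_toEuclideanCLM_eq_toEuclideanLin,
      ← coe_toEuclideanCLM_eq_toEuclideanLin, map_one]
    rfl
  have hPh : P.IsHermitian := kerProjCompl_isHermitian _
  have hQh : Q.IsHermitian := kerProjCompl_isHermitian _
  have hsym : ∀ {M : Matrix ι ι ℂ}, M.IsHermitian → ∀ x y : EuclideanSpace ℂ ι,
      ⟪toEuclideanLin M x, y⟫_ℂ = ⟪x, toEuclideanLin M y⟫_ℂ := fun hM =>
    isSymmetric_toEuclideanLin_iff.2 hM
  have hmul : ∀ (M N : Matrix ι ι ℂ) (x : EuclideanSpace ℂ ι),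
      toEuclideanLin (M * N) x = toEuclideanLin M (toEuclideanLin N x) := fun M N x => by
    simp only [← coe_toEuclideanCLM_eq_toEuclideanLin, map_mul]; rfl
  have hPP : P * P = P := kerProjCompl_mul_self _
  have hQQ : Q * Q = Q := kerProjCompl_mul_self _
  rw [← isPositive_toEuclideanLin_iff]
  refine ⟨?_, fun z => ?_⟩
  · rw [isSymmetric_toEuclideanLin_iff]
    unfold IsHermitian
    rw [conjTranspose_add, conjTranspose_add, conjTranspose_mul, conjTranspose_mul,
      conjTranspose_smul, conjTranspose_add, hPh.eq, hQh.eq, add_comm (Q * P)]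
    simp
  · have := anticommutator_starProjection (LinearMap.ker (toEuclideanLin h₁))
      (LinearMap.ker (toEuclideanLin h₂)) hε (fun x hx y hy hk =>
        h x y ((mem_ker_toEuclideanLin _ _).1 hx) ((mem_ker_toEuclideanLin _ _).1 hy)
          fun k hk1 hk2 => hk k ((mem_ker_toEuclideanLin _ _).2 hk1)
            ((mem_ker_toEuclideanLin _ _).2 hk2)) z
    rw [← hPs, ← hQs] at this
    have e1 : ⟪toEuclideanLin (P * Q) z, z⟫_ℂ = ⟪toEuclideanLin Q z, toEuclideanLin P z⟫_ℂ := by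
      rw [hmul, hsym hPh]
    have e2 : ⟪toEuclideanLin (Q * P) z, z⟫_ℂ = ⟪toEuclideanLin P z, toEuclideanLin Q z⟫_ℂ := by
      rw [hmul, hsym hQh]
    have e3 : ⟪toEuclideanLin P z, z⟫_ℂ = (‖toEuclideanLin P z‖ ^ 2 : ℝ) := by
      nth_rewrite 1 [← hPP]; rw [hmul, hsym hPh, inner_self_eq_norm_sq_to_K]; push_cast; rfl
    have e4 : ⟪toEuclideanLin Q z, z⟫_ℂ = (‖toEuclideanLin Q z‖ ^ 2 : ℝ) := by
      nth_rewrite 1 [← hQQ]; rw [hmul, hsym hQh, inner_self_eq_norm_sq_to_K]; push_cast; rfl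
    rw [map_add, map_add, map_smul, map_add, LinearMap.add_apply, LinearMap.add_apply,
      LinearMap.smul_apply, LinearMap.add_apply, inner_add_left, inner_add_left, inner_smul_left,
      inner_add_left, e1, e2, e3, e4, ← inner_conj_symm (toEuclideanLin Q z)]
    simp only [RCLike.re_to_complex, Complex.add_re, Complex.conj_re, Complex.conj_ofReal]
    rw [← Complex.ofReal_add, ← Complex.ofReal_mul, Complex.ofReal_re]
    linarith

end LinearAlgebra

/-! ### Operators that act on some of the sites -/

section Embed

variable {S V U : Type*}

open Classical in
/-- The operator `A` on the sites `S`, carried to the sites `f '' S` and tensored with the identity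
at all other sites of `V`. -/
noncomputable def embed (twoS : V → ℕ) (f : S → V)
    (A : Matrix (SpinConfig fun s => twoS (f s)) (SpinConfig fun s => twoS (f s)) ℂ) :
    Matrix (SpinConfig twoS) (SpinConfig twoS) ℂ :=
  Matrix.of fun σ τ =>
    if ∀ w, w ∉ Set.range f → σ w = τ w then A (fun s => σ (f s)) (fun s => τ (f s)) else 0

open Classical in
/-- The configuration `σ` with the values at the sites `f x` replaced by `s x`. -/
noncomputable def glue {twoS : V → ℕ} (f : S → V) (σ : SpinConfig twoS)
    (s : SpinConfig fun x => twoS (f x)) : SpinConfig twoS :=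
  fun w => if h : ∃ x, f x = w then h.choose_spec ▸ s h.choose else σ w

variable {twoS : V → ℕ} {f : S → V}

theorem glue_apply (hf : Function.Injective f) (σ : SpinConfig twoS)
    (s : SpinConfig fun x => twoS (f x)) (x : S) : glue f σ s (f x) = s x := by
  have h : ∃ y, f y = f x := ⟨x, rfl⟩
  rw [glue, dif_pos h]
  have key : ∀ (y : S) (e : f y = f x), (e ▸ s y : Fin (twoS (f x) + 1)) = s x := by
    intro y e
    obtain rfl := hf e
    rfl
  exact key _ _

theorem glue_of_notMem (σ : SpinConfig twoS) (s : SpinConfig fun x => twoS (f x)) {w : V}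
    (h : w ∉ Set.range f) : glue f σ s w = σ w := by
  rw [glue, dif_neg]
  exact h

theorem eq_glue (hf : Function.Injective f) {σ τ : SpinConfig twoS}
    (h : ∀ w, w ∉ Set.range f → σ w = τ w) : glue f σ (fun x => τ (f x)) = τ := by
  funext w
  by_cases hw : w ∈ Set.range f
  · obtain ⟨x, rfl⟩ := hw
    rw [glue_apply hf]
  · rw [glue_of_notMem _ _ hw, h w hw]

open Classical in
theorem sum_ite_eq_sum_glue [Fintype S] [Fintype V] [DecidableEq S] [DecidableEq V] (hf : Function.Injective f)
    (σ : SpinConfig twoS) (F : SpinConfig twoS → ℂ) :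
    ∑ τ, (if ∀ w, w ∉ Set.range f → σ w = τ w then F τ else 0) = ∑ s, F (glue f σ s) := by
  rw [← Finset.sum_filter]
  symm
  refine Finset.sum_bij' (fun s _ => glue f σ s) (fun τ _ => fun x => τ (f x)) ?_ ?_ ?_ ?_ ?_
  · intro s _
    simp only [Finset.mem_filter, Finset.mem_univ, true_and]
    intro w hw
    rw [glue_of_notMem _ _ hw]
  · intro _ _
    exact Finset.mem_univ _
  · intro s _
    funext x
    exact glue_apply hf σ s x
  · intro τ hτ
    exact eq_glue hf (Finset.mem_filter.1 hτ).2
  · intro _ _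
    rfl

variable [Fintype S] [Fintype V] [Fintype U] [DecidableEq S] [DecidableEq V] [DecidableEq U]

theorem embed_mulVec (hf : Function.Injective f)
    (A : Matrix (SpinConfig fun s => twoS (f s)) (SpinConfig fun s => twoS (f s)) ℂ)
    (ψ : SpinConfig twoS → ℂ) (σ : SpinConfig twoS) :
    (embed twoS f A *ᵥ ψ) σ = (A *ᵥ fun s => ψ (glue f σ s)) fun x => σ (f x) := by
  simp only [mulVec, dotProduct, embed, of_apply, ite_mul, zero_mul]
  rw [sum_ite_eq_sum_glue hf]
  simp only [glue_apply hf]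

theorem embed_mulVec_eq_zero (hf : Function.Injective f)
    (A : Matrix (SpinConfig fun s => twoS (f s)) (SpinConfig fun s => twoS (f s)) ℂ)
    (ψ : SpinConfig twoS → ℂ) :
    embed twoS f A *ᵥ ψ = 0 ↔ ∀ σ, (A *ᵥ fun s => ψ (glue f σ s)) = 0 := by
  constructor
  · intro h σ
    funext s
    have := congrFun h (glue f σ s)
    rw [embed_mulVec hf] at this
    simp only [glue_apply hf] at this
    have e : ∀ s', glue f (glue f σ s) s' = glue f σ s' := fun s' => by
      funext w
      by_cases hw : w ∈ Set.range f
      · obtain ⟨x, rfl⟩ := hw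
        rw [glue_apply hf, glue_apply hf]
      · simp only [glue_of_notMem _ _ hw]
    simp only [e] at this
    exact this
  · intro h
    funext σ
    rw [embed_mulVec hf, h]
    rfl

theorem embed_add (A B : Matrix (SpinConfig fun s => twoS (f s)) (SpinConfig fun s => twoS (f s)) ℂ) :
    embed twoS f (A + B) = embed twoS f A + embed twoS f B := by
  ext σ τ
  simp only [embed, of_apply, Matrix.add_apply]
  split_ifs <;> simp

theorem embed_smul (c : ℂ)
    (A : Matrix (SpinConfig fun s => twoS (f s)) (SpinConfig fun s => twoS (f s)) ℂ) :
    embed twoS f (c • A) = c • embed twoS f A := by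
  ext σ τ
  simp only [embed, of_apply, Matrix.smul_apply]
  split_ifs <;> simp

theorem embed_sub (A B : Matrix (SpinConfig fun s => twoS (f s)) (SpinConfig fun s => twoS (f s)) ℂ) :
    embed twoS f (A - B) = embed twoS f A - embed twoS f B := by
  ext σ τ
  simp only [embed, of_apply, Matrix.sub_apply]
  split_ifs <;> simp

theorem embed_sum {κ : Type*} (s : Finset κ)
    (A : κ → Matrix (SpinConfig fun s => twoS (f s)) (SpinConfig fun s => twoS (f s)) ℂ) :
    embed twoS f (∑ i ∈ s, A i) = ∑ i ∈ s, embed twoS f (A i) := by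
  classical
  induction s using Finset.induction_on with
  | empty =>
    ext σ τ
    simp [embed]
  | insert i s hi ih => rw [Finset.sum_insert hi, Finset.sum_insert hi, embed_add, ih]

theorem embed_conjTranspose
    (A : Matrix (SpinConfig fun s => twoS (f s)) (SpinConfig fun s => twoS (f s)) ℂ) :
    embed twoS f Aᴴ = (embed twoS f A)ᴴ := by
  ext σ τ
  simp only [embed, of_apply, conjTranspose_apply, eq_comm (a := σ _)]
  split_ifs <;> simp

theorem embed_one : embed twoS f 1 = 1 := by
  ext σ τ
  simp only [embed, of_apply, one_apply]
  by_cases h : σ = τ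
  · subst h; simp
  · rw [if_neg h]
    split_ifs with h1 h2
    · exfalso
      apply h
      funext w
      by_cases hw : w ∈ Set.range f
      · obtain ⟨x, rfl⟩ := hw
        exact congrFun h2 x
      · exact h1 w hw
    · rfl
    · rfl

theorem embed_mul (hf : Function.Injective f)
    (A B : Matrix (SpinConfig fun s => twoS (f s)) (SpinConfig fun s => twoS (f s)) ℂ) :
    embed twoS f (A * B) = embed twoS f A * embed twoS f B := by
  refine Matrix.ext_of_mulVec_single fun τ => ?_
  rw [← mulVec_mulVec]
  funext σ
  rw [embed_mulVec hf, embed_mulVec hf, ← mulVec_mulVec]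
  congr 2
  funext s
  rw [embed_mulVec hf]
  simp only [glue_apply hf]
  congr 2
  funext s'
  congr 1
  funext w
  by_cases hw : w ∈ Set.range f
  · obtain ⟨x, rfl⟩ := hw
    rw [glue_apply hf, glue_apply hf]
  · simp only [glue_of_notMem _ _ hw]

theorem embed_posSemidef (hf : Function.Injective f)
    {A : Matrix (SpinConfig fun s => twoS (f s)) (SpinConfig fun s => twoS (f s)) ℂ}
    (hA : A.PosSemidef) : (embed twoS f A).PosSemidef := by
  open MatrixOrder in
  obtain ⟨B, rfl⟩ := CStarAlgebra.nonneg_iff_eq_star_mul_self.mp hA.nonneg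
  rw [star_eq_conjTranspose, embed_mul hf, embed_conjTranspose]
  exact posSemidef_conjTranspose_mul_self _

theorem embed_kerProj (hf : Function.Injective f)
    (h : Matrix (SpinConfig fun s => twoS (f s)) (SpinConfig fun s => twoS (f s)) ℂ) :
    embed twoS f (kerProj h) = kerProj (embed twoS f h) := by
  refine eq_kerProj ?_ ?_ fun x => ?_
  · unfold IsHermitian
    rw [← embed_conjTranspose, (kerProj_isHermitian h).eq]
  · rw [← embed_mul hf, kerProj_mul_self]
  · rw [embed_mulVec_eq_zero hf, ← sub_eq_zero]
    have : embed twoS f (kerProj h) *ᵥ x - x = embed twoS f (kerProj h - 1) *ᵥ x := by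
      rw [embed_sub, embed_one, sub_mulVec, one_mulVec]
    rw [this, embed_mulVec_eq_zero hf]
    refine forall_congr' fun σ => ?_
    rw [sub_mulVec, one_mulVec, sub_eq_zero, kerProj_mulVec_eq_self]

theorem embed_kerProjCompl (hf : Function.Injective f)
    (h : Matrix (SpinConfig fun s => twoS (f s)) (SpinConfig fun s => twoS (f s)) ℂ) :
    embed twoS f (kerProjCompl h) = kerProjCompl (embed twoS f h) := by
  rw [kerProjCompl, kerProjCompl, embed_sub, embed_one, embed_kerProj hf]

theorem embed_siteOp (hf : Function.Injective f) (s : S)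
    (A : Matrix (Fin (twoS (f s) + 1)) (Fin (twoS (f s) + 1)) ℂ) :
    embed twoS f (siteOp (fun x => twoS (f x)) s A) = siteOp twoS (f s) A := by
  ext σ τ
  simp only [embed, siteOp, of_apply]
  by_cases h : ∀ w, w ≠ f s → σ w = τ w
  · rw [if_pos h, if_pos, if_pos]
    · intro x hx
      exact h _ (hf.ne hx)
    · intro w hw
      refine h _ ?_
      rintro rfl
      exact hw ⟨s, rfl⟩
  · rw [if_neg h]
    split_ifs with h1 h2
    · exfalso
      apply h
      intro w hw
      by_cases hw' : w ∈ Set.range f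
      · obtain ⟨x, rfl⟩ := hw'
        exact h2 x (fun e => hw (e ▸ rfl))
      · exact h1 w hw'
    · rfl
    · rfl

/-- Operators at disjoint sets of sites commute. -/
theorem embed_commute {g : U → V} (hf : Function.Injective f) (hg : Function.Injective g)
    (hfg : ∀ x y, f x ≠ g y)
    (A : Matrix (SpinConfig fun s => twoS (f s)) (SpinConfig fun s => twoS (f s)) ℂ)
    (B : Matrix (SpinConfig fun s => twoS (g s)) (SpinConfig fun s => twoS (g s)) ℂ) :
    Commute (embed twoS f A) (embed twoS g B) := by
  have key : ∀ ψ σ, (embed twoS f A *ᵥ (embed twoS g B *ᵥ ψ)) σ =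
      ∑ s, ∑ t, A (fun x => σ (f x)) s * (B (fun y => σ (g y)) t * ψ (glue g (glue f σ s) t)) := by
    intro ψ σ
    rw [embed_mulVec hf]
    simp only [mulVec, dotProduct]
    refine Finset.sum_congr rfl fun s _ => ?_
    have := embed_mulVec hg B ψ (glue f σ s)
    simp only [mulVec, dotProduct] at this
    rw [this, Finset.mul_sum]
    refine Finset.sum_congr rfl fun t _ => ?_
    have e : ∀ y, glue f σ s (g y) = σ (g y) := fun y =>
      glue_of_notMem _ _ fun ⟨x, hx⟩ => hfg x y hx
    simp only [e]
  have key' : ∀ ψ σ, (embed twoS g B *ᵥ (embed twoS f A *ᵥ ψ)) σ =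
      ∑ t, ∑ s, B (fun x => σ (g x)) t * (A (fun y => σ (f y)) s * ψ (glue f (glue g σ t) s)) := by
    intro ψ σ
    rw [embed_mulVec hg]
    simp only [mulVec, dotProduct]
    refine Finset.sum_congr rfl fun s _ => ?_
    have := embed_mulVec hf A ψ (glue g σ s)
    simp only [mulVec, dotProduct] at this
    rw [this, Finset.mul_sum]
    refine Finset.sum_congr rfl fun t _ => ?_
    have e : ∀ y, glue g σ s (f y) = σ (f y) := fun y =>
      glue_of_notMem _ _ fun ⟨x, hx⟩ => hfg y x hx.symm
    simp only [e]
  refine Matrix.ext_of_mulVec_single fun τ => ?_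
  rw [← mulVec_mulVec, ← mulVec_mulVec]
  funext σ
  rw [key, key', Finset.sum_comm]
  refine Finset.sum_congr rfl fun t _ => Finset.sum_congr rfl fun s _ => ?_
  have e : glue g (glue f σ s) t = glue f (glue g σ t) s := by
    funext w
    by_cases h1 : w ∈ Set.range f
    · obtain ⟨x, rfl⟩ := h1
      rw [glue_apply hf, glue_of_notMem _ _ (fun ⟨y, hy⟩ => hfg x y hy.symm), glue_apply hf]
    · rw [glue_of_notMem (glue g σ t) s h1]
      by_cases h2 : w ∈ Set.range g
      · obtain ⟨x, rfl⟩ := h2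
        rw [glue_apply hg, glue_apply hg]
      · rw [glue_of_notMem _ _ h2, glue_of_notMem _ _ h2, glue_of_notMem _ _ h1]
  rw [e]
  ring

end Embed

/-! ### The edge projections -/

section Edge

variable {S V : Type*} [Fintype S] [DecidableEq S] [Fintype V] [DecidableEq V]

/-- The difference between the largest value of the square of the total spin of the sites `x` and
`y`, and this operator. -/
noncomputable def edgeDefect (twoS : V → ℕ) (x y : V) : Matrix (SpinConfig twoS) (SpinConfig twoS) ℂ :=
  (((twoS x + twoS y : ℝ) / 2 * ((twoS x + twoS y : ℝ) / 2 + 1) : ℝ) : ℂ) • 1 -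
    ∑ a : Fin 3, (siteOp twoS x (spinMatrix (twoS x) a) + siteOp twoS y (spinMatrix (twoS y) a)) *
      (siteOp twoS x (spinMatrix (twoS x) a) + siteOp twoS y (spinMatrix (twoS y) a))

/-- The projection onto the largest total spin of the sites `x` and `y`. -/
noncomputable def edgeProj (twoS : V → ℕ) (x y : V) : Matrix (SpinConfig twoS) (SpinConfig twoS) ℂ :=
  kerProj (edgeDefect twoS x y)

theorem embed_edgeDefect {twoS : V → ℕ} {f : S → V} (hf : Function.Injective f) (x y : S) :
    embed twoS f (edgeDefect (fun s => twoS (f s)) x y) = edgeDefect twoS (f x) (f y) := by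
  rw [edgeDefect, edgeDefect, embed_sub, embed_smul, embed_one, embed_sum]
  simp only [embed_mul hf, embed_add, embed_siteOp hf]

theorem embed_edgeProj {twoS : V → ℕ} {f : S → V} (hf : Function.Injective f) (x y : S) :
    embed twoS f (edgeProj (fun s => twoS (f s)) x y) = edgeProj twoS (f x) (f y) := by
  rw [edgeProj, edgeProj, embed_kerProj hf, embed_edgeDefect hf]

theorem edgeTotalSpinSq_mk (twoS : V → ℕ) {x y : V} (hxy : x ≠ y) :
    edgeTotalSpinSq twoS s(x, y) = ∑ a : Fin 3,
      (siteOp twoS x (spinMatrix (twoS x) a) + siteOp twoS y (spinMatrix (twoS y) a)) *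
      (siteOp twoS x (spinMatrix (twoS x) a) + siteOp twoS y (spinMatrix (twoS y) a)) := by
  rw [edgeTotalSpinSq]
  refine Finset.sum_congr rfl fun a _ => ?_
  have : (Finset.univ.filter fun v => v ∈ s(x, y)) = {x, y} := by
    ext v; simp
  rw [this, Finset.sum_pair hxy, sq]

/-- The projections of the Hamiltonian, as matrices. -/
theorem starProjection_edgeSpinSubspace (twoS : V → ℕ) {x y : V} (hxy : x ≠ y) {j : ℝ}
    (hj : j = (twoS x + twoS y : ℝ) / 2) :
    (edgeSpinSubspace twoS s(x, y) j).starProjection =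
      toEuclideanCLM (n := SpinConfig twoS) (𝕜 := ℂ) (edgeProj twoS x y) := by
  rw [edgeProj, toEuclideanCLM_kerProj]
  congr 1
  ext v
  rw [mem_ker_toEuclideanLin, edgeSpinSubspace, Module.End.mem_eigenspace_iff, edgeDefect,
    ← edgeTotalSpinSq_mk twoS hxy, sub_mulVec, smul_mulVec, one_mulVec, sub_eq_zero, ← hj,
    ← (WithLp.ofLp_injective 2).eq_iff, eq_comm]
  rfl

end Edge

/-! ### The kernel of an edge projection -/

section Spin

/-- The weight `√(d.choose k)` of the component of a spin `d / 2` that is lowered `k` times. In the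
coordinates divided by these weights the spin matrices are free of square roots. -/
noncomputable def binomWeight (d k : ℕ) : ℂ := ((Real.sqrt (d.choose k) : ℝ) : ℂ)

theorem binomWeight_ne_zero {d k : ℕ} (h : k ≤ d) : binomWeight d k ≠ 0 := by
  rw [binomWeight, Complex.ofReal_ne_zero]
  exact (Real.sqrt_pos.2 (by exact_mod_cast Nat.choose_pos h)).ne'

theorem conj_binomWeight (d k : ℕ) : star (binomWeight d k) = binomWeight d k :=
  Complex.conj_ofReal _

theorem sqrt_mul_binomWeight_succ {d k : ℕ} (h : k + 1 ≤ d) :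
    ((Real.sqrt ((k + 1 : ℕ) * ((d : ℝ) + 1 - (k + 1 : ℕ))) : ℝ) : ℂ) * binomWeight d (k + 1) =
      ((d : ℂ) - k) * binomWeight d k := by
  have hk : (0 : ℝ) ≤ (d : ℝ) - k := by
    have : (k : ℝ) ≤ d := by exact_mod_cast (by omega : k ≤ d)
    linarith
  have key : ((k : ℝ) + 1) * (d.choose (k + 1)) = ((d : ℝ) - k) * d.choose k := by
    have := Nat.choose_succ_right_eq d k
    have h2 : ((d.choose (k + 1) : ℝ)) * (k + 1) = d.choose k * ((d - k : ℕ) : ℝ) := by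
      exact_mod_cast this
    rw [Nat.cast_sub (by omega)] at h2
    linarith
  have : Real.sqrt ((k + 1 : ℕ) * ((d : ℝ) + 1 - (k + 1 : ℕ))) * Real.sqrt (d.choose (k + 1)) =
      ((d : ℝ) - k) * Real.sqrt (d.choose k) := by
    rw [← Real.sqrt_mul' _ (by positivity)]
    have e : ((k + 1 : ℕ) : ℝ) * ((d : ℝ) + 1 - (k + 1 : ℕ)) * (d.choose (k + 1)) =
        ((d : ℝ) - k) ^ 2 * d.choose k := by
      push_cast
      calc _ = ((d : ℝ) - k) * (((k : ℝ) + 1) * (d.choose (k + 1))) := by ring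
        _ = _ := by rw [key]; ring
    rw [e, Real.sqrt_mul (by positivity), Real.sqrt_sq hk]
  rw [binomWeight, binomWeight, ← Complex.ofReal_mul, this]
  push_cast; ring

theorem sqrt_mul_binomWeight {d k : ℕ} (h : k + 1 ≤ d) :
    ((Real.sqrt ((k + 1 : ℕ) * ((d : ℝ) + 1 - (k + 1 : ℕ))) : ℝ) : ℂ) * binomWeight d k =
      ((k : ℂ) + 1) * binomWeight d (k + 1) := by
  have h1 := sqrt_mul_binomWeight_succ h
  set s : ℂ := ((Real.sqrt ((k + 1 : ℕ) * ((d : ℝ) + 1 - (k + 1 : ℕ))) : ℝ) : ℂ) with hs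
  have hss : s * s = ((k : ℂ) + 1) * ((d : ℂ) - k) := by
    rw [hs, ← Complex.ofReal_mul, Real.mul_self_sqrt]
    · push_cast; ring
    · have : ((k + 1 : ℕ) : ℝ) ≤ d := by exact_mod_cast h
      have : (0 : ℝ) ≤ (d : ℝ) + 1 - (k + 1 : ℕ) := by linarith
      positivity
  have hdk : ((d : ℂ) - k) ≠ 0 := by
    rw [sub_ne_zero]
    exact_mod_cast (by omega : d ≠ k)
  apply mul_left_cancel₀ hdk
  calc ((d : ℂ) - k) * (s * binomWeight d k) = s * (((d : ℂ) - k) * binomWeight d k) := by ring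
    _ = (s * s) * binomWeight d (k + 1) := by rw [← h1]; ring
    _ = _ := by rw [hss]; ring

theorem spinRaise_mulVec (d : ℕ) (g : ℕ → ℂ) (j : Fin (d + 1)) :
    ∑ k, spinRaise d j k * (binomWeight d k * g k) =
      binomWeight d j * (((d : ℂ) - (j : ℕ)) * g ((j : ℕ) + 1)) := by
  by_cases hj : (j : ℕ) + 1 ≤ d
  · rw [Finset.sum_eq_single (⟨(j : ℕ) + 1, by omega⟩ : Fin (d + 1))]
    · have := sqrt_mul_binomWeight_succ hj
      simp only [spinRaise, of_apply, if_true]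
      calc _ = _ := (mul_assoc _ _ _).symm
        _ = _ := by rw [this]; ring
    · intro k _ hk
      have : ¬ (j : ℕ) + 1 = k := fun e => hk (Fin.ext e.symm)
      simp [spinRaise, this]
    · simp
  · have : (j : ℕ) = d := by omega
    rw [this, sub_self, zero_mul, mul_zero]
    refine Finset.sum_eq_zero fun k _ => ?_
    have : ¬ (j : ℕ) + 1 = k := by omega
    simp [spinRaise, this]

theorem spinLower_mulVec (d : ℕ) (g : ℕ → ℂ) (j : Fin (d + 1)) :
    ∑ k, (spinRaise d)ᴴ j k * (binomWeight d k * g k) =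
      binomWeight d j * ((j : ℕ) * g ((j : ℕ) - 1)) := by
  obtain ⟨j, hj⟩ := j
  cases j with
  | zero =>
    simp only [Nat.cast_zero, zero_mul, mul_zero]
    refine Finset.sum_eq_zero fun k _ => ?_
    simp [spinRaise]
  | succ j =>
    rw [Finset.sum_eq_single (⟨j, by omega⟩ : Fin (d + 1))]
    · have := sqrt_mul_binomWeight (d := d) (k := j) (by omega)
      simp only [spinRaise, of_apply, if_true, conjTranspose_apply]
      rw [RCLike.star_def, Complex.conj_ofReal]
      calc _ = _ := (mul_assoc _ _ _).symm
        _ = _ := by rw [this]; push_cast; ring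
    · intro k _ hk
      have : ¬ (k : ℕ) = j := fun e => hk (Fin.ext e)
      simp [spinRaise, this]
    · simp

theorem spinZ_mulVec (d : ℕ) (g : ℕ → ℂ) (j : Fin (d + 1)) :
    ∑ k, spinZ d j k * (binomWeight d k * g k) =
      binomWeight d j * (((d : ℂ) / 2 - (j : ℕ)) * g j) := by
  rw [Finset.sum_eq_single j]
  · simp [spinZ]; ring
  · intro k _ hk
    simp [spinZ, diagonal_apply_ne _ hk.symm]
  · simp

/-- `∑ₐ Sᵃ Tᵃ` in terms of raising and lowering operators. -/
theorem sum_mul_spin {A : Type*} [Ring A] [Algebra ℂ A] (r r' z t t' w : A) :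
    ((1 / 2 : ℂ) • (r + r')) * ((1 / 2 : ℂ) • (t + t')) +
      ((1 / (2 * Complex.I) : ℂ) • (r - r')) * ((1 / (2 * Complex.I) : ℂ) • (t - t')) + z * w =
    (1 / 2 : ℂ) • (r * t' + r' * t) + z * w := by
  have h : (1 / (2 * Complex.I) : ℂ) * (1 / (2 * Complex.I) : ℂ) = - (1 / 4) := by
    field_simp; rw [Complex.I_sq]; norm_num
  rw [smul_mul_smul_comm, smul_mul_smul_comm, h]
  simp only [add_mul, mul_add, sub_mul, mul_sub]
  module

/-- The Casimir operator is a scalar. -/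
theorem sum_spinMatrix_mul_self (d : ℕ) :
    ∑ a, spinMatrix d a * spinMatrix d a = ((d : ℂ) / 2 * ((d : ℂ) / 2 + 1)) • 1 := by
  rw [Fin.sum_univ_three]
  simp only [spinMatrix, cons_val_zero, cons_val_one, cons_val]
  rw [sum_mul_spin]
  refine Matrix.ext_of_mulVec_single fun i => ?_
  obtain ⟨g, hg⟩ : ∃ g : ℕ → ℂ, (Pi.single i 1 : Fin (d + 1) → ℂ) =
      fun k : Fin (d + 1) => binomWeight d k * g k := by
    refine ⟨fun k => if k = (i : ℕ) then (binomWeight d k)⁻¹ else 0, ?_⟩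
    funext k
    by_cases h : k = i
    · subst h
      simp [mul_inv_cancel₀ (binomWeight_ne_zero (d := d) (k := (k : ℕ)) (by omega))]
    · have : ¬ (k : ℕ) = i := fun e => h (Fin.ext e)
      simp [h, this]
  have hR : ∀ g : ℕ → ℂ, (spinRaise d *ᵥ fun k : Fin (d + 1) => binomWeight d k * g k) =
      fun j : Fin (d + 1) => binomWeight d j * (((d : ℂ) - (j : ℕ)) * g ((j : ℕ) + 1)) :=
    fun g => funext (spinRaise_mulVec d g)
  have hL : ∀ g : ℕ → ℂ, ((spinRaise d)ᴴ *ᵥ fun k : Fin (d + 1) => binomWeight d k * g k) =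
      fun j : Fin (d + 1) => binomWeight d j * ((j : ℕ) * g ((j : ℕ) - 1)) :=
    fun g => funext (spinLower_mulVec d g)
  have hZ : ∀ g : ℕ → ℂ, (spinZ d *ᵥ fun k : Fin (d + 1) => binomWeight d k * g k) =
      fun j : Fin (d + 1) => binomWeight d j * (((d : ℂ) / 2 - (j : ℕ)) * g j) :=
    fun g => funext (spinZ_mulVec d g)
  rw [hg, add_mulVec, smul_mulVec, add_mulVec, ← mulVec_mulVec, ← mulVec_mulVec, ← mulVec_mulVec,
    smul_mulVec, one_mulVec, hR, hL, hZ, hR (fun j => (j : ℂ) * g (j - 1)),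
    hL (fun j => ((d : ℂ) - j) * g (j + 1)), hZ (fun j => ((d : ℂ) / 2 - j) * g j)]
  funext j
  simp only [Pi.add_apply, Pi.smul_apply, smul_eq_mul, Nat.add_sub_cancel]
  rcases Nat.eq_zero_or_pos (j : ℕ) with h0 | h0
  · simp only [h0]
    push_cast
    ring
  · rw [Nat.sub_add_cancel h0, Nat.cast_sub h0]
    push_cast
    ring

end Spin

section Edge

variable {V : Type*} [Fintype V] [DecidableEq V] {twoS : V → ℕ}

theorem siteOp_mulVec (v : V) (A : Matrix (Fin (twoS v + 1)) (Fin (twoS v + 1)) ℂ)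
    (ψ : SpinConfig twoS → ℂ) (σ : SpinConfig twoS) :
    (siteOp twoS v A *ᵥ ψ) σ = ∑ k, A (σ v) k * ψ (Function.update σ v k) := by
  simp only [mulVec, dotProduct, siteOp, of_apply, ite_mul, zero_mul]
  rw [← Finset.sum_filter]
  symm
  refine Finset.sum_bij' (fun k _ => Function.update σ v k) (fun τ _ => τ v) ?_ ?_ ?_ ?_ ?_
  · intro k _
    simp only [Finset.mem_filter, Finset.mem_univ, true_and]
    intro w hw
    rw [Function.update_of_ne hw]
  · intro _ _
    exact Finset.mem_univ _
  · intro k _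
    simp
  · intro τ hτ
    have := (Finset.mem_filter.1 hτ).2
    funext w
    by_cases hw : w = v
    · subst hw; simp
    · rw [Function.update_of_ne hw, this w hw]
  · intro k _
    simp

theorem siteOp_add (v : V) (A B : Matrix (Fin (twoS v + 1)) (Fin (twoS v + 1)) ℂ) :
    siteOp twoS v (A + B) = siteOp twoS v A + siteOp twoS v B := by
  ext σ τ
  simp only [siteOp, of_apply, Matrix.add_apply]
  split_ifs <;> simp

theorem siteOp_smul (v : V) (c : ℂ) (A : Matrix (Fin (twoS v + 1)) (Fin (twoS v + 1)) ℂ) :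
    siteOp twoS v (c • A) = c • siteOp twoS v A := by
  ext σ τ
  simp only [siteOp, of_apply, Matrix.smul_apply]
  split_ifs <;> simp

theorem siteOp_mul (v : V) (A B : Matrix (Fin (twoS v + 1)) (Fin (twoS v + 1)) ℂ) :
    siteOp twoS v (A * B) = siteOp twoS v A * siteOp twoS v B := by
  refine Matrix.ext_of_mulVec_single fun τ => ?_
  rw [← mulVec_mulVec]
  funext σ
  simp only [siteOp_mulVec, Function.update_self, Function.update_idem, mul_apply,
    Finset.mul_sum, Finset.sum_mul]
  rw [Finset.sum_comm]
  simp only [mul_assoc]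

theorem siteOp_one (v : V) : siteOp twoS v 1 = 1 := by
  refine Matrix.ext_of_mulVec_single fun τ => ?_
  funext σ
  rw [siteOp_mulVec, one_mulVec, Finset.sum_eq_single (σ v)]
  · simp
  · intro k _ hk
    rw [one_apply_ne hk.symm, zero_mul]
  · simp

theorem siteOp_comm {x y : V} (hxy : x ≠ y) (A : Matrix (Fin (twoS x + 1)) (Fin (twoS x + 1)) ℂ)
    (B : Matrix (Fin (twoS y + 1)) (Fin (twoS y + 1)) ℂ) :
    siteOp twoS x A * siteOp twoS y B = siteOp twoS y B * siteOp twoS x A := by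
  refine Matrix.ext_of_mulVec_single fun τ => ?_
  rw [← mulVec_mulVec, ← mulVec_mulVec]
  funext σ
  simp only [siteOp_mulVec, Finset.mul_sum, Function.update_of_ne hxy,
    Function.update_of_ne hxy.symm]
  rw [Finset.sum_comm]
  refine Finset.sum_congr rfl fun k _ => Finset.sum_congr rfl fun l _ => ?_
  rw [Function.update_comm hxy]
  ring

theorem siteOp_sum {κ : Type*} (s : Finset κ) (v : V)
    (A : κ → Matrix (Fin (twoS v + 1)) (Fin (twoS v + 1)) ℂ) :
    siteOp twoS v (∑ i ∈ s, A i) = ∑ i ∈ s, siteOp twoS v (A i) := by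
  classical
  induction s using Finset.induction_on with
  | empty => ext σ τ; simp [siteOp]
  | insert i s hi ih => rw [Finset.sum_insert hi, Finset.sum_insert hi, siteOp_add, ih]

/-- The defect of the total spin in terms of raising and lowering operators. -/
theorem edgeDefect_eq {x y : V} (hxy : x ≠ y) :
    edgeDefect twoS x y = ((twoS x * twoS y : ℂ) / 2) • 1 -
      (siteOp twoS x (spinRaise (twoS x)) * siteOp twoS y (spinRaise (twoS y))ᴴ +
        siteOp twoS x (spinRaise (twoS x))ᴴ * siteOp twoS y (spinRaise (twoS y))) -
      (2 : ℂ) • (siteOp twoS x (spinZ (twoS x)) * siteOp twoS y (spinZ (twoS y))) := by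
  have e1 : ∀ v : V, ∑ a, siteOp twoS v (spinMatrix (twoS v) a) * siteOp twoS v (spinMatrix (twoS v) a) =
      ((twoS v : ℂ) / 2 * ((twoS v : ℂ) / 2 + 1)) • 1 := fun v => by
    simp only [← siteOp_mul]
    rw [← siteOp_sum, sum_spinMatrix_mul_self, siteOp_smul, siteOp_one]
  have e2 : ∑ a, siteOp twoS x (spinMatrix (twoS x) a) * siteOp twoS y (spinMatrix (twoS y) a) =
      (1 / 2 : ℂ) • (siteOp twoS x (spinRaise (twoS x)) * siteOp twoS y (spinRaise (twoS y))ᴴ +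
        siteOp twoS x (spinRaise (twoS x))ᴴ * siteOp twoS y (spinRaise (twoS y))) +
      siteOp twoS x (spinZ (twoS x)) * siteOp twoS y (spinZ (twoS y)) := by
    rw [← sum_mul_spin, Fin.sum_univ_three]
    simp only [spinMatrix, cons_val_zero, cons_val_one, cons_val, siteOp_smul, sub_eq_add_neg,
      siteOp_add]
    simp only [← neg_one_smul ℂ (spinRaise _)ᴴ, siteOp_smul, neg_one_smul ℂ (siteOp _ _ _)]
  have e3 : ∀ a, siteOp twoS y (spinMatrix (twoS y) a) * siteOp twoS x (spinMatrix (twoS x) a) =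
      siteOp twoS x (spinMatrix (twoS x) a) * siteOp twoS y (spinMatrix (twoS y) a) := fun a =>
    siteOp_comm hxy.symm _ _
  rw [edgeDefect]
  simp only [add_mul, mul_add, Finset.sum_add_distrib, e3, e1, e2]
  push_cast
  module

/-- Action of the defect of the total spin in the coordinates without square roots. -/
theorem edgeDefect_mulVec {x y : V} (hxy : x ≠ y) (ψ : SpinConfig twoS → ℂ) (σ : SpinConfig twoS)
    (g : ℕ → ℕ → ℂ)
    (hg : ∀ k l, ψ (Function.update (Function.update σ x k) y l) =
      binomWeight (twoS x) k * (binomWeight (twoS y) l * g k l)) :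
    (edgeDefect twoS x y *ᵥ ψ) σ = binomWeight (twoS x) (σ x) * (binomWeight (twoS y) (σ y) *
      (((twoS x : ℂ) - (σ x : ℕ)) * (σ y : ℕ) * (g (σ x) (σ y) - g ((σ x : ℕ) + 1) ((σ y : ℕ) - 1)) +
      (σ x : ℕ) * ((twoS y : ℂ) - (σ y : ℕ)) *
        (g (σ x) (σ y) - g ((σ x : ℕ) - 1) ((σ y : ℕ) + 1)))) := by
  have key : ∀ (A : Matrix (Fin (twoS x + 1)) (Fin (twoS x + 1)) ℂ)
      (B : Matrix (Fin (twoS y + 1)) (Fin (twoS y + 1)) ℂ),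
      (siteOp twoS x A *ᵥ (siteOp twoS y B *ᵥ ψ)) σ =
        ∑ k : Fin (twoS x + 1), A (σ x) k * (binomWeight (twoS x) k *
          ∑ l : Fin (twoS y + 1), B (σ y) l * (binomWeight (twoS y) l * g k l)) := by
    intro A B
    simp only [siteOp_mulVec, Function.update_of_ne hxy.symm, hg, Finset.mul_sum]
    refine Finset.sum_congr rfl fun k _ => Finset.sum_congr rfl fun l _ => ?_
    ring
  have h0 : ψ σ = binomWeight (twoS x) (σ x) * (binomWeight (twoS y) (σ y) * g (σ x) (σ y)) := by
    rw [← hg]; simp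
  rw [edgeDefect_eq hxy, sub_mulVec, sub_mulVec, add_mulVec, smul_mulVec, smul_mulVec, one_mulVec,
    ← mulVec_mulVec, ← mulVec_mulVec, ← mulVec_mulVec]
  simp only [Pi.sub_apply, Pi.add_apply, Pi.smul_apply, smul_eq_mul, key, h0]
  simp only [spinLower_mulVec, spinZ_mulVec, spinRaise_mulVec (twoS y)]
  rw [spinRaise_mulVec (twoS x) (fun k => binomWeight (twoS y) (σ y) *
      ((σ y : ℕ) * g k ((σ y : ℕ) - 1))),
    spinLower_mulVec (twoS x) (fun k => binomWeight (twoS y) (σ y) *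
      (((twoS y : ℂ) - (σ y : ℕ)) * g k ((σ y : ℕ) + 1))),
    spinZ_mulVec (twoS x) (fun k => binomWeight (twoS y) (σ y) *
      (((twoS y : ℂ) / 2 - (σ y : ℕ)) * g k (σ y)))]
  ring

/-- The inner product of `ψ` with the vector of largest total spin of the sites `x` and `y` and
third component of the spin lowered by `M`, all other sites being in the configuration `σ`. -/
noncomputable def edgeSum (x y : V) (ψ : SpinConfig twoS → ℂ) (σ : SpinConfig twoS) (M : ℕ) : ℂ :=
  ∑ k : Fin (twoS x + 1), ∑ l : Fin (twoS y + 1), if (k : ℕ) + l = M then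
    binomWeight (twoS x) k * (binomWeight (twoS y) l *
      ψ (Function.update (Function.update σ x k) y l)) else 0

/-- The vector whose inner product with `ψ` is `edgeSum`. -/
noncomputable def edgeVec (x y : V) (σ : SpinConfig twoS) (M : ℕ) : SpinConfig twoS → ℂ := fun τ =>
  if ∀ w, w ≠ x → w ≠ y → σ w = τ w then
    (if (τ x : ℕ) + τ y = M then binomWeight (twoS x) (τ x) * binomWeight (twoS y) (τ y) else 0)
  else 0

theorem star_edgeVec_dotProduct {x y : V} (hxy : x ≠ y) (σ : SpinConfig twoS) (M : ℕ)
    (ψ : SpinConfig twoS → ℂ) : star (edgeVec x y σ M) ⬝ᵥ ψ = edgeSum x y ψ σ M := by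
  have e : ∀ τ, star (edgeVec x y σ M) τ * ψ τ = if ∀ w, w ≠ x → w ≠ y → σ w = τ w then
      (if (τ x : ℕ) + τ y = M then
        binomWeight (twoS x) (τ x) * (binomWeight (twoS y) (τ y) * ψ τ) else 0) else 0 := by
    intro τ
    simp only [Pi.star_apply, edgeVec]
    split_ifs
    · rw [star_mul, conj_binomWeight, conj_binomWeight]; ring
    · simp
    · simp
  simp only [dotProduct, e]
  rw [edgeSum, ← Finset.sum_filter, ← Finset.sum_product']
  symm
  refine Finset.sum_bij' (fun p _ => Function.update (Function.update σ x p.1) y p.2)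
    (fun τ _ => (τ x, τ y)) ?_ ?_ ?_ ?_ ?_
  · intro p _
    simp only [Finset.mem_filter, Finset.mem_univ, true_and]
    intro w hwx hwy
    rw [Function.update_of_ne hwy, Function.update_of_ne hwx]
  · intro _ _
    simp
  · intro p _
    simp [Function.update_of_ne hxy]
  · intro τ hτ
    have := (Finset.mem_filter.1 hτ).2
    funext w
    by_cases hy : w = y
    · subst hy; simp
    by_cases hx : w = x
    · subst hx; simp [Function.update_of_ne hy]
    rw [Function.update_of_ne hy, Function.update_of_ne hx, this w hx hy]
  · intro p _
    simp [Function.update_of_ne hxy]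

theorem edgeDefect_mulVec_edgeVec {x y : V} (hxy : x ≠ y) (σ : SpinConfig twoS) (M : ℕ) :
    edgeDefect twoS x y *ᵥ edgeVec x y σ M = 0 := by
  funext τ
  rw [edgeDefect_mulVec hxy _ τ (fun k l => if ∀ w, w ≠ x → w ≠ y → σ w = τ w then
    (if k + l = M then 1 else 0) else 0)]
  · by_cases h : ∀ w, w ≠ x → w ≠ y → σ w = τ w
    · simp only [if_pos h]
      have e1 : ((τ y : ℕ) : ℂ) * ((if (τ x : ℕ) + τ y = M then (1 : ℂ) else 0) -
          if (τ x : ℕ) + 1 + (τ y - 1) = M then 1 else 0) = 0 := by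
        rcases Nat.eq_zero_or_pos (τ y : ℕ) with h0 | h0
        · simp [h0]
        · have : (τ x : ℕ) + 1 + (τ y - 1) = τ x + τ y := by omega
          simp [this]
      have e2 : ((τ x : ℕ) : ℂ) * ((if (τ x : ℕ) + τ y = M then (1 : ℂ) else 0) -
          if (τ x : ℕ) - 1 + (τ y + 1) = M then 1 else 0) = 0 := by
        rcases Nat.eq_zero_or_pos (τ x : ℕ) with h0 | h0
        · simp [h0]
        · have : (τ x : ℕ) - 1 + (τ y + 1) = τ x + τ y := by omega
          simp [this]
      rw [mul_assoc _ ((τ y : ℕ) : ℂ), e1, mul_comm ((τ x : ℕ) : ℂ), mul_assoc _ ((τ x : ℕ) : ℂ), e2]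
      simp
    · simp only [if_neg h]
      simp
  · intro k l
    have e : (∀ w, w ≠ x → w ≠ y → σ w = Function.update (Function.update τ x k) y l w) ↔
        ∀ w, w ≠ x → w ≠ y → σ w = τ w := by
      refine forall_congr' fun w => forall_congr' fun hx => forall_congr' fun hy => ?_
      rw [Function.update_of_ne hy, Function.update_of_ne hx]
    simp only [edgeVec, e, Function.update_self, Function.update_of_ne hxy]
    split_ifs <;> simp

theorem sum_sq_binomWeight_ne_zero {a b : ℕ} (k₀ : Fin (a + 1)) (l₀ : Fin (b + 1)) :
    ∑ k : Fin (a + 1), ∑ l : Fin (b + 1), (if (k : ℕ) + l = (k₀ : ℕ) + l₀ then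
      ((a.choose k : ℂ) * (b.choose l)) else 0) ≠ 0 := by
  have : ∑ k : Fin (a + 1), ∑ l : Fin (b + 1), (if (k : ℕ) + l = (k₀ : ℕ) + l₀ then
      ((a.choose k) * (b.choose l)) else 0) ≠ 0 := by
    refine (Finset.sum_pos' (fun _ _ => Nat.zero_le _) ⟨k₀, Finset.mem_univ _, ?_⟩).ne'
    refine Finset.sum_pos' (fun _ _ => Nat.zero_le _) ⟨l₀, Finset.mem_univ _, ?_⟩
    rw [if_pos rfl]
    exact Nat.mul_pos (Nat.choose_pos (by omega)) (Nat.choose_pos (by omega))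
  exact_mod_cast this

/-- The kernel of `edgeDefect` is spanned by the vectors `edgeVec`: in the coordinates without square
roots, a vector of the kernel depends on the total `k + l` only. -/
theorem eq_zero_of_edgeDefect {x y : V} (hxy : x ≠ y) {φ : SpinConfig twoS → ℂ}
    (h : edgeDefect twoS x y *ᵥ φ = 0) (h0 : ∀ σ M, edgeSum x y φ σ M = 0) : φ = 0 := by
  funext σ
  let g : ℕ → ℕ → ℂ := fun k l => if h : k < twoS x + 1 ∧ l < twoS y + 1 then
    (binomWeight (twoS x) k)⁻¹ * ((binomWeight (twoS y) l)⁻¹ *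
      φ (Function.update (Function.update σ x ⟨k, h.1⟩) y ⟨l, h.2⟩)) else 0
  have hg : ∀ (k : Fin (twoS x + 1)) (l : Fin (twoS y + 1)),
      φ (Function.update (Function.update σ x k) y l) =
      binomWeight (twoS x) k * (binomWeight (twoS y) l * g k l) := by
    intro k l
    have h1 := binomWeight_ne_zero (d := twoS x) (k := k) (by omega)
    have h2 := binomWeight_ne_zero (d := twoS y) (k := l) (by omega)
    have : g k l = (binomWeight (twoS x) k)⁻¹ * ((binomWeight (twoS y) l)⁻¹ *
        φ (Function.update (Function.update σ x k) y l)) := by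
      simp only [g]
      rw [dif_pos ⟨k.2, l.2⟩]
    rw [this]
    field_simp
  -- the equation `edgeDefect φ = 0` in the coordinates `g`
  have eqn : ∀ k l : ℕ, k ≤ twoS x → l ≤ twoS y →
      ((twoS x : ℂ) - k) * l * (g k l - g (k + 1) (l - 1)) +
      k * ((twoS y : ℂ) - l) * (g k l - g (k - 1) (l + 1)) = 0 := by
    intro k l hk hl
    have e := congrFun h (Function.update (Function.update σ x ⟨k, by omega⟩) y ⟨l, by omega⟩)
    rw [edgeDefect_mulVec hxy φ _ g] at e
    · simp only [Function.update_self, Function.update_of_ne hxy, Pi.zero_apply, mul_eq_zero,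
        binomWeight_ne_zero hk, binomWeight_ne_zero hl, false_or] at e
      exact e
    · intro k' l'
      rw [← hg]
      congr 1
      rw [Function.update_comm hxy, Function.update_idem, Function.update_comm hxy.symm,
        Function.update_idem]
  -- hence `g` is constant along `k + l = M`
  have const : ∀ k l : ℕ, k + 1 ≤ twoS x → l + 1 ≤ twoS y → g k (l + 1) = g (k + 1) l := by
    intro k
    induction k with
    | zero =>
      intro l hk hl
      have e := eqn 0 (l + 1) (by omega) hl
      have h1 : ((twoS x : ℂ) - (0 : ℕ)) * ((l + 1 : ℕ) : ℂ) ≠ 0 := by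
        rw [Nat.cast_zero, sub_zero]
        exact_mod_cast Nat.mul_ne_zero (by omega) (by omega)
      simp only [Nat.cast_zero, zero_mul, add_zero, Nat.add_sub_cancel, zero_add] at e h1 ⊢
      exact sub_eq_zero.1 ((mul_eq_zero.1 e).resolve_left h1)
    | succ k ih =>
      intro l hk hl
      have e := eqn (k + 1) (l + 1) (by omega) hl
      have h2 : ((twoS y : ℂ) - ((l + 1 : ℕ) : ℂ)) * (g (k + 1) (l + 1) - g k (l + 1 + 1)) = 0 := by
        by_cases hl' : l + 1 + 1 ≤ twoS y
        · rw [ih (l + 1) (by omega) hl', sub_self, mul_zero]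
        · rw [show twoS y = l + 1 by omega, sub_self, zero_mul]
      simp only [Nat.add_sub_cancel] at e
      rw [mul_assoc ((k + 1 : ℕ) : ℂ), h2, mul_zero, add_zero] at e
      have h1 : ((twoS x : ℂ) - ((k + 1 : ℕ) : ℂ)) * ((l + 1 : ℕ) : ℂ) ≠ 0 := by
        refine mul_ne_zero ?_ (by exact_mod_cast (by omega : l + 1 ≠ 0))
        rw [sub_ne_zero]
        exact_mod_cast (by omega : twoS x ≠ k + 1)
      exact sub_eq_zero.1 ((mul_eq_zero.1 e).resolve_left h1)
  have const' : ∀ j k l : ℕ, k + j ≤ twoS x → l + j ≤ twoS y → g k (l + j) = g (k + j) l := by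
    intro j
    induction j with
    | zero => intros; rfl
    | succ j ih =>
      intro k l hk hl
      rw [← add_assoc l, const k (l + j) (by omega) (by omega), ih (k + 1) l (by omega) (by omega),
        add_right_comm, add_assoc]
  have const'' : ∀ k l k' l' : ℕ, k ≤ twoS x → l ≤ twoS y → k' ≤ twoS x → l' ≤ twoS y →
      k + l = k' + l' → g k l = g k' l' := by
    intro k l k' l' hk hl hk' hl' e
    rcases le_total k k' with hkk | hkk
    · have := const' (k' - k) k l' (by omega) (by omega)
      rwa [show l' + (k' - k) = l by omega, show k + (k' - k) = k' by omega] at this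
    · have := const' (k - k') k' l (by omega) (by omega)
      rw [show l + (k - k') = l' by omega, show k' + (k - k') = k by omega] at this
      exact this.symm
  have e := h0 σ ((σ x : ℕ) + σ y)
  rw [edgeSum] at e
  have e2 : ∀ (k : Fin (twoS x + 1)) (l : Fin (twoS y + 1)),
      (if (k : ℕ) + l = (σ x : ℕ) + σ y then binomWeight (twoS x) k * (binomWeight (twoS y) l *
        φ (Function.update (Function.update σ x k) y l)) else 0) =
      (if (k : ℕ) + l = (σ x : ℕ) + σ y then
        (((twoS x).choose k : ℂ) * ((twoS y).choose l)) else 0) * g (σ x) (σ y) := by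
    intro k l
    split_ifs with hkl
    · rw [hg, const'' k l (σ x) (σ y) (by omega) (by omega) (by omega) (by omega) hkl]
      have sq : ∀ d k : ℕ, binomWeight d k * binomWeight d k = d.choose k := fun d k => by
        rw [binomWeight, ← Complex.ofReal_mul, Real.mul_self_sqrt (by positivity)]; simp
      rw [← sq, ← sq]
      ring
    · simp
  simp only [e2, ← Finset.sum_mul] at e
  have e3 := (mul_eq_zero.1 e).resolve_left (sum_sq_binomWeight_ne_zero (σ x) (σ y))
  have e4 := hg (σ x) (σ y)
  rw [e3] at e4
  simpa using e4

/-- The vectors without a component of largest total spin at the sites `x` and `y`. -/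
theorem edgeProj_mulVec_eq_zero {x y : V} (hxy : x ≠ y) (ψ : SpinConfig twoS → ℂ) :
    edgeProj twoS x y *ᵥ ψ = 0 ↔ ∀ σ M, edgeSum x y ψ σ M = 0 := by
  have hsum : ∀ σ M, edgeSum x y (edgeProj twoS x y *ᵥ ψ) σ M = edgeSum x y ψ σ M := by
    intro σ M
    have h1 := (kerProj_mulVec_eq_self _ _).2 (edgeDefect_mulVec_edgeVec hxy σ M)
    rw [← star_edgeVec_dotProduct hxy, ← star_edgeVec_dotProduct hxy, dotProduct_mulVec,
      edgeProj]
    congr 1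
    nth_rewrite 2 [← h1]
    rw [star_mulVec, (kerProj_isHermitian _).eq]
  constructor
  · intro h σ M
    rw [← hsum, h]
    simp [edgeSum]
  · intro h
    refine eq_zero_of_edgeDefect hxy ?_ fun σ M => (hsum σ M).trans (h σ M)
    rw [edgeProj, mulVec_mulVec, mul_kerProj, zero_mulVec]

end Edge

/-! ### Matrix product states on a chain -/

section Chain

/-- The AKLT matrices: the components of a spin 1 in the product of two spins 1/2, one of
which is contracted with a singlet. -/
noncomputable def bondMat : Fin 3 → Matrix (Fin 2) (Fin 2) ℂ :=
  ![!![0, 0; -((Real.sqrt 2 : ℝ) : ℂ), 0], !![1, 0; 0, -1], !![0, ((Real.sqrt 2 : ℝ) : ℂ); 0, 0]]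

/-- The product of the AKLT matrices along a chain. -/
noncomputable def chainMat {n : ℕ} (m : Fin n → Fin 3) : Matrix (Fin 2) (Fin 2) ℂ :=
  (List.ofFn fun k => bondMat (m k)).prod

theorem chainMat_cons {n : ℕ} (a : Fin 3) (m : Fin n → Fin 3) :
    chainMat (Fin.cons a m : Fin (n + 1) → Fin 3) = bondMat a * chainMat m := by
  simp [chainMat, List.ofFn_succ]

theorem sqrt_two_mul_self : ((Real.sqrt 2 : ℝ) : ℂ) * ((Real.sqrt 2 : ℝ) : ℂ) = 2 := by
  rw [← Complex.ofReal_mul, Real.mul_self_sqrt (by norm_num)]; norm_num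

theorem sqrt_two_ne_zero : ((Real.sqrt 2 : ℝ) : ℂ) ≠ 0 := by
  intro h
  have := sqrt_two_mul_self
  rw [h] at this
  norm_num at this

theorem binomWeight_zero (d : ℕ) : binomWeight d 0 = 1 := by simp [binomWeight]

theorem binomWeight_self (d : ℕ) : binomWeight d d = 1 := by simp [binomWeight]

theorem binomWeight_two_one : binomWeight 2 1 = ((Real.sqrt 2 : ℝ) : ℂ) := by simp [binomWeight]

/-- The condition that no two neighbours of a chain of spins 1 have total spin 2. -/
def ChainCond {n : ℕ} {R : Type*} [AddCommMonoid R] [Module ℂ R] (φ : (Fin n → Fin 3) → R) : Prop :=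
  ∀ (k : ℕ) (hk : k + 1 < n) (m : Fin n → Fin 3) (M : ℕ),
    ∑ a : Fin 3, ∑ b : Fin 3, (if (a : ℕ) + b = M then (binomWeight 2 a * binomWeight 2 b) •
      φ (Function.update (Function.update m ⟨k, by omega⟩ a) ⟨k + 1, hk⟩ b) else 0) = 0

/-- The condition that the spin 3/2 at the centre and the first spin of a leg do not have
total spin 5/2. -/
def CentreCond {n : ℕ} (φ : Fin 4 → (Fin (n + 1) → Fin 3) → ℂ) : Prop :=
  ∀ (m : Fin (n + 1) → Fin 3) (M : ℕ),
    ∑ c : Fin 4, ∑ b : Fin 3, (if (c : ℕ) + b = M then (binomWeight 3 c * binomWeight 2 b) •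
      φ c (Function.update m 0 b) else 0) = 0

/-- The product of two neighbouring AKLT matrices has no component of total spin 2. -/
theorem bondMat_relation (M : ℕ) :
    ∑ a : Fin 3, ∑ b : Fin 3, (if (a : ℕ) + b = M then (binomWeight 2 a * binomWeight 2 b) •
      (bondMat a * bondMat b) else 0) = 0 := by
  have h := sqrt_two_mul_self
  have w0 := binomWeight_zero 2
  have w1 := binomWeight_two_one
  have w2 := binomWeight_self 2
  simp only [Fin.sum_univ_three, Fin.val_zero, Fin.val_one, Fin.val_two, w0, w1, w2, bondMat,
    cons_val_zero, cons_val_one, cons_val]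
  rcases M with _ | _ | _ | _ | _ | M
  all_goals simp
  all_goals ext i j
  all_goals fin_cases i <;> fin_cases j
  all_goals simp

/-- Matrix product states are ground states of a chain. -/
theorem chainCond_chainMat (n : ℕ) : ChainCond (chainMat : (Fin n → Fin 3) → _) := by
  induction n with
  | zero => intro k hk; omega
  | succ n ih =>
    intro k hk m M
    rcases k with _ | k
    · obtain ⟨n, rfl⟩ : ∃ n', n = n' + 1 := ⟨n - 1, by omega⟩
      have e : ∀ a b : Fin 3, (Function.update (Function.update m ⟨0, by omega⟩ a)
          ⟨0 + 1, hk⟩ b : Fin (n + 2) → Fin 3) =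
          Fin.cons a (Fin.cons b (Fin.tail (Fin.tail m))) := by
        intro a b
        refine funext fun i => Fin.cases ?_ (fun i => Fin.cases ?_ (fun i => ?_) i) i
        · simp [Function.update]
        · simp [Function.update]
        · simp [Function.update, Fin.ext_iff, Fin.tail]
      have := congrArg (· * chainMat (Fin.tail (Fin.tail m))) (bondMat_relation M)
      simp only [Finset.sum_mul, ite_mul, zero_mul, smul_mul_assoc] at this
      simpa only [e, chainMat_cons, Matrix.mul_assoc] using this
    · have e : ∀ a b : Fin 3, (Function.update (Function.update m ⟨k + 1, by omega⟩ a)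
          ⟨k + 1 + 1, hk⟩ b : Fin (n + 1) → Fin 3) =
          Fin.cons (m 0) (Function.update (Function.update (Fin.tail m) ⟨k, by omega⟩ a)
            ⟨k + 1, by omega⟩ b) := by
        intro a b
        refine funext fun i => Fin.cases ?_ (fun i => ?_) i
        · simp [Function.update, Fin.ext_iff]
        · simp [Function.update, Fin.ext_iff, Fin.tail]
      have := congrArg (bondMat (m 0) * ·) (ih k (by omega) (Fin.tail m) M)
      simp only [Finset.mul_sum, mul_ite, mul_zero, mul_smul_comm] at this
      simpa only [e, chainMat_cons] using this

theorem ChainCond.map {n : ℕ} {R R' : Type*} [AddCommMonoid R] [Module ℂ R] [AddCommMonoid R']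
    [Module ℂ R'] {φ : (Fin n → Fin 3) → R} (h : ChainCond φ) (L : R →ₗ[ℂ] R') :
    ChainCond fun m => L (φ m) := by
  intro k hk m M
  have := congrArg L (h k hk m M)
  simp only [map_sum, map_zero] at this
  refine Eq.trans ?_ this
  refine Finset.sum_congr rfl fun a _ => Finset.sum_congr rfl fun b _ => ?_
  split_ifs <;> simp

theorem ChainCond.cons {n : ℕ} {φ : (Fin (n + 1) → Fin 3) → ℂ} (h : ChainCond φ) (a : Fin 3) :
    ChainCond fun m : Fin n → Fin 3 => φ (Fin.cons a m) := by
  intro k hk m M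
  have := h (k + 1) (by omega) (Fin.cons a m) M
  refine Eq.trans ?_ this
  refine Finset.sum_congr rfl fun b _ => Finset.sum_congr rfl fun c _ => ?_
  congr 2
  refine congrArg φ ?_
  refine funext fun i => Fin.cases ?_ (fun i => ?_) i
  · simp [Function.update, Fin.ext_iff]
  · simp [Function.update, Fin.ext_iff]

theorem exists_chainMat_eq_diag (n : ℕ) :
    ∃ e : ℂ, e ≠ 0 ∧ ∃ m : Fin n → Fin 3, chainMat m = !![1, 0; 0, e] := by
  induction n with
  | zero =>
    refine ⟨1, one_ne_zero, Fin.elim0, ?_⟩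
    simp only [chainMat, List.ofFn_zero, List.prod_nil]
    exact one_fin_two
  | succ n ih =>
    obtain ⟨e, he, m, hm⟩ := ih
    refine ⟨-e, neg_ne_zero.2 he, Fin.cons 1 m, ?_⟩
    rw [chainMat_cons, hm]
    simp [bondMat]

/-- Single matrix entries occur among the matrices of chains of length at least two. -/
theorem exists_chainMat_eq_single (n : ℕ) (u t : Fin 2) : ∃ (m : Fin (n + 2) → Fin 3) (c : ℂ),
    c ≠ 0 ∧ chainMat m = c • Matrix.single u t 1 := by
  obtain ⟨e, he, m, hm⟩ := exists_chainMat_eq_diag n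
  have hs := sqrt_two_ne_zero
  have key : ∀ a b : Fin 3, ∀ c : ℂ, c ≠ 0 →
      bondMat a * (bondMat b * !![1, 0; 0, e]) = c • Matrix.single u t 1 →
      ∃ (m : Fin (n + 2) → Fin 3) (c : ℂ), c ≠ 0 ∧ chainMat m = c • Matrix.single u t 1 := by
    intro a b c hc h
    exact ⟨Fin.cons a (Fin.cons b m), c, hc, by rw [chainMat_cons, chainMat_cons, hm, h]⟩
  have h := sqrt_two_mul_self
  fin_cases u <;> fin_cases t
  · refine key 2 0 (-2) (by norm_num) ?_
    ext i j
    fin_cases i <;> fin_cases j <;> simp [bondMat, h]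
  · refine key 1 2 (((Real.sqrt 2 : ℝ) : ℂ) * e) (mul_ne_zero hs he) ?_
    ext i j
    fin_cases i <;> fin_cases j <;> simp [bondMat]
  · refine key 0 1 (-((Real.sqrt 2 : ℝ) : ℂ)) (neg_ne_zero.2 hs) ?_
    ext i j
    fin_cases i <;> fin_cases j <;> simp [bondMat]
  · refine key 0 2 (-2 * e) (mul_ne_zero (by norm_num) he) ?_
    ext i j
    fin_cases i <;> fin_cases j <;> simp [bondMat, ← mul_assoc, h]

/-- The ground states of a chain of spins 1 are the matrix product states: adding one site does not
enlarge the space of boundary conditions. -/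
theorem ChainCond.exists_eq_sum {n : ℕ} {φ : (Fin (n + 2) → Fin 3) → ℂ} (h : ChainCond φ) :
    ∃ X : Fin 2 → Fin 2 → ℂ, ∀ m, φ m = ∑ u, ∑ t, X u t * chainMat m u t := by
  have hs := sqrt_two_ne_zero
  have hss := sqrt_two_mul_self
  have w0 := binomWeight_zero 2
  have w1 := binomWeight_two_one
  have w2 := binomWeight_self 2
  set r : ℂ := ((Real.sqrt 2 : ℝ) : ℂ) with hr
  induction n with
  | zero =>
    have hm : ∀ m : Fin 2 → Fin 3, m = ![m 0, m 1] := fun m => by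
      ext i; fin_cases i <;> rfl
    have e : ∀ M, ∑ a : Fin 3, ∑ b : Fin 3, (if (a : ℕ) + b = M then
        (binomWeight 2 a * binomWeight 2 b) • φ ![a, b] else 0) = 0 := by
      intro M
      refine Eq.trans ?_ (h 0 (by omega) ![0, 0] M)
      refine Finset.sum_congr rfl fun b _ => Finset.sum_congr rfl fun c _ => ?_
      congr 3
      ext i; fin_cases i <;> rfl
    have e0 := e 0
    have e1 := e 1
    have e2 := e 2
    have e3 := e 3
    have e4 := e 4
    simp only [Fin.sum_univ_three, Fin.val_zero, Fin.val_one, Fin.val_two, w0, w1, w2] at e0 e1 e2 e3 e4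
    norm_num [hs, hss] at e0 e1 e2 e3 e4
    refine ⟨!![-(φ ![2, 0] / 2), φ ![1, 2] / r; -(φ ![0, 1] / r), -(φ ![0, 2] / 2)], fun m => ?_⟩
    rw [hm m]
    generalize m 0 = a
    generalize m 1 = b
    have hc : chainMat ![a, b] = bondMat a * bondMat b := by
      simp [chainMat]
    rw [hc]
    have e1' : φ ![0, 1] + φ ![1, 0] = 0 := by
      have : r * (φ ![0, 1] + φ ![1, 0]) = 0 := by linear_combination e1
      exact (mul_eq_zero.1 this).resolve_left hs
    have e3' : φ ![1, 2] + φ ![2, 1] = 0 := by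
      have : r * (φ ![1, 2] + φ ![2, 1]) = 0 := by linear_combination e3
      exact (mul_eq_zero.1 this).resolve_left hs
    fin_cases a <;> fin_cases b <;> simp [bondMat, ← hr, Fin.sum_univ_two]
    · exact e0
    · field_simp
    · linear_combination -(φ ![0, 2] / 2) * hss
    · field_simp
      linear_combination e1'
    · linear_combination e2 / 2
    · field_simp
    · linear_combination -(φ ![2, 0] / 2) * hss
    · field_simp
      linear_combination e3'
    · exact e4
  | succ n ih =>
    choose X hX using fun a => ih (h.cons a)
    -- the matrix of the last `n + 1` sites can be chosen to be a multiple of either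
    -- off-diagonal matrix unit
    obtain ⟨e, he, m, hm⟩ := exists_chainMat_eq_diag n
    have key : ∀ (k : Fin 3) (M : ℕ), ∑ a : Fin 3, ∑ b : Fin 3, (if (a : ℕ) + b = M then
        (binomWeight 2 a * binomWeight 2 b) • ∑ u, ∑ t, X a u t *
          (bondMat b * (bondMat k * !![1, 0; 0, e])) u t else 0) = 0 := by
      intro k M
      refine Eq.trans ?_ (h 0 (by omega) (Fin.cons 0 (Fin.cons 0 (Fin.cons k m))) M)
      refine Finset.sum_congr rfl fun a _ => Finset.sum_congr rfl fun b _ => ?_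
      congr 2
      have : (Function.update (Function.update (Fin.cons 0 (Fin.cons 0 (Fin.cons k m)) :
          Fin (n + 3) → Fin 3) ⟨0, by omega⟩ a) ⟨0 + 1, by omega⟩ b : Fin (n + 3) → Fin 3) =
          Fin.cons a (Fin.cons b (Fin.cons k m)) := by
        refine funext fun i => Fin.cases ?_ (fun i => Fin.cases ?_ (fun i => ?_) i) i
        · simp [Function.update]
        · simp [Function.update]
        · rw [Function.update_of_ne (Fin.ne_of_val_ne (by simp only [Fin.val_succ]; omega)),
            Function.update_of_ne (Fin.ne_of_val_ne (by simp only [Fin.val_succ]; omega))]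
          rfl
      rw [this, hX, chainMat_cons, chainMat_cons, hm]
    have k0 := key 0
    have k2 := key 2
    simp only [Fin.sum_univ_three, Fin.val_zero, Fin.val_one, Fin.val_two, w0, w1, w2, bondMat,
      Fin.sum_univ_two, cons_val_zero, cons_val_one, cons_val, ← hr] at k0 k2
    have a1 := k0 1
    have a2 := k0 2
    have a3 := k0 3
    have a4 := k0 4
    have b0 := k2 0
    have b1 := k2 1
    have b2 := k2 2
    have b3 := k2 3
    clear k0 k2 key
    simp [hs, he] at a1 a2 a3 a4 b0 b1 b2 b3
    have c2 : X 0 0 0 = r * X 1 1 0 := by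
      apply mul_left_cancel₀ (mul_ne_zero hs hs)
      linear_combination -a2
    have c3 : X 2 1 0 = r * X 1 0 0 := by
      apply mul_left_cancel₀ (mul_ne_zero hs hs)
      linear_combination a3
    have d1 : X 0 0 1 = r * X 1 1 1 := by
      apply mul_left_cancel₀ (mul_ne_zero (mul_ne_zero hs hs) he)
      linear_combination b1
    have d2 : X 2 1 1 = r * X 1 0 1 := by
      apply mul_left_cancel₀ (mul_ne_zero (mul_ne_zero hs hs) he)
      linear_combination -b2
    refine ⟨fun s t => if s = 0 then X 1 0 t else - X 1 1 t, fun m => ?_⟩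
    rw [← Fin.cons_self_tail m, hX, chainMat_cons]
    generalize m 0 = a
    generalize chainMat (Fin.tail m) = K
    simp only [Fin.sum_univ_two, mul_apply]
    fin_cases a <;> simp [bondMat, ← hr, a1, b0, a4, b3, c2, c3, d1, d2] <;> ring

end Chain

/-! ### Ground states of a star -/

section Star

/-- The component `c` of the spin 3/2 in the product of three spins 1/2, normalized so that
the components are an isometry on the symmetric tensors. -/
noncomputable def centreTensor (p q r : Fin 2) (c : Fin 4) : ℂ :=
  if (c : ℕ) = (p : ℕ) + q + r then (binomWeight 3 c)⁻¹ else 0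

/-- The state of a star with the boundary condition `ζ`: the centre has the spin `c` and the three
legs have the spins `m₀`, `m₁`, `m₂`, listed from the centre. -/
noncomputable def starState {n : ℕ} (ζ : Fin 2 → Fin 2 → Fin 2 → ℂ) (c : Fin 4)
    (m₀ m₁ m₂ : Fin n → Fin 3) : ℂ :=
  ∑ p, ∑ t, chainMat m₀ p t * ∑ q, ∑ u, chainMat m₁ q u * ∑ r, ∑ v, chainMat m₂ r v *
    (centreTensor p q r c * ζ t u v)

theorem starState_swap₀₁ {n : ℕ} (ζ : Fin 2 → Fin 2 → Fin 2 → ℂ) (c : Fin 4)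
    (m₀ m₁ m₂ : Fin n → Fin 3) :
    starState ζ c m₀ m₁ m₂ = starState (fun t u v => ζ u t v) c m₁ m₀ m₂ := by
  have e : ∀ p q r, centreTensor p q r c = centreTensor q p r c := fun p q r => by
    rw [centreTensor, centreTensor, add_comm (p : ℕ)]
  have hx : ∀ (F : Fin 2 → Fin 2 → Fin 2 → Fin 2 → ℂ),
      ∑ p, ∑ t, ∑ q, ∑ u, F p t q u = ∑ q, ∑ u, ∑ p, ∑ t, F p t q u := by
    intro F
    simp only [Fin.sum_univ_two]
    ring
  simp only [starState, Finset.mul_sum]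
  rw [hx]
  refine Finset.sum_congr rfl fun q _ => Finset.sum_congr rfl fun u _ =>
    Finset.sum_congr rfl fun p _ => Finset.sum_congr rfl fun t _ =>
    Finset.sum_congr rfl fun r _ => Finset.sum_congr rfl fun v _ => ?_
  rw [e]
  ring

theorem starState_swap₁₂ {n : ℕ} (ζ : Fin 2 → Fin 2 → Fin 2 → ℂ) (c : Fin 4)
    (m₀ m₁ m₂ : Fin n → Fin 3) :
    starState ζ c m₀ m₁ m₂ = starState (fun t u v => ζ t v u) c m₀ m₂ m₁ := by
  have e : ∀ p q r, centreTensor p q r c = centreTensor p r q c := fun p q r => by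
    rw [centreTensor, centreTensor, add_right_comm (p : ℕ)]
  have hx : ∀ (F : Fin 2 → Fin 2 → Fin 2 → Fin 2 → ℂ),
      ∑ p, ∑ t, ∑ q, ∑ u, F p t q u = ∑ q, ∑ u, ∑ p, ∑ t, F p t q u := by
    intro F
    simp only [Fin.sum_univ_two]
    ring
  simp only [starState]
  refine Finset.sum_congr rfl fun q _ => Finset.sum_congr rfl fun u _ => ?_
  congr 1
  simp only [Finset.mul_sum]
  rw [hx]
  refine Finset.sum_congr rfl fun q _ => Finset.sum_congr rfl fun u _ =>
    Finset.sum_congr rfl fun p _ => Finset.sum_congr rfl fun t _ => ?_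
  rw [e]
  ring

/-- The conditions for a ground state of a star, leg by leg. -/
structure StarCond {n : ℕ} (φ : Fin 4 → (Fin (n + 1) → Fin 3) → (Fin (n + 1) → Fin 3) →
    (Fin (n + 1) → Fin 3) → ℂ) : Prop where
  chain₀ : ∀ c m₁ m₂, ChainCond fun m => φ c m m₁ m₂
  chain₁ : ∀ c m₀ m₂, ChainCond fun m => φ c m₀ m m₂
  chain₂ : ∀ c m₀ m₁, ChainCond fun m => φ c m₀ m₁ m
  centre₀ : ∀ m₁ m₂, CentreCond fun c m => φ c m m₁ m₂
  centre₁ : ∀ m₀ m₂, CentreCond fun c m => φ c m₀ m m₂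
  centre₂ : ∀ m₀ m₁, CentreCond fun c m => φ c m₀ m₁ m

theorem binomWeight_three_zero : binomWeight 3 0 = 1 := binomWeight_zero 3

theorem binomWeight_three_three : binomWeight 3 3 = 1 := binomWeight_self 3

theorem chainCond_sum {n : ℕ} (G : Fin 2 → Fin 2 → ℂ) :
    ChainCond fun m : Fin n → Fin 3 => ∑ p, ∑ t, chainMat m p t * G p t := by
  exact (chainCond_chainMat n).map
    { toFun := fun K => ∑ p, ∑ t, K p t * G p t
      map_add' := fun K K' => by
        simp only [Matrix.add_apply, add_mul, Finset.sum_add_distrib]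
      map_smul' := fun c K => by
        simp only [Matrix.smul_apply, smul_eq_mul, mul_assoc, Finset.mul_sum, RingHom.id_apply] }

/-- A symmetric tensor at the centre, contracted with the first AKLT matrix of a leg, has no component
of total spin 5/2. -/
theorem centreTensor_relation (q r v : Fin 2) (M : ℕ) :
    ∑ c : Fin 4, ∑ b : Fin 3, (if (c : ℕ) + b = M then (binomWeight 3 c * binomWeight 2 b) *
      ∑ p, bondMat b p v * centreTensor p q r c else 0) = 0 := by
  have w : ∀ (p : Fin 2) (c : Fin 4), binomWeight 3 c * centreTensor p q r c =
      if (c : ℕ) = (p : ℕ) + q + r then 1 else 0 := by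
    intro p c
    rw [centreTensor]
    split_ifs
    · exact mul_inv_cancel₀ (binomWeight_ne_zero (by omega))
    · simp
  have e : ∀ (c : Fin 4) (b : Fin 3), (binomWeight 3 c * binomWeight 2 b) *
      ∑ p, bondMat b p v * centreTensor p q r c =
      binomWeight 2 b * ∑ p, bondMat b p v * if (c : ℕ) = (p : ℕ) + q + r then 1 else 0 := by
    intro c b
    simp only [← w, Finset.mul_sum]
    refine Finset.sum_congr rfl fun p _ => ?_
    ring
  simp only [e]
  have w0 := binomWeight_zero 2
  have w1 := binomWeight_two_one
  have w2 := binomWeight_self 2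
  simp only [Fin.sum_univ_four, Fin.sum_univ_three, Fin.sum_univ_two, Fin.val_zero, Fin.val_one,
    Fin.val_two, w0, w1, w2, bondMat, cons_val_zero, cons_val_one, cons_val]
  rcases M with _ | _ | _ | _ | _ | _ | M <;> fin_cases q <;> fin_cases r <;> fin_cases v <;> simp

theorem centreCond_sum {n : ℕ} (H : Fin 2 → Fin 2 → Fin 2 → ℂ) :
    CentreCond fun c (m : Fin (n + 1) → Fin 3) =>
      ∑ p, ∑ t, chainMat m p t * ∑ q, ∑ r, centreTensor p q r c * H q r t := by
  intro m M
  have e : ∀ b : Fin 3, chainMat (Function.update m 0 b) =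
      bondMat b * chainMat (Fin.tail m) := by
    intro b
    rw [← chainMat_cons]
    congr 1
    refine funext fun i => Fin.cases ?_ (fun i => ?_) i
    · simp
    · simp [Fin.tail]
  obtain ⟨S, hS⟩ : ∃ S : Fin 4 → Fin 3 → Fin 2 → Fin 2 → Fin 2 → ℂ,
      S = fun c b q r v => ∑ p, bondMat b p v * centreTensor p q r c := ⟨_, rfl⟩
  have e2 : ∀ (c : Fin 4) (b : Fin 3), ∑ p, ∑ t, chainMat (Function.update m 0 b) p t *
      ∑ q, ∑ r, centreTensor p q r c * H q r t =
      ∑ q, ∑ r, ∑ v, ∑ t, S c b q r v * (chainMat (Fin.tail m) v t * H q r t) := by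
    intro c b
    rw [e, hS]
    simp only [mul_apply, Fin.sum_univ_two]
    ring
  have rel : ∀ q r v, ∑ c : Fin 4, ∑ b : Fin 3,
      (if (c : ℕ) + b = M then (binomWeight 3 c * binomWeight 2 b) * S c b q r v else 0) = 0 := by
    intro q r v
    rw [hS]
    exact centreTensor_relation q r v M
  have this : ∀ (c : Fin 4) (b : Fin 3), (if (c : ℕ) + b = M then
      (binomWeight 3 c * binomWeight 2 b) • ∑ q, ∑ r, ∑ v, ∑ t,
        S c b q r v * (chainMat (Fin.tail m) v t * H q r t) else 0) =
      ∑ q, ∑ r, ∑ v, ∑ t, (if (c : ℕ) + b = M then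
        (binomWeight 3 c * binomWeight 2 b) * S c b q r v else 0) *
        (chainMat (Fin.tail m) v t * H q r t) := by
    intro c b
    split_ifs
    · simp only [smul_eq_mul, Finset.mul_sum, mul_assoc]
    · simp
  have swap : ∀ F : Fin 4 → Fin 3 → Fin 2 → Fin 2 → Fin 2 → Fin 2 → ℂ,
      ∑ c, ∑ b, ∑ q, ∑ r, ∑ v, ∑ t, F c b q r v t =
      ∑ q, ∑ r, ∑ v, ∑ t, ∑ c, ∑ b, F c b q r v t := by
    intro F
    simp only [Fin.sum_univ_two, Finset.sum_add_distrib]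
  simp only [e2, this]
  rw [swap]
  simp only [← Finset.sum_mul, rel, zero_mul, Finset.sum_const_zero]

/-- The states `starState ζ` are ground states. An exchange of legs permutes the indices of `ζ`,
so one leg suffices. -/
theorem starCond_starState {n : ℕ} (ζ : Fin 2 → Fin 2 → Fin 2 → ℂ) :
    StarCond (n := n) (starState ζ) := by
  have h1 : ∀ (ζ : Fin 2 → Fin 2 → Fin 2 → ℂ) c (m₁ m₂ : Fin (n + 1) → Fin 3),
      ChainCond fun m => starState ζ c m m₁ m₂ := fun ζ c m₁ m₂ => chainCond_sum _
  have h2 : ∀ (ζ : Fin 2 → Fin 2 → Fin 2 → ℂ) (m₁ m₂ : Fin (n + 1) → Fin 3),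
      CentreCond fun c m => starState ζ c m m₁ m₂ := by
    intro ζ m₁ m₂
    have := centreCond_sum (n := n) fun q r t => ∑ u, ∑ v, chainMat m₁ q u * chainMat m₂ r v * ζ t u v
    convert this using 10 with c m p _ t
    rw [starState]
    refine Finset.sum_congr rfl fun p _ => Finset.sum_congr rfl fun t _ => ?_
    congr 1
    simp only [Fin.sum_univ_two]
    ring
  refine ⟨h1 ζ, fun c m₀ m₂ => ?_, fun c m₀ m₁ => ?_, h2 ζ, fun m₀ m₂ => ?_, fun m₀ m₁ => ?_⟩
  · simp only [starState_swap₀₁ ζ]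
    exact h1 _ _ _ _
  · simp only [starState_swap₁₂ ζ, starState_swap₀₁ (fun t u v => ζ t v u)]
    exact h1 _ _ _ _
  · simp only [starState_swap₀₁ ζ]
    exact h2 _ _ _
  · simp only [starState_swap₁₂ ζ, starState_swap₀₁ (fun t u v => ζ t v u)]
    exact h2 _ _ _

/-- The shift relations that express divisibility of a cubic form by a linear form. -/
def CentreStep (g : Fin 4 → Fin 2 → ℂ) : Prop :=
  g 0 1 = 0 ∧ g 1 1 = g 0 0 ∧ g 2 1 = g 1 0 ∧ g 3 1 = g 2 0 ∧ g 3 0 = 0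

/-- The condition at the centre, read in the coefficients of the matrix product state of a leg. -/
theorem CentreCond.centreStep {n : ℕ} {φ : Fin 4 → (Fin (n + 3) → Fin 3) → ℂ} (h : CentreCond φ)
    (X : Fin 4 → Fin 2 → Fin 2 → ℂ)
    (hX : ∀ c m, φ c m = ∑ u, ∑ t, X c u t * chainMat m u t) (t : Fin 2) :
    CentreStep fun c u => binomWeight 3 c * X c u t := by
  obtain ⟨m, e, he, hm⟩ := exists_chainMat_eq_single n 0 t
  have key : ∀ M, ∑ c : Fin 4, ∑ b : Fin 3, (if (c : ℕ) + b = M then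
      (binomWeight 3 c * binomWeight 2 b) * ∑ u, X c u t * bondMat b u 0 else 0) = 0 := by
    intro M
    have h1 := h (Fin.cons 0 m) M
    simp only [Fin.update_cons_zero, hX, chainMat_cons, hm, smul_eq_mul] at h1
    have h2 : ∀ (c : Fin 4) (b : Fin 3), ∑ u, ∑ t', X c u t' *
        (bondMat b * e • Matrix.single 0 t (1 : ℂ) : Matrix (Fin 2) (Fin 2) ℂ) u t' =
        (∑ u, X c u t * bondMat b u 0) * e := by
      intro c b
      rw [Finset.sum_mul]
      refine Finset.sum_congr rfl fun u _ => ?_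
      rw [Finset.sum_eq_single t]
      · rw [Matrix.mul_smul, Matrix.smul_apply, mul_single_apply_same]
        simp only [smul_eq_mul]
        ring
      · intro t' _ ht'
        rw [Matrix.mul_smul, Matrix.smul_apply, mul_single_apply_of_ne _ _ _ _ _ ht']
        simp
      · simp
    simp only [h2] at h1
    apply mul_right_cancel₀ he
    rw [zero_mul]
    refine Eq.trans ?_ h1
    simp only [Finset.sum_mul, ite_mul, zero_mul, mul_assoc]
  have w0 := binomWeight_zero 2
  have w1 := binomWeight_two_one
  have w2 := binomWeight_self 2
  have hs := sqrt_two_ne_zero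
  simp only [Fin.sum_univ_four, Fin.sum_univ_three, Fin.sum_univ_two, Fin.val_zero, Fin.val_one,
    Fin.val_two, w0, w1, w2, bondMat, cons_val_zero, cons_val_one, cons_val] at key
  set r : ℂ := ((Real.sqrt 2 : ℝ) : ℂ) with hr
  have a0 := key 0
  have a1 := key 1
  have a2 := key 2
  have a3 := key 3
  have a4 := key 4
  clear key
  simp [hs] at a0 a1 a2 a3 a4
  have v3 : ((3 : Fin 4) : ℕ) = 3 := rfl
  refine ⟨?_, ?_, ?_, ?_, ?_⟩
  · simpa using a0
  · apply mul_left_cancel₀ hs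
    simp only [Fin.val_zero, Fin.val_one]
    linear_combination -a1
  · apply mul_left_cancel₀ hs
    simp only [Fin.val_two, Fin.val_one]
    linear_combination -a2
  · apply mul_left_cancel₀ hs
    simp only [Fin.val_two, v3]
    linear_combination -a3
  · simpa using a4

/-- A tensor that satisfies the shift relations in all three indices is a multiple of the symmetric
tensor `centreTensor`, up to the weights. -/
theorem eq_of_centreStep {y : Fin 4 → Fin 2 → Fin 2 → Fin 2 → ℂ}
    (h₀ : ∀ q r, CentreStep fun c p => y c p q r) (h₁ : ∀ p r, CentreStep fun c q => y c p q r)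
    (h₂ : ∀ p q, CentreStep fun c r => y c p q r) (c : Fin 4) (p q r : Fin 2) :
    y c p q r = if (c : ℕ) = (p : ℕ) + q + r then y 0 0 0 0 else 0 := by
  have a := h₀ 0 0
  have a' := h₀ 0 1
  have a'' := h₀ 1 0
  have a''' := h₀ 1 1
  have b := h₁ 0 0
  have b' := h₁ 0 1
  have b'' := h₁ 1 0
  have b''' := h₁ 1 1
  have d := h₂ 0 0
  have d' := h₂ 0 1
  have d'' := h₂ 1 0
  have d''' := h₂ 1 1
  simp only [CentreStep] at *
  fin_cases c <;> fin_cases p <;> fin_cases q <;> fin_cases r <;> simp <;> grind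

/-- The ground states of a star are the states `starState ζ`: each leg is a matrix product state,
and the conditions at the centre force its tensor to be the symmetric one. -/
theorem StarCond.exists_eq_starState {n : ℕ} {φ : Fin 4 → (Fin (n + 3) → Fin 3) →
    (Fin (n + 3) → Fin 3) → (Fin (n + 3) → Fin 3) → ℂ} (h : StarCond φ) :
    ∃ ζ, ∀ c m₀ m₁ m₂, φ c m₀ m₁ m₂ = starState ζ c m₀ m₁ m₂ := by
  choose s e he hs using exists_chainMat_eq_single (n + 1)
  have key : ∀ f : (Fin (n + 3) → Fin 3) → ℂ, ChainCond f → ∀ m,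
      f m = ∑ u, ∑ t, ((e u t)⁻¹ * f (s u t)) * chainMat m u t := by
    intro f hf m
    obtain ⟨X, hX⟩ := ChainCond.exists_eq_sum (n := n + 1) hf
    have : ∀ u t, X u t = (e u t)⁻¹ * f (s u t) := by
      intro u t
      rw [hX, hs, Finset.sum_eq_single u, Finset.sum_eq_single t]
      · simp; field_simp [he]
      · intro t' _ ht'
        simp [ht'.symm]
      · simp
      · intro u' _ hu'
        refine Finset.sum_eq_zero fun t' _ => ?_
        simp [hu'.symm]
      · simp
    simp only [← this]
    exact hX m
  let Y : Fin 4 → Fin 2 → Fin 2 → Fin 2 → Fin 2 → Fin 2 → Fin 2 → ℂ := fun c p t q u r v =>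
    (e p t)⁻¹ * ((e q u)⁻¹ * ((e r v)⁻¹ * φ c (s p t) (s q u) (s r v)))
  have hY : ∀ c m₀ m₁ m₂, φ c m₀ m₁ m₂ = ∑ p, ∑ t, chainMat m₀ p t * ∑ q, ∑ u, chainMat m₁ q u *
      ∑ r, ∑ v, chainMat m₂ r v * Y c p t q u r v := by
    intro c m₀ m₁ m₂
    rw [key _ (h.chain₀ c m₁ m₂) m₀]
    refine Finset.sum_congr rfl fun p _ => Finset.sum_congr rfl fun t _ => ?_
    rw [mul_comm, key _ (h.chain₁ c (s p t) m₂) m₁, Finset.mul_sum]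
    congr 1
    refine Finset.sum_congr rfl fun q _ => ?_
    rw [Finset.mul_sum]
    refine Finset.sum_congr rfl fun u _ => ?_
    rw [key _ (h.chain₂ c (s p t) (s q u)) m₂]
    simp only [Finset.mul_sum, Finset.sum_mul, Y]
    refine Finset.sum_congr rfl fun r _ => Finset.sum_congr rfl fun v _ => ?_
    ring
  have step₀ : ∀ t q u r v, CentreStep fun c p => binomWeight 3 c * Y c p t q u r v := by
    intro t q u r v
    have := (h.centre₀ (s q u) (s r v)).centreStep
      (fun c p t => (e p t)⁻¹ * φ c (s p t) (s q u) (s r v))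
      (fun c m => key _ (h.chain₀ c (s q u) (s r v)) m) t
    simp only [CentreStep] at this ⊢
    obtain ⟨h1, h2, h3, h4, h5⟩ := this
    refine ⟨?_, ?_, ?_, ?_, ?_⟩
    · linear_combination ((e q u)⁻¹ * (e r v)⁻¹) * h1
    · linear_combination ((e q u)⁻¹ * (e r v)⁻¹) * h2
    · linear_combination ((e q u)⁻¹ * (e r v)⁻¹) * h3
    · linear_combination ((e q u)⁻¹ * (e r v)⁻¹) * h4
    · linear_combination ((e q u)⁻¹ * (e r v)⁻¹) * h5
  have step₁ : ∀ p t u r v, CentreStep fun c q => binomWeight 3 c * Y c p t q u r v := by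
    intro p t u r v
    have := (h.centre₁ (s p t) (s r v)).centreStep
      (fun c q u => (e q u)⁻¹ * φ c (s p t) (s q u) (s r v))
      (fun c m => key _ (h.chain₁ c (s p t) (s r v)) m) u
    simp only [CentreStep] at this ⊢
    obtain ⟨h1, h2, h3, h4, h5⟩ := this
    refine ⟨?_, ?_, ?_, ?_, ?_⟩
    · linear_combination ((e p t)⁻¹ * (e r v)⁻¹) * h1
    · linear_combination ((e p t)⁻¹ * (e r v)⁻¹) * h2
    · linear_combination ((e p t)⁻¹ * (e r v)⁻¹) * h3
    · linear_combination ((e p t)⁻¹ * (e r v)⁻¹) * h4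
    · linear_combination ((e p t)⁻¹ * (e r v)⁻¹) * h5
  have step₂ : ∀ p t q u v, CentreStep fun c r => binomWeight 3 c * Y c p t q u r v := by
    intro p t q u v
    have := (h.centre₂ (s p t) (s q u)).centreStep
      (fun c r v => (e r v)⁻¹ * φ c (s p t) (s q u) (s r v))
      (fun c m => key _ (h.chain₂ c (s p t) (s q u)) m) v
    simp only [CentreStep] at this ⊢
    obtain ⟨h1, h2, h3, h4, h5⟩ := this
    refine ⟨?_, ?_, ?_, ?_, ?_⟩
    · linear_combination ((e p t)⁻¹ * (e q u)⁻¹) * h1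
    · linear_combination ((e p t)⁻¹ * (e q u)⁻¹) * h2
    · linear_combination ((e p t)⁻¹ * (e q u)⁻¹) * h3
    · linear_combination ((e p t)⁻¹ * (e q u)⁻¹) * h4
    · linear_combination ((e p t)⁻¹ * (e q u)⁻¹) * h5
  refine ⟨fun t u v => Y 0 0 t 0 u 0 v, fun c m₀ m₁ m₂ => ?_⟩
  rw [hY, starState]
  refine Finset.sum_congr rfl fun p _ => Finset.sum_congr rfl fun t _ => ?_
  congr 1
  refine Finset.sum_congr rfl fun q _ => Finset.sum_congr rfl fun u _ => ?_
  congr 1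
  refine Finset.sum_congr rfl fun r _ => Finset.sum_congr rfl fun v _ => ?_
  congr 1
  have := eq_of_centreStep (y := fun c p q r => binomWeight 3 c * Y c p t q u r v)
    (fun q r => step₀ t q u r v) (fun p r => step₁ p t u r v) (fun p q => step₂ p t q u v) c p q r
  simp only [Fin.val_zero, binomWeight_zero, one_mul] at this
  rw [centreTensor, ite_mul, zero_mul]
  have hw := binomWeight_ne_zero (d := 3) (k := c) (by omega)
  apply mul_left_cancel₀ hw
  rw [this, mul_ite, mul_zero, ← mul_assoc, mul_inv_cancel₀ hw, one_mul]

end Star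

/-! ### Gram matrices -/

section Gram

/-- Cauchy–Schwarz for finite sums of complex numbers. -/
theorem norm_sum_conj_mul_sq_le {ι : Type*} (s : Finset ι) (a b : ι → ℂ) :
    ‖∑ i ∈ s, conj (a i) * b i‖ ^ 2 ≤ (∑ i ∈ s, ‖a i‖ ^ 2) * ∑ i ∈ s, ‖b i‖ ^ 2 := by
  calc _ ≤ (∑ i ∈ s, ‖a i‖ * ‖b i‖) ^ 2 := by
        gcongr
        refine (norm_sum_le _ _).trans (Finset.sum_le_sum fun i _ => ?_)
        rw [norm_mul, RCLike.norm_conj]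
    _ ≤ _ := Finset.sum_mul_sq_le_sq_mul_sq _ _ _

/-- `GramCond M b` says that the Gram matrix of the entries of the matrices `M m` is the sum
of the identity and `b` times the rank one form given by the trace. -/
def GramCond {μ : Type*} [Fintype μ] (M : μ → Fin 2 → Fin 2 → ℂ) (b : ℝ) : Prop :=
  ∀ s' t' s t, ∑ m, conj (M m s' t') * M m s t =
    (if s' = s then 1 else 0) * (if t' = t then 1 else 0) +
      b * ((if s' = t' then 1 else 0) * (if s = t then 1 else 0))

theorem GramCond.sum_inner {μ : Type*} [Fintype μ] {M : μ → Fin 2 → Fin 2 → ℂ} {b : ℝ}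
    (h : GramCond M b) (X Y : Fin 2 → Fin 2 → ℂ) :
    ∑ m, conj (∑ s, ∑ t, M m s t * X s t) * ∑ s, ∑ t, M m s t * Y s t =
      ∑ s, ∑ t, conj (X s t) * Y s t + b * (conj (∑ s, X s s) * ∑ s, Y s s) := by
  have e : ∑ m, conj (∑ s, ∑ t, M m s t * X s t) * ∑ s, ∑ t, M m s t * Y s t =
      ∑ s', ∑ t', ∑ s, ∑ t, conj (X s' t') * Y s t * ∑ m, conj (M m s' t') * M m s t := by
    simp only [Finset.mul_sum]
    simp only [Fin.sum_univ_two, ← Finset.sum_add_distrib]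
    refine Finset.sum_congr rfl fun m _ => ?_
    simp only [map_add, map_mul]
    ring
  rw [e]
  simp only [h _ _ _ _, Fin.sum_univ_two, map_add]
  simp
  ring

theorem conj_mul_self_eq (z : ℂ) : conj z * z = ((‖z‖ ^ 2 : ℝ) : ℂ) := by
  rw [Complex.conj_mul']; push_cast; rfl

theorem GramCond.sum_norm_sq {μ : Type*} [Fintype μ] {M : μ → Fin 2 → Fin 2 → ℂ} {b : ℝ}
    (h : GramCond M b) (X : Fin 2 → Fin 2 → ℂ) :
    ∑ m, ‖∑ s, ∑ t, M m s t * X s t‖ ^ 2 =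
      ∑ s, ∑ t, ‖X s t‖ ^ 2 + b * ‖∑ s, X s s‖ ^ 2 := by
  have := h.sum_inner X X
  simp only [conj_mul_self_eq] at this
  exact_mod_cast this

theorem GramCond.swap {μ : Type*} [Fintype μ] {M : μ → Fin 2 → Fin 2 → ℂ} {b : ℝ}
    (h : GramCond M b) : GramCond (fun m s t => M m t s) b := by
  intro s' t' s t
  rw [h t' s' t s, mul_comm (if t' = t then (1 : ℂ) else 0)]
  simp only [eq_comm]

/-- The transfer operator of the AKLT matrices, with the eigenvalue 3 on the identity and the eigenvalue
-1 on the traceless matrices. -/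
theorem sum_conj_bondMat_mul (s' u' s u : Fin 2) :
    ∑ a, conj (bondMat a s' u') * bondMat a s u =
      2 * ((if s' = s then 1 else 0) * (if u' = u then 1 else 0)) -
        (if s' = u' then 1 else 0) * (if s = u then 1 else 0) := by
  have h := sqrt_two_mul_self
  fin_cases s' <;> fin_cases u' <;> fin_cases s <;> fin_cases u <;>
    simp [bondMat, Fin.sum_univ_three, h] <;> norm_num

/-- The Gram matrix of a chain: the power of the transfer operator, rearranged as a map between the
two ends. The weight of the identity grows like `3 ^ n`, that of the rank one form stays bounded. -/
theorem sum_conj_chainMat_mul (n : ℕ) (s' t' s t : Fin 2) :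
    ∑ m : Fin n → Fin 3, conj (chainMat m s' t') * chainMat m s t =
      ((3 ^ n - (-1) ^ n) / 2) * ((if s' = s then 1 else 0) * (if t' = t then 1 else 0)) +
        (-1) ^ n * ((if s' = t' then 1 else 0) * (if s = t then 1 else 0)) := by
  induction n generalizing s' t' s t with
  | zero =>
    simp [chainMat, one_apply]
  | succ n ih =>
    rw [← (Fin.consEquiv fun _ : Fin (n + 1) => Fin 3).sum_comp, Fintype.sum_prod_type]
    have e : ∀ (a : Fin 3) (m : Fin n → Fin 3),
        conj (chainMat ((Fin.consEquiv fun _ : Fin (n + 1) => Fin 3) (a, m)) s' t') *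
          chainMat ((Fin.consEquiv fun _ : Fin (n + 1) => Fin 3) (a, m)) s t =
        ∑ u', ∑ u, (conj (bondMat a s' u') * bondMat a s u) *
          (conj (chainMat m u' t') * chainMat m u t) := by
      intro a m
      have : chainMat ((Fin.consEquiv fun _ : Fin (n + 1) => Fin 3) (a, m)) =
          bondMat a * chainMat m := chainMat_cons a m
      rw [this]
      simp only [mul_apply, Fin.sum_univ_two, map_add, map_mul]
      ring
    simp only [e]
    have swap : ∀ F : Fin 3 → (Fin n → Fin 3) → Fin 2 → Fin 2 → ℂ,
        ∑ a, ∑ m, ∑ u', ∑ u, F a m u' u = ∑ u', ∑ u, ∑ a, ∑ m, F a m u' u := by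
      intro F
      simp only [Fin.sum_univ_two, Finset.sum_add_distrib]
    rw [swap]
    simp only [← Finset.mul_sum, ih, ← Finset.sum_mul, sum_conj_bondMat_mul, Fin.sum_univ_two]
    fin_cases s' <;> fin_cases t' <;> fin_cases s <;> fin_cases t <;> simp [pow_succ] <;> ring

/-- The weight of the identity in the Gram matrix of a chain. -/
noncomputable def chainNorm (n : ℕ) : ℝ := (3 ^ n - (-1) ^ n) / 2

/-- The weight of the rank one form in the Gram matrix of a chain, relative to that of the
identity. -/
noncomputable def chainRatio (n : ℕ) : ℝ := (-1) ^ n / chainNorm n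

theorem chainNorm_ge {n : ℕ} (hn : 3 ≤ n) : 13 ≤ chainNorm n := by
  have h1 : (3 : ℝ) ^ 3 ≤ 3 ^ n := pow_le_pow_right₀ (by norm_num) hn
  have h2 : (-1 : ℝ) ^ n ≤ 1 := (abs_le.1 (by simp : |(-1 : ℝ) ^ n| ≤ 1)).2
  rw [chainNorm]
  norm_num at h1
  linarith

theorem abs_chainRatio_le {n : ℕ} (hn : 3 ≤ n) : |chainRatio n| ≤ 1 / 13 := by
  have h := chainNorm_ge hn
  rw [chainRatio, abs_div, abs_of_pos (by linarith : 0 < chainNorm n)]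
  simp only [abs_pow, abs_neg, abs_one, one_pow]
  gcongr

/-- The entries of the matrices of a chain, normalized. -/
noncomputable def chainTensor (n : ℕ) (m : Fin n → Fin 3) (s t : Fin 2) : ℂ :=
  (((Real.sqrt (chainNorm n))⁻¹ : ℝ) : ℂ) * chainMat m s t

/-- The ends of a chain are nearly independent: the Gram matrix is the identity up to `chainRatio`. -/
theorem gramCond_chainTensor {n : ℕ} (hn : 3 ≤ n) : GramCond (chainTensor n) (chainRatio n) := by
  intro s' t' s t
  have h := chainNorm_ge hn
  have h1 : (((Real.sqrt (chainNorm n))⁻¹ : ℝ) : ℂ) * (((Real.sqrt (chainNorm n))⁻¹ : ℝ) : ℂ) *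
      (chainNorm n : ℂ) = 1 := by
    rw [← Complex.ofReal_mul, ← mul_inv, Real.mul_self_sqrt (by linarith), ← Complex.ofReal_mul,
      inv_mul_cancel₀ (by linarith), Complex.ofReal_one]
  have h0 : (chainNorm n : ℂ) ≠ 0 := by
    rw [Complex.ofReal_ne_zero]; linarith
  have e : ∀ m : Fin n → Fin 3, conj (chainTensor n m s' t') * chainTensor n m s t =
      (((Real.sqrt (chainNorm n))⁻¹ : ℝ) : ℂ) * (((Real.sqrt (chainNorm n))⁻¹ : ℝ) : ℂ) *
        (conj (chainMat m s' t') * chainMat m s t) := by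
    intro m
    rw [chainTensor, chainTensor, map_mul, Complex.conj_ofReal]
    ring
  have h2 : (((Real.sqrt (chainNorm n))⁻¹ : ℝ) : ℂ) * (((Real.sqrt (chainNorm n))⁻¹ : ℝ) : ℂ) =
      (chainNorm n : ℂ)⁻¹ := by
    exact eq_inv_of_mul_eq_one_left h1
  simp only [e, ← Finset.mul_sum]
  rw [sum_conj_chainMat_mul, h2, chainRatio]
  have h3 : ((3 ^ n - (-1) ^ n) / 2 : ℂ) = chainNorm n := by
    rw [chainNorm]; push_cast; rfl
  rw [h3]
  push_cast
  field_simp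

/-- `NearIsometry T ν` says that the map with the kernel `T` changes squared norms by at most the
fraction `ν`. -/
def NearIsometry {β κ : Type*} [Fintype β] [Fintype κ] (T : Fin 2 → β → κ → ℂ) (ν : ℝ) : Prop :=
  ∀ z : Fin 2 → β → ℂ, |∑ l, ‖∑ s, ∑ b, T s b l * z s b‖ ^ 2 - ∑ s, ∑ b, ‖z s b‖ ^ 2| ≤
    ν * ∑ s, ∑ b, ‖z s b‖ ^ 2

/-- The tensor of a centre with two of its legs, as a map from the three open bonds. -/
noncomputable def cornerTensor {μ : Type*} (M : μ → Fin 2 → Fin 2 → ℂ) (s : Fin 2)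
    (b : Fin 2 × Fin 2) (l : Fin 4 × μ × μ) : ℂ :=
  (((Real.sqrt 2)⁻¹ : ℝ) : ℂ) *
    ∑ p, ∑ q, centreTensor s p q l.1 * (M l.2.1 p b.1 * M l.2.2 q b.2)

theorem norm_binomWeight_inv_sq (d k : ℕ) : ‖(binomWeight d k)⁻¹‖ ^ 2 = ((d.choose k : ℝ))⁻¹ := by
  rw [norm_inv, binomWeight, Complex.norm_real, Real.norm_eq_abs, inv_pow, sq_abs,
    Real.sq_sqrt (by positivity)]

theorem norm_sq_add_le (a b : ℂ) : ‖a + b‖ ^ 2 ≤ 2 * (‖a‖ ^ 2 + ‖b‖ ^ 2) := by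
  have := norm_add_le a b
  nlinarith [norm_nonneg (a + b), sq_nonneg (‖a‖ - ‖b‖)]

theorem norm_sq_add_add_le (a b c : ℂ) :
    ‖a + b + c‖ ^ 2 ≤ 3 * (‖a‖ ^ 2 + ‖b‖ ^ 2 + ‖c‖ ^ 2) := by
  have := norm_add₃_le (a := a) (b := b) (c := c)
  nlinarith [norm_nonneg (a + b + c), sq_nonneg (‖a‖ - ‖b‖), sq_nonneg (‖a‖ - ‖c‖),
    sq_nonneg (‖b‖ - ‖c‖)]

/-- Contracting two indices of the symmetrizer of three spins 1/2 gives twice the identity. -/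
theorem sum_norm_sq_centreTensor (z : Fin 2 → ℂ) :
    ∑ c, ∑ p, ∑ q, ‖∑ s, centreTensor s p q c * z s‖ ^ 2 = 2 * ∑ s, ‖z s‖ ^ 2 := by
  have w1 := norm_binomWeight_inv_sq 3 1
  have w2 := norm_binomWeight_inv_sq 3 2
  have w0 := binomWeight_three_zero
  have w3 := binomWeight_three_three
  norm_num at w1 w2
  simp [Fin.sum_univ_four, Fin.sum_univ_two, centreTensor, w0, w3, mul_pow, w1, w2]
  ring

theorem sum_norm_sq_centreTensor_pair_le (z : Fin 2 → Fin 2 → ℂ) :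
    ∑ c, ∑ p, ‖∑ q, ∑ s, centreTensor s p q c * z s q‖ ^ 2 ≤
      4 / 3 * ∑ s, ∑ q, ‖z s q‖ ^ 2 := by
  have w1 := norm_binomWeight_inv_sq 3 1
  have w2 := norm_binomWeight_inv_sq 3 2
  have w0 := binomWeight_three_zero
  have w3 := binomWeight_three_three
  norm_num at w1 w2
  have h := norm_sq_add_le (z 1 0) (z 0 1)
  simp [Fin.sum_univ_four, Fin.sum_univ_two, centreTensor, w0, w3, ← mul_add, mul_pow, w1, w2]
  linarith

theorem sum_norm_sq_centreTensor_triple_le (z : Fin 2 → Fin 2 → Fin 2 → ℂ) :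
    ∑ c, ‖∑ p, ∑ q, ∑ s, centreTensor s p q c * z s p q‖ ^ 2 ≤
      ∑ s, ∑ p, ∑ q, ‖z s p q‖ ^ 2 := by
  have w1 := norm_binomWeight_inv_sq 3 1
  have w2 := norm_binomWeight_inv_sq 3 2
  have w0 := binomWeight_three_zero
  have w3 := binomWeight_three_three
  norm_num at w1 w2
  have h1 := norm_sq_add_add_le (z 1 0 0) (z 0 0 1) (z 0 1 0)
  have h2 := norm_sq_add_add_le (z 1 0 1) (z 1 1 0) (z 0 1 1)
  simp [Fin.sum_univ_four, Fin.sum_univ_two, centreTensor, w0, w3, ← mul_add, mul_pow, w1, w2,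
    ← add_assoc]
  ring_nf at h1 h2 ⊢
  linarith

/-- Two independent chains attached to a tensor with two pairs of indices. -/
theorem GramCond.sum_norm_sq_pair {μ : Type*} [Fintype μ] {M : μ → Fin 2 → Fin 2 → ℂ} {b : ℝ}
    (h : GramCond M b) (Z : Fin 2 → Fin 2 → Fin 2 → Fin 2 → ℂ) :
    ∑ m₁, ∑ m₂, ‖∑ p, ∑ b₁, M m₁ p b₁ * ∑ q, ∑ b₂, M m₂ q b₂ * Z p b₁ q b₂‖ ^ 2 =
      (∑ p, ∑ b₁, ∑ q, ∑ b₂, ‖Z p b₁ q b₂‖ ^ 2 + b * ∑ p, ∑ b₁, ‖∑ q, Z p b₁ q q‖ ^ 2) +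
        b * (∑ q, ∑ b₂, ‖∑ p, Z p p q b₂‖ ^ 2 + b * ‖∑ q, ∑ p, Z p p q q‖ ^ 2) := by
  rw [Finset.sum_comm]
  simp only [h.sum_norm_sq, Finset.sum_add_distrib, ← Finset.mul_sum]
  have r1 : ∀ F : μ → Fin 2 → Fin 2 → ℝ, ∑ m, ∑ p, ∑ q, F m p q = ∑ p, ∑ q, ∑ m, F m p q := by
    intro F
    simp only [Fin.sum_univ_two, Finset.sum_add_distrib]
  rw [r1]
  simp only [h.sum_norm_sq, Finset.sum_add_distrib, ← Finset.mul_sum]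
  have r2 : ∀ m : μ, ∑ p, ∑ q, ∑ b₂, M m q b₂ * Z p p q b₂ =
      ∑ q, ∑ b₂, M m q b₂ * ∑ p, Z p p q b₂ := by
    intro m
    simp only [Fin.sum_univ_two]
    ring
  simp only [r2, h.sum_norm_sq]

/-- The norm of a corner in terms of its centre `Z` alone: each of the two legs contributes the identity
and `b` times a contraction of its ends. -/
theorem sum_norm_sq_cornerTensor {μ : Type*} [Fintype μ] {M : μ → Fin 2 → Fin 2 → ℂ} {b : ℝ}
    (h : GramCond M b) (z : Fin 2 → Fin 2 × Fin 2 → ℂ)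
    (Z : Fin 4 → Fin 2 → Fin 2 → Fin 2 → Fin 2 → ℂ)
    (hZ : ∀ c p b₁ q b₂, Z c p b₁ q b₂ = ∑ s, centreTensor s p q c * z s (b₁, b₂)) :
    ∑ l, ‖∑ s, ∑ b, cornerTensor M s b l * z s b‖ ^ 2 = 1 / 2 *
      ((∑ c, ∑ p, ∑ b₁, ∑ q, ∑ b₂, ‖Z c p b₁ q b₂‖ ^ 2 +
          b * ∑ c, ∑ p, ∑ b₁, ‖∑ q, Z c p b₁ q q‖ ^ 2) +
        b * (∑ c, ∑ q, ∑ b₂, ‖∑ p, Z c p p q b₂‖ ^ 2 +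
          b * ∑ c, ‖∑ q, ∑ p, Z c p p q q‖ ^ 2)) := by
  have hs : ‖(((Real.sqrt 2)⁻¹ : ℝ) : ℂ)‖ ^ 2 = 1 / 2 := by
    rw [Complex.norm_real, Real.norm_eq_abs, sq_abs, inv_pow, Real.sq_sqrt (by norm_num)]
    norm_num
  have e1 : ∀ l : Fin 4 × μ × μ, ‖∑ s, ∑ b, cornerTensor M s b l * z s b‖ ^ 2 =
      1 / 2 * ‖∑ p, ∑ b₁, M l.2.1 p b₁ * ∑ q, ∑ b₂, M l.2.2 q b₂ * Z l.1 p b₁ q b₂‖ ^ 2 := by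
    intro l
    rw [← hs, ← mul_pow, ← norm_mul]
    congr 2
    simp only [cornerTensor, Fintype.sum_prod_type, hZ, Fin.sum_univ_two]
    ring
  rw [Finset.sum_congr rfl fun l _ => e1 l, ← Finset.mul_sum, Fintype.sum_prod_type]
  congr 1
  simp only [Fintype.sum_prod_type (α₁ := μ), h.sum_norm_sq_pair, Finset.sum_add_distrib,
    ← Finset.mul_sum]

theorem abs_half_sub_le {b N N₁ N₂ N₃ : ℝ} (hb : |b| ≤ 1 / 13) (p₁ : 0 ≤ N₁) (p₂ : 0 ≤ N₂)
    (p₃ : 0 ≤ N₃) (n₁ : N₁ ≤ 4 / 3 * N) (n₂ : N₂ ≤ 4 / 3 * N) (n₃ : N₃ ≤ N) :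
    |1 / 2 * ((2 * N + b * N₁) + b * (N₂ + b * N₃)) - N| ≤ 11 / 100 * N := by
  have q1 : |b * N₁| ≤ 1 / 13 * (4 / 3 * N) := by
    rw [abs_mul, abs_of_nonneg p₁]; gcongr
  have q2 : |b * N₂| ≤ 1 / 13 * (4 / 3 * N) := by
    rw [abs_mul, abs_of_nonneg p₂]; gcongr
  have q3 : |b * (b * N₃)| ≤ 1 / 13 * (1 / 13 * N) := by
    rw [abs_mul, abs_mul, abs_of_nonneg p₃]; gcongr
  have hN : 0 ≤ N := p₃.trans n₃
  rw [abs_le] at q1 q2 q3 ⊢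
  rw [mul_add b]
  constructor <;> linarith [q1.1, q1.2, q2.1, q2.2, q3.1, q3.2]

/-- A corner is nearly an isometry of its three open bonds. For `b = 0` it would be one;
the three corrections, of order `b`, `b` and `b ^ 2`, come from contracting the ends of its legs. -/
theorem nearIsometry_cornerTensor {μ : Type*} [Fintype μ] {M : μ → Fin 2 → Fin 2 → ℂ} {b : ℝ}
    (h : GramCond M b) (hb : |b| ≤ 1 / 13) : NearIsometry (cornerTensor M) (11 / 100) := by
  intro z
  obtain ⟨Z, hZ⟩ : ∃ Z : Fin 4 → Fin 2 → Fin 2 → Fin 2 → Fin 2 → ℂ, ∀ c p b₁ q b₂,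
      Z c p b₁ q b₂ = ∑ s, centreTensor s p q c * z s (b₁, b₂) := ⟨_, fun _ _ _ _ _ => rfl⟩
  have swap₁ : ∀ F : Fin 4 → Fin 2 → Fin 2 → ℝ,
      ∑ c, ∑ q, ∑ b₂, F c q b₂ = ∑ b₂, ∑ c, ∑ q, F c q b₂ := fun F =>
    (Finset.sum_congr rfl fun c _ => Finset.sum_comm).trans Finset.sum_comm
  have swap₃ : ∀ F : Fin 4 → Fin 2 → Fin 2 → Fin 2 → Fin 2 → ℝ,
      ∑ c, ∑ p, ∑ b₁, ∑ q, ∑ b₂, F c p b₁ q b₂ =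
        ∑ b₁, ∑ b₂, ∑ c, ∑ p, ∑ q, F c p b₁ q b₂ := by
    intro F
    rw [swap₁ fun c p b₁ => ∑ q, ∑ b₂, F c p b₁ q b₂]
    refine Finset.sum_congr rfl fun b₁ _ => ?_
    rw [← swap₁ fun c p b₂ => ∑ q, F c p b₁ q b₂]
    exact Finset.sum_congr rfl fun c _ => Finset.sum_congr rfl fun p _ => Finset.sum_comm
  have prod : ∀ f : Fin 2 → Fin 2 × Fin 2 → ℝ,
      ∑ b₁, ∑ s, ∑ b₂, f s (b₁, b₂) = ∑ s, ∑ b, f s b := by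
    intro f
    simp only [Fintype.sum_prod_type, Fin.sum_univ_two]
    ring
  have n0 : ∑ c, ∑ p, ∑ b₁, ∑ q, ∑ b₂, ‖Z c p b₁ q b₂‖ ^ 2 = 2 * ∑ s, ∑ b, ‖z s b‖ ^ 2 := by
    rw [swap₃]
    simp only [hZ, sum_norm_sq_centreTensor, ← Finset.mul_sum]
    rw [← prod]
    congr 1
    refine Finset.sum_congr rfl fun b₁ _ => Finset.sum_comm
  have n1 : ∑ c, ∑ p, ∑ b₁, ‖∑ q, Z c p b₁ q q‖ ^ 2 ≤ 4 / 3 * ∑ s, ∑ b, ‖z s b‖ ^ 2 := by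
    rw [swap₁, ← prod, Finset.mul_sum]
    refine Finset.sum_le_sum fun b₁ _ => ?_
    simp only [hZ]
    exact sum_norm_sq_centreTensor_pair_le fun s q => z s (b₁, q)
  have sym : ∀ c s p q, centreTensor s p q c = centreTensor s q p c := fun c s p q => by
    rw [centreTensor, centreTensor, add_right_comm (s : ℕ)]
  have n2 : ∑ c, ∑ q, ∑ b₂, ‖∑ p, Z c p p q b₂‖ ^ 2 ≤ 4 / 3 * ∑ s, ∑ b, ‖z s b‖ ^ 2 := by
    have e : ∀ c q b₂, ∑ p, Z c p p q b₂ = ∑ p, ∑ s, centreTensor s q p c * z s (p, b₂) := by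
      intro c q b₂
      refine Finset.sum_congr rfl fun p _ => ?_
      rw [hZ]
      refine Finset.sum_congr rfl fun s _ => ?_
      rw [sym]
    have prod' : ∑ b₂, ∑ s, ∑ p, ‖z s (p, b₂)‖ ^ 2 = ∑ s, ∑ b, ‖z s b‖ ^ 2 := by
      simp only [Fintype.sum_prod_type]
      rw [Finset.sum_comm]
      exact Finset.sum_congr rfl fun s _ => Finset.sum_comm
    rw [swap₁, ← prod', Finset.mul_sum]
    refine Finset.sum_le_sum fun b₂ _ => ?_
    simp only [e]
    exact sum_norm_sq_centreTensor_pair_le fun s q => z s (q, b₂)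
  have n3 : ∑ c, ‖∑ q, ∑ p, Z c p p q q‖ ^ 2 ≤ ∑ s, ∑ b, ‖z s b‖ ^ 2 := by
    have := sum_norm_sq_centreTensor_triple_le fun s p q => z s (p, q)
    simp only [Fintype.sum_prod_type]
    have e : ∀ c, ∑ q, ∑ p, Z c p p q q = ∑ p, ∑ q, ∑ s, centreTensor s p q c * z s (p, q) := by
      intro c
      rw [Finset.sum_comm]
      simp only [hZ]
    simp only [e]
    exact this
  have p1 : 0 ≤ ∑ c, ∑ p, ∑ b₁, ‖∑ q, Z c p b₁ q q‖ ^ 2 :=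
    Finset.sum_nonneg fun _ _ => Finset.sum_nonneg fun _ _ => Finset.sum_nonneg fun _ _ => sq_nonneg _
  have p2 : 0 ≤ ∑ c, ∑ q, ∑ b₂, ‖∑ p, Z c p p q b₂‖ ^ 2 :=
    Finset.sum_nonneg fun _ _ => Finset.sum_nonneg fun _ _ => Finset.sum_nonneg fun _ _ => sq_nonneg _
  have p3 : 0 ≤ ∑ c, ‖∑ q, ∑ p, Z c p p q q‖ ^ 2 :=
    Finset.sum_nonneg fun _ _ => sq_nonneg _
  rw [sum_norm_sq_cornerTensor h z Z hZ, n0]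
  exact abs_half_sub_le hb p1 p2 p3 n1 n2 n3

end Gram

/-! ### The angle between the ground spaces of two overlapping stars -/

section DoubleStar

variable {β κ κ' μ : Type*} [Fintype β] [Fintype κ] [Fintype κ'] [Fintype μ]

theorem inner_eq_sum_conj {ι : Type*} [Fintype ι] (x y : EuclideanSpace ℂ ι) :
    ⟪x, y⟫_ℂ = ∑ i, conj (x i) * y i := by
  rw [PiLp.inner_apply]
  refine Finset.sum_congr rfl fun i _ => ?_
  rw [RCLike.inner_apply, mul_comm]

theorem NearIsometry.slice {T : Fin 2 → β → κ → ℂ} {ν : ℝ} (h : NearIsometry T ν) (s : Fin 2)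
    (w : β → ℂ) : |∑ l, ‖∑ b, T s b l * w b‖ ^ 2 - ∑ b, ‖w b‖ ^ 2| ≤ ν * ∑ b, ‖w b‖ ^ 2 := by
  have := h fun s' b => if s' = s then w b else 0
  have e1 : ∀ l, ∑ s', ∑ b, T s' b l * (if s' = s then w b else 0) = ∑ b, T s b l * w b := by
    intro l
    rw [Finset.sum_eq_single s]
    · simp
    · intro s' _ hs'
      simp [hs']
    · simp
  have e2 : ∑ s', ∑ b, ‖(if s' = s then w b else 0)‖ ^ 2 = ∑ b, ‖w b‖ ^ 2 := by
    rw [Finset.sum_eq_single s]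
    · simp
    · intro s' _ hs'
      simp [hs']
    · simp
  simpa only [e1, e2] using this

/-- A tensor and a chain that share one bond: a multiple of a near isometry. -/
theorem abs_sum_norm_sq_tensor_chain_le {M : μ → Fin 2 → Fin 2 → ℂ} {b ν : ℝ} (hM : GramCond M b)
    {T : Fin 2 → β → κ → ℂ} (hT : NearIsometry T ν) (z : Fin 2 → β → ℂ) :
    |∑ l, ∑ m, ‖∑ s, ∑ t, M m s t * ∑ b', T s b' l * z t b'‖ ^ 2 - 2 * ∑ t, ∑ b', ‖z t b'‖ ^ 2| ≤
      (2 * ν + |b| * (1 + ν)) * ∑ t, ∑ b', ‖z t b'‖ ^ 2 := by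
  simp only [hM.sum_norm_sq, Finset.sum_add_distrib, ← Finset.mul_sum]
  have h1 := hT z
  have h2 : |∑ l, ∑ s, ∑ t, ‖∑ b', T s b' l * z t b'‖ ^ 2 - 2 * ∑ t, ∑ b', ‖z t b'‖ ^ 2| ≤
      2 * ν * ∑ t, ∑ b', ‖z t b'‖ ^ 2 := by
    have e1 : ∑ l, ∑ s, ∑ t, ‖∑ b', T s b' l * z t b'‖ ^ 2 - 2 * ∑ t, ∑ b', ‖z t b'‖ ^ 2 =
        ∑ s : Fin 2, ∑ t, (∑ l, ‖∑ b', T s b' l * z t b'‖ ^ 2 - ∑ b', ‖z t b'‖ ^ 2) := by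
      simp only [Fin.sum_univ_two, Finset.sum_add_distrib]
      ring
    have e2 : 2 * ν * ∑ t, ∑ b', ‖z t b'‖ ^ 2 =
        ∑ _s : Fin 2, ∑ t, ν * ∑ b', ‖z t b'‖ ^ 2 := by
      simp only [Fin.sum_univ_two]
      ring
    rw [e1, e2]
    refine (Finset.abs_sum_le_sum_abs _ _).trans (Finset.sum_le_sum fun s _ => ?_)
    refine (Finset.abs_sum_le_sum_abs _ _).trans (Finset.sum_le_sum fun t _ => ?_)
    exact hT.slice s _
  have h0 : 0 ≤ ∑ l, ‖∑ s, ∑ b', T s b' l * z s b'‖ ^ 2 := Finset.sum_nonneg fun _ _ => sq_nonneg _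
  have h3 : |b * ∑ l, ‖∑ s, ∑ b', T s b' l * z s b'‖ ^ 2| ≤
      |b| * ((1 + ν) * ∑ t, ∑ b', ‖z t b'‖ ^ 2) := by
    rw [abs_mul, abs_of_nonneg h0]
    gcongr
    linarith [(abs_le.1 h1).2]
  rw [abs_le] at h2 h3 ⊢
  constructor <;> linarith [h2.1, h2.2, h3.1, h3.2]

/-- States of a double star which are ground states of the left star, with the boundary
condition `ξ`. -/
noncomputable def leftMap (M : μ → Fin 2 → Fin 2 → ℂ) (T : Fin 2 → β → κ → ℂ) :
    EuclideanSpace ℂ (β × Fin 2 × κ') →ₗ[ℂ] EuclideanSpace ℂ (κ × μ × κ') where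
  toFun ξ := WithLp.toLp 2 fun i =>
    ∑ s, ∑ t, M i.2.1 s t * ∑ b, T s b i.1 * ξ (b, t, i.2.2)
  map_add' ξ ξ' := by
    ext i
    simp only [PiLp.add_apply, mul_add, Finset.sum_add_distrib]
  map_smul' c ξ := by
    ext i
    simp only [PiLp.smul_apply, smul_eq_mul, Finset.mul_sum, RingHom.id_apply]
    refine Finset.sum_congr rfl fun s _ => Finset.sum_congr rfl fun t _ =>
      Finset.sum_congr rfl fun b _ => ?_
    ring

/-- States of a double star which are ground states of the right star, with the boundary
condition `η`. -/
noncomputable def rightMap (M : μ → Fin 2 → Fin 2 → ℂ) (T : Fin 2 → β → κ' → ℂ) :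
    EuclideanSpace ℂ (κ × Fin 2 × β) →ₗ[ℂ] EuclideanSpace ℂ (κ × μ × κ') where
  toFun η := WithLp.toLp 2 fun i =>
    ∑ s, ∑ t, M i.2.1 s t * ∑ b, T t b i.2.2 * η (i.1, s, b)
  map_add' ξ ξ' := by
    ext i
    simp only [PiLp.add_apply, mul_add, Finset.sum_add_distrib]
  map_smul' c ξ := by
    ext i
    simp only [PiLp.smul_apply, smul_eq_mul, Finset.mul_sum, RingHom.id_apply]
    refine Finset.sum_congr rfl fun s _ => Finset.sum_congr rfl fun t _ =>
      Finset.sum_congr rfl fun b _ => ?_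
    ring

/-- States of a double star which are ground states of both stars, with the boundary
condition `ω`. -/
noncomputable def bothMap (M : μ → Fin 2 → Fin 2 → ℂ) (T : Fin 2 → β → κ → ℂ)
    (T' : Fin 2 → β → κ' → ℂ) (ω : β → β → ℂ) : EuclideanSpace ℂ (κ × μ × κ') :=
  WithLp.toLp 2 fun i =>
    ∑ s, ∑ t, M i.2.1 s t * ∑ b, ∑ b', T s b i.1 * T' t b' i.2.2 * ω b b'

variable {M : μ → Fin 2 → Fin 2 → ℂ} {T : Fin 2 → β → κ → ℂ} {T' : Fin 2 → β → κ' → ℂ} {b ν : ℝ}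

theorem abs_norm_sq_leftMap_le (hM : GramCond M b) (hT : NearIsometry T ν)
    (ξ : EuclideanSpace ℂ (β × Fin 2 × κ')) :
    |‖leftMap M T ξ‖ ^ 2 - 2 * ‖ξ‖ ^ 2| ≤ (2 * ν + |b| * (1 + ν)) * ‖ξ‖ ^ 2 := by
  have e1 : ‖leftMap M T ξ‖ ^ 2 = ∑ r, ∑ l, ∑ m,
      ‖∑ s, ∑ t, M m s t * ∑ b', T s b' l * ξ (b', t, r)‖ ^ 2 := by
    rw [EuclideanSpace.norm_sq_eq, Fintype.sum_prod_type]
    simp only [Fintype.sum_prod_type]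
    refine (Finset.sum_congr rfl fun l _ => Finset.sum_comm).trans Finset.sum_comm
  have e2 : ‖ξ‖ ^ 2 = ∑ r, ∑ t, ∑ b', ‖ξ (b', t, r)‖ ^ 2 := by
    rw [EuclideanSpace.norm_sq_eq, Fintype.sum_prod_type, Finset.sum_comm,
      Fintype.sum_prod_type, Finset.sum_comm]
  rw [e1, e2, Finset.mul_sum, ← Finset.sum_sub_distrib, Finset.mul_sum]
  refine (Finset.abs_sum_le_sum_abs _ _).trans (Finset.sum_le_sum fun r _ => ?_)
  exact abs_sum_norm_sq_tensor_chain_le hM hT fun t b' => ξ (b', t, r)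

theorem abs_norm_sq_rightMap_le (hM : GramCond M b) (hT : NearIsometry T' ν)
    (η : EuclideanSpace ℂ (κ × Fin 2 × β)) :
    |‖rightMap M T' η‖ ^ 2 - 2 * ‖η‖ ^ 2| ≤ (2 * ν + |b| * (1 + ν)) * ‖η‖ ^ 2 := by
  have e1 : ‖rightMap M T' η‖ ^ 2 = ∑ l, ∑ r, ∑ m,
      ‖∑ t, ∑ s, M m s t * ∑ b', T' t b' r * η (l, s, b')‖ ^ 2 := by
    rw [EuclideanSpace.norm_sq_eq, Fintype.sum_prod_type]
    refine Finset.sum_congr rfl fun l _ => ?_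
    rw [Fintype.sum_prod_type, Finset.sum_comm]
    refine Finset.sum_congr rfl fun r _ => Finset.sum_congr rfl fun m _ => ?_
    rw [Finset.sum_comm]
    rfl
  have e2 : ‖η‖ ^ 2 = ∑ l, ∑ s, ∑ b', ‖η (l, s, b')‖ ^ 2 := by
    rw [EuclideanSpace.norm_sq_eq, Fintype.sum_prod_type]
    simp only [Fintype.sum_prod_type]
  rw [e1, e2, Finset.mul_sum, ← Finset.sum_sub_distrib, Finset.mul_sum]
  refine (Finset.abs_sum_le_sum_abs _ _).trans (Finset.sum_le_sum fun l _ => ?_)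
  exact abs_sum_norm_sq_tensor_chain_le hM.swap hT fun s b' => η (l, s, b')

/-- The part of a left ground state that enters its overlap with right ground states: what
remains of the boundary condition when the right star is contracted. -/
noncomputable def overlapBoundary (T' : Fin 2 → β → κ' → ℂ) (ξ : EuclideanSpace ℂ (β × Fin 2 × κ'))
    (b b' : β) : ℂ :=
  ∑ t, ∑ r, conj (T' t b' r) * ξ (b, t, r)

/-- The boundary condition of the right star given by a boundary condition `ω` of the
double star. -/
noncomputable def extendLeft (T : Fin 2 → β → κ → ℂ) (ω : β → β → ℂ) :
    EuclideanSpace ℂ (κ × Fin 2 × β) :=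
  WithLp.toLp 2 fun i => ∑ b, T i.2.1 b i.1 * ω b i.2.2

theorem rightMap_extendLeft (ω : β → β → ℂ) :
    rightMap M T' (extendLeft T ω) = bothMap M T T' ω := by
  ext i
  simp only [rightMap, bothMap, extendLeft, LinearMap.coe_mk, AddHom.coe_mk]
  refine Finset.sum_congr rfl fun s _ => Finset.sum_congr rfl fun t _ => ?_
  congr 1
  rw [Finset.sum_comm]
  refine Finset.sum_congr rfl fun b' _ => ?_
  rw [Finset.mul_sum]
  refine Finset.sum_congr rfl fun b _ => ?_
  ring

/-- The boundary condition of the left star given by a boundary condition `ω` of the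
double star. -/
noncomputable def extendRight (T' : Fin 2 → β → κ' → ℂ) (ω : β → β → ℂ) :
    EuclideanSpace ℂ (β × Fin 2 × κ') :=
  WithLp.toLp 2 fun i => ∑ b', T' i.2.1 b' i.2.2 * ω i.1 b'

theorem leftMap_extendRight (ω : β → β → ℂ) :
    leftMap M T (extendRight T' ω) = bothMap M T T' ω := by
  ext i
  simp only [leftMap, bothMap, extendRight, LinearMap.coe_mk, AddHom.coe_mk]
  refine Finset.sum_congr rfl fun s _ => Finset.sum_congr rfl fun t _ => ?_
  congr 1
  refine Finset.sum_congr rfl fun b _ => ?_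
  rw [Finset.mul_sum]
  refine Finset.sum_congr rfl fun b' _ => ?_
  ring

theorem sum_norm_sq_slices_le (hT : NearIsometry T ν) (w : β → ℂ) :
    ∑ s, ∑ l, ‖∑ b, T s b l * w b‖ ^ 2 ≤ 2 * (1 + ν) * ∑ b, ‖w b‖ ^ 2 := by
  have h0 := (abs_le.1 (hT.slice 0 w)).2
  have h1 := (abs_le.1 (hT.slice 1 w)).2
  rw [Fin.sum_univ_two]
  linarith

theorem norm_sq_extendLeft_le (hT : NearIsometry T ν) (ω : β → β → ℂ) :
    ‖extendLeft T ω‖ ^ 2 ≤ 2 * (1 + ν) * ∑ b, ∑ b', ‖ω b b'‖ ^ 2 := by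
  have e : ‖extendLeft T ω‖ ^ 2 = ∑ b', ∑ s, ∑ l, ‖∑ b, T s b l * ω b b'‖ ^ 2 := by
    rw [EuclideanSpace.norm_sq_eq, Fintype.sum_prod_type, Finset.sum_comm, Fintype.sum_prod_type,
      Finset.sum_comm]
    rfl
  rw [e, Finset.sum_comm (s := Finset.univ (α := β)) (t := Finset.univ (α := β)), Finset.mul_sum]
  exact Finset.sum_le_sum fun b' _ => sum_norm_sq_slices_le hT fun b => ω b b'

theorem sum_norm_sq_overlapBoundary_le (hν : 0 ≤ ν) (hT : NearIsometry T' ν)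
    (ξ : EuclideanSpace ℂ (β × Fin 2 × κ')) :
    ∑ b, ∑ b', ‖overlapBoundary T' ξ b b'‖ ^ 2 ≤ 2 * (1 + ν) * ‖ξ‖ ^ 2 := by
  have e : ‖ξ‖ ^ 2 = ∑ b, ∑ t, ∑ r, ‖ξ (b, t, r)‖ ^ 2 := by
    rw [EuclideanSpace.norm_sq_eq, Fintype.sum_prod_type]
    simp only [Fintype.sum_prod_type]
  rw [e, Finset.mul_sum]
  refine Finset.sum_le_sum fun b _ => ?_
  -- the adjoint of a map has the same norm
  set w := overlapBoundary T' ξ b with hw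
  have h1 : ((∑ b', ‖w b'‖ ^ 2 : ℝ) : ℂ) =
      ∑ p : Fin 2 × κ', conj (∑ b', T' p.1 b' p.2 * w b') * ξ (b, p) := by
    push_cast
    have : ∀ b', ((‖w b'‖ : ℂ) ^ 2) = ∑ p : Fin 2 × κ', conj (w b') * (conj (T' p.1 b' p.2) * ξ (b, p)) := by
      intro b'
      rw [← Complex.conj_mul', ← Finset.mul_sum, Fintype.sum_prod_type]
      rfl
    simp only [this]
    rw [Finset.sum_comm]
    refine Finset.sum_congr rfl fun p _ => ?_
    rw [map_sum, Finset.sum_mul]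
    refine Finset.sum_congr rfl fun b' _ => ?_
    rw [map_mul]; ring
  have h2 := norm_sum_conj_mul_sq_le Finset.univ
    (fun p : Fin 2 × κ' => ∑ b', T' p.1 b' p.2 * w b') (fun p => ξ (b, p))
  have h0 : 0 ≤ ∑ b', ‖w b'‖ ^ 2 := Finset.sum_nonneg fun _ _ => sq_nonneg _
  rw [← h1, Complex.norm_real, Real.norm_of_nonneg h0, Fintype.sum_prod_type,
    Fintype.sum_prod_type] at h2
  have h3 := sum_norm_sq_slices_le hT w
  have h4 : 0 ≤ ∑ t, ∑ r, ‖ξ (b, t, r)‖ ^ 2 :=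
    Finset.sum_nonneg fun _ _ => Finset.sum_nonneg fun _ _ => sq_nonneg _
  rcases eq_or_lt_of_le h0 with h0 | h0
  · rw [← h0]; positivity
  · refine le_of_mul_le_mul_left ?_ h0
    calc _ = (∑ b', ‖w b'‖ ^ 2) ^ 2 := (sq _).symm
      _ ≤ _ := h2
      _ ≤ (2 * (1 + ν) * ∑ b', ‖w b'‖ ^ 2) * ∑ t, ∑ r, ‖ξ (b, t, r)‖ ^ 2 := by gcongr
      _ = _ := by ring

theorem conj_extendLeft_overlapBoundary (ξ : EuclideanSpace ℂ (β × Fin 2 × κ')) (l : κ)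
    (s : Fin 2) (b' : β) :
    conj (extendLeft T (overlapBoundary T' ξ) (l, s, b')) =
      ∑ r, ∑ t, conj (∑ b, T s b l * ξ (b, t, r)) * T' t b' r := by
  simp only [extendLeft, overlapBoundary, map_sum, map_mul, Complex.conj_conj, Finset.mul_sum,
    Finset.sum_mul]
  refine ((Finset.sum_congr rfl fun b _ => Finset.sum_comm).trans Finset.sum_comm).trans ?_
  refine Finset.sum_congr rfl fun r _ => Finset.sum_comm.trans ?_
  refine Finset.sum_congr rfl fun t _ => Finset.sum_congr rfl fun b _ => ?_
  ring

/-- The overlap of a left and a right ground state, up to the error of the shared leg: if the Gram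
matrix of this leg were the identity, the right star would see the left state as the state with the
boundary condition `extendLeft T (overlapBoundary T' ξ)`, which is a common ground state. -/
theorem norm_inner_leftMap_rightMap_sub_le (hν : 0 ≤ ν) (hM : GramCond M b)
    (hT : NearIsometry T ν) (hT' : NearIsometry T' ν)
    (ξ : EuclideanSpace ℂ (β × Fin 2 × κ')) (η : EuclideanSpace ℂ (κ × Fin 2 × β)) :
    ‖⟪leftMap M T ξ, rightMap M T' η⟫_ℂ - ⟪extendLeft T (overlapBoundary T' ξ), η⟫_ℂ‖ ≤
      |b| * (1 + ν) * (‖ξ‖ * ‖η‖) := by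
  have e1 : ⟪leftMap M T ξ, rightMap M T' η⟫_ℂ = ∑ l, ∑ r,
      (∑ s, ∑ t, conj (∑ b', T s b' l * ξ (b', t, r)) * (∑ b', T' t b' r * η (l, s, b')) +
        b * (conj (∑ s, ∑ b', T s b' l * ξ (b', s, r)) * ∑ s, ∑ b', T' s b' r * η (l, s, b'))) := by
    rw [inner_eq_sum_conj, Fintype.sum_prod_type]
    refine Finset.sum_congr rfl fun l _ => ?_
    rw [Fintype.sum_prod_type, Finset.sum_comm]
    refine Finset.sum_congr rfl fun r _ => ?_
    exact hM.sum_inner (fun s t => ∑ b', T s b' l * ξ (b', t, r))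
      (fun s t => ∑ b', T' t b' r * η (l, s, b'))
  have e2 : ⟪extendLeft T (overlapBoundary T' ξ), η⟫_ℂ = ∑ l, ∑ r,
      ∑ s, ∑ t, conj (∑ b', T s b' l * ξ (b', t, r)) * (∑ b', T' t b' r * η (l, s, b')) := by
    rw [inner_eq_sum_conj, Fintype.sum_prod_type]
    refine Finset.sum_congr rfl fun l _ => ?_
    rw [Fintype.sum_prod_type, Finset.sum_comm (t := Finset.univ (α := Fin 2))]
    refine Finset.sum_congr rfl fun s _ => ?_
    calc ∑ b', conj (extendLeft T (overlapBoundary T' ξ) (l, s, b')) * η (l, s, b')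
        = ∑ b', ∑ r, ∑ t, conj (∑ b, T s b l * ξ (b, t, r)) * (T' t b' r * η (l, s, b')) := by
          refine Finset.sum_congr rfl fun b' _ => ?_
          rw [conj_extendLeft_overlapBoundary, Finset.sum_mul]
          refine Finset.sum_congr rfl fun r _ => ?_
          rw [Finset.sum_mul]
          refine Finset.sum_congr rfl fun t _ => ?_
          ring
      _ = _ := by
          rw [Finset.sum_comm]
          refine Finset.sum_congr rfl fun r _ => ?_
          rw [Finset.sum_comm]
          refine Finset.sum_congr rfl fun t _ => ?_
          rw [Finset.mul_sum]
  have e3 : ⟪leftMap M T ξ, rightMap M T' η⟫_ℂ - ⟪extendLeft T (overlapBoundary T' ξ), η⟫_ℂ =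
      b * ∑ p : κ × κ', conj (∑ s, ∑ b', T s b' p.1 * ξ (b', s, p.2)) *
        ∑ s, ∑ b', T' s b' p.2 * η (p.1, s, b') := by
    rw [e1, e2, Fintype.sum_prod_type, Finset.mul_sum, ← Finset.sum_sub_distrib]
    refine Finset.sum_congr rfl fun l _ => ?_
    rw [← Finset.sum_sub_distrib, Finset.mul_sum]
    refine Finset.sum_congr rfl fun r _ => ?_
    ring
  have h1 : ∑ p : κ × κ', ‖∑ s, ∑ b', T s b' p.1 * ξ (b', s, p.2)‖ ^ 2 ≤ (1 + ν) * ‖ξ‖ ^ 2 := by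
    have e : ‖ξ‖ ^ 2 = ∑ r, ∑ t, ∑ b', ‖ξ (b', t, r)‖ ^ 2 := by
      rw [EuclideanSpace.norm_sq_eq, Fintype.sum_prod_type, Finset.sum_comm,
        Fintype.sum_prod_type, Finset.sum_comm]
    rw [Fintype.sum_prod_type, Finset.sum_comm, e, Finset.mul_sum]
    refine Finset.sum_le_sum fun r _ => ?_
    have := (abs_le.1 (hT fun s b' => ξ (b', s, r))).2
    linarith
  have h2 : ∑ p : κ × κ', ‖∑ s, ∑ b', T' s b' p.2 * η (p.1, s, b')‖ ^ 2 ≤ (1 + ν) * ‖η‖ ^ 2 := by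
    have e : ‖η‖ ^ 2 = ∑ l, ∑ s, ∑ b', ‖η (l, s, b')‖ ^ 2 := by
      rw [EuclideanSpace.norm_sq_eq, Fintype.sum_prod_type]
      simp only [Fintype.sum_prod_type]
    rw [Fintype.sum_prod_type, e, Finset.mul_sum]
    refine Finset.sum_le_sum fun l _ => ?_
    have := (abs_le.1 (hT' fun s b' => η (l, s, b'))).2
    linarith
  rw [e3, norm_mul, Complex.norm_real, Real.norm_eq_abs, mul_assoc]
  gcongr
  refine le_of_sq_le_sq ?_ (by positivity)
  calc _ ≤ _ := norm_sum_conj_mul_sq_le _ _ _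
    _ ≤ ((1 + ν) * ‖ξ‖ ^ 2) * ((1 + ν) * ‖η‖ ^ 2) := by
      gcongr
    _ = _ := by ring

/-- Two overlapping stars: ground states of the left star and ground states of the right star
which are orthogonal to the common ground states are nearly orthogonal. -/
theorem norm_inner_leftMap_rightMap_le (hM : GramCond M b) (hb : |b| ≤ 1 / 13)
    (hT : NearIsometry T (11 / 100)) (hT' : NearIsometry T' (11 / 100))
    (ξ : EuclideanSpace ℂ (β × Fin 2 × κ')) (η : EuclideanSpace ℂ (κ × Fin 2 × β))
    (h0 : ∀ ω, ⟪bothMap M T T' ω, rightMap M T' η⟫_ℂ = 0) :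
    ‖⟪leftMap M T ξ, rightMap M T' η⟫_ℂ‖ ≤
      3 / 10 * (‖leftMap M T ξ‖ * ‖rightMap M T' η‖) := by
  -- With `ν = 11 / 100` the defects of the maps are at most `2 * ν + (1 + ν) / 13 ≤ 31 / 100`, the
  -- error of the overlap is at most `(1 + ν) / 13 ≤ 9 / 100` and the map `ξ ↦ extendLeft T _` has
  -- norm at most `2 * (1 + ν) = 222 / 100`.
  have hδ : 2 * (11 / 100 : ℝ) + |b| * (1 + 11 / 100) ≤ 31 / 100 := by linarith
  have key := norm_inner_le_of_near_isometry (leftMap M T) (rightMap M T')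
    (fun ξ : EuclideanSpace ℂ (β × Fin 2 × κ') => extendLeft T (overlapBoundary T' ξ)) (δ := 31 / 100) (c₁ := 9 / 100) (c₂ := 222 / 100)
    (by norm_num) (by norm_num) (by norm_num) (by norm_num)
    (fun v => (abs_norm_sq_leftMap_le hM hT v).trans (by gcongr))
    (fun v => (abs_norm_sq_rightMap_le hM hT' v).trans (by gcongr))
    (fun v => by
      refine le_of_sq_le_sq ?_ (by positivity)
      have h1 := norm_sq_extendLeft_le hT (overlapBoundary T' v)
      have h2 := sum_norm_sq_overlapBoundary_le (by norm_num) hT' v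
      rw [mul_pow]
      linarith)
    (fun v w => (norm_inner_leftMap_rightMap_sub_le (by norm_num) hM hT hT' v w).trans (by
      gcongr; linarith))
    ξ η (by rw [rightMap_extendLeft]; exact h0 _)
  exact key.trans (mul_le_mul_of_nonneg_right (by norm_num) (by positivity))

end DoubleStar

/-! ### The Hamiltonian of a star -/

section SumKernel

variable {ι κ : Type*} [Fintype ι] [DecidableEq ι]

theorem kerProj_posSemidef (h : Matrix ι ι ℂ) : (kerProj h).PosSemidef := by
  rw [← kerProj_mul_self]
  nth_rewrite 1 [← (kerProj_isHermitian h).eq]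
  exact posSemidef_conjTranspose_mul_self _

/-- A sum of positive semidefinite matrices is frustration free on its kernel. -/
theorem sum_mulVec_eq_zero_iff {s : Finset κ} {A : κ → Matrix ι ι ℂ}
    (hA : ∀ i ∈ s, (A i).PosSemidef) (x : ι → ℂ) :
    (∑ i ∈ s, A i) *ᵥ x = 0 ↔ ∀ i ∈ s, A i *ᵥ x = 0 := by
  constructor
  · intro h i hi
    have h1 : ∑ i ∈ s, star x ⬝ᵥ (A i *ᵥ x) = 0 := by
      rw [← dotProduct_sum, ← sum_mulVec, h, dotProduct_zero]
    rw [← (hA i hi).dotProduct_mulVec_zero_iff]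
    exact (Finset.sum_eq_zero_iff_of_nonneg fun i hi => (hA i hi).dotProduct_mulVec_nonneg x).1
      h1 i hi
  · intro h
    rw [sum_mulVec]
    exact Finset.sum_eq_zero h

end SumKernel

section StarHam

/-- The sites of a star: the centre and three legs with `n` sites each, numbered from the
centre. -/
abbrev StarSite (n : ℕ) : Type := Unit ⊕ (Fin 3 × Fin n)

/-- The centre and the sites of the leg `i`, in order. -/
def legSite {n : ℕ} (i : Fin 3) : Fin (n + 1) → StarSite n :=
  Fin.cons (Sum.inl ()) fun k => Sum.inr (i, k)

/-- Twice the spin at the sites of a star. -/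
def starSpin (n : ℕ) : StarSite n → ℕ := Sum.elim (fun _ => 3) (fun _ => 2)

theorem legSite_castSucc_ne_succ {n : ℕ} (i : Fin 3) (k : Fin n) :
    legSite i k.castSucc ≠ legSite i k.succ := by
  rw [legSite, Fin.cons_succ]
  rcases n with _ | n
  · exact k.elim0
  · refine Fin.cases ?_ (fun k => ?_) k
    · simp
    · rw [← Fin.succ_castSucc, Fin.cons_succ]
      simp [Fin.ext_iff]

variable {V : Type*} [Fintype V] [DecidableEq V]

/-- The sum of the edge projections of the star whose sites are placed by `F`. -/
noncomputable def starHam {n : ℕ} (twoS : V → ℕ) (F : StarSite n → V) :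
    Matrix (SpinConfig twoS) (SpinConfig twoS) ℂ :=
  ∑ i, ∑ k : Fin n, edgeProj twoS (F (legSite i k.castSucc)) (F (legSite i k.succ))

theorem edgeProj_posSemidef (twoS : V → ℕ) (x y : V) : (edgeProj twoS x y).PosSemidef :=
  kerProj_posSemidef _

theorem starHam_posSemidef {n : ℕ} (twoS : V → ℕ) (F : StarSite n → V) :
    (starHam twoS F).PosSemidef :=
  posSemidef_sum _ fun _ _ => posSemidef_sum _ fun _ _ => edgeProj_posSemidef _ _ _

theorem starHam_mulVec_eq_zero_iff {n : ℕ} {twoS : V → ℕ} {F : StarSite n → V}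
    {ψ : SpinConfig twoS → ℂ} : starHam twoS F *ᵥ ψ = 0 ↔ ∀ i k,
      edgeProj twoS (F (legSite i (Fin.castSucc k))) (F (legSite i (Fin.succ k))) *ᵥ ψ = 0 := by
  rw [starHam, sum_mulVec_eq_zero_iff
    fun _ _ => posSemidef_sum _ fun _ _ => edgeProj_posSemidef _ _ _]
  simp only [Finset.mem_univ, true_imp_iff]
  refine forall_congr' fun i => ?_
  rw [sum_mulVec_eq_zero_iff fun _ _ => edgeProj_posSemidef _ _ _]
  simp only [Finset.mem_univ, true_imp_iff]

theorem embed_starHam {W : Type*} [Fintype W] [DecidableEq W] {n : ℕ} {twoS : V → ℕ} {f : W → V}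
    (hf : Function.Injective f) (F : StarSite n → W) :
    embed twoS f (starHam (fun w => twoS (f w)) F) = starHam twoS (f ∘ F) := by
  simp only [starHam, embed_sum, embed_edgeProj hf, Function.comp_apply]

end StarHam

section StarKernel

variable {n : ℕ}

/-- The configuration of a star with the spin `c` at the centre and the spins `m i` on the
leg `i`. -/
def starConf (c : Fin 4) (m : Fin 3 → Fin n → Fin 3) : SpinConfig (starSpin n)
  | Sum.inl _ => c
  | Sum.inr p => m p.1 p.2

theorem exists_eq_starConf (σ : SpinConfig (starSpin n)) : ∃ c m, σ = starConf c m :=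
  ⟨σ (Sum.inl ()), fun i k => σ (Sum.inr (i, k)), by
    funext s
    rcases s with _ | ⟨i, k⟩ <;> rfl⟩

theorem update_starConf_centre (c : Fin 4) (c' : Fin (starSpin n (Sum.inl ()) + 1))
    (m : Fin 3 → Fin n → Fin 3) :
    Function.update (starConf c m) (Sum.inl ()) c' = starConf c' m := by
  funext s
  rcases s with _ | ⟨i, k⟩
  · exact Function.update_self _ _ _
  · exact Function.update_of_ne (by simp) _ _

theorem update_starConf_leg (c : Fin 4) (m : Fin 3 → Fin n → Fin 3) (i : Fin 3) (k : Fin n)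
    (a : Fin (starSpin n (Sum.inr (i, k)) + 1)) :
    Function.update (starConf c m) (Sum.inr (i, k)) a =
      starConf c (Function.update m i (Function.update (m i) k a)) := by
  funext s
  rcases s with _ | ⟨j, l⟩
  · exact Function.update_of_ne (by simp) _ _
  · by_cases h : (j, l) = (i, k)
    · obtain ⟨rfl, rfl⟩ := Prod.mk.inj h
      refine (Function.update_self _ _ _).trans ?_
      change a = Function.update m j (Function.update (m j) l a) j l
      rw [Function.update_self]
      exact (Function.update_self l (a : Fin 3) (m j)).symm
    · refine (Function.update_of_ne (by simpa using h) _ _).trans ?_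
      change m j l = Function.update m i (Function.update (m i) k a) j l
      by_cases hj : j = i
      · subst hj
        rw [Function.update_self]
        have hl : l ≠ k := fun e => h (by rw [e])
        exact (Function.update_of_ne (β := fun _ => Fin 3) hl a (m j)).symm
      · rw [Function.update_of_ne hj]

theorem starHam_mulVec_eq_zero_iff_legs {ψ : SpinConfig (starSpin (n + 1)) → ℂ} :
    starHam (starSpin (n + 1)) id *ᵥ ψ = 0 ↔ ∀ i m,
      (∀ c, ChainCond fun l => ψ (starConf c (Function.update m i l))) ∧
        CentreCond fun c l => ψ (starConf c (Function.update m i l)) := by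
  rw [starHam_mulVec_eq_zero_iff]
  simp only [id]
  have hcentre : ∀ i, edgeProj (starSpin (n + 1)) (legSite i (Fin.castSucc 0))
      (legSite i (Fin.succ 0)) *ᵥ ψ = 0 ↔
        ∀ m, CentreCond fun c l => ψ (starConf c (Function.update m i l)) := by
    intro i
    rw [edgeProj_mulVec_eq_zero (legSite_castSucc_ne_succ _ _)]
    have e : ∀ c m M, edgeSum (legSite i (Fin.castSucc 0)) (legSite i (Fin.succ 0)) ψ
        (starConf c m) M = ∑ c : Fin 4, ∑ b : Fin 3,
          (if (c : ℕ) + b = M then (binomWeight 3 c * binomWeight 2 b) •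
            ψ (starConf c (Function.update m i (Function.update (m i) 0 b))) else 0) := by
      intro c m M
      rw [edgeSum]
      refine Finset.sum_congr rfl fun c' _ => Finset.sum_congr rfl fun b _ => ?_
      split_ifs
      · rw [smul_eq_mul, mul_assoc]
        have := update_starConf_leg c' m i 0 b
        rw [← update_starConf_centre c c' m] at this
        exact congrArg (fun τ => binomWeight 3 c' * (binomWeight 2 b * ψ τ)) this
      · rfl
    constructor
    · intro h m l M
      have := h (starConf 0 (Function.update m i l)) M
      rw [e] at this
      simpa using this
    · intro h σ M
      obtain ⟨c, m, rfl⟩ := exists_eq_starConf σ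
      rw [e]
      exact h m (m i) M
  have hchain : ∀ i (k : Fin n), edgeProj (starSpin (n + 1)) (legSite i (Fin.castSucc k.succ))
      (legSite i (Fin.succ k.succ)) *ᵥ ψ = 0 ↔ ∀ c m (l : Fin (n + 1) → Fin 3) M,
        ∑ a : Fin 3, ∑ b : Fin 3, (if (a : ℕ) + b = M then (binomWeight 2 a * binomWeight 2 b) •
          ψ (starConf c (Function.update m i (Function.update (Function.update l k.castSucc a)
            k.succ b))) else 0) = 0 := by
    intro i k
    rw [edgeProj_mulVec_eq_zero (legSite_castSucc_ne_succ _ _)]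
    have e : ∀ c m M, edgeSum (legSite i (Fin.castSucc k.succ)) (legSite i (Fin.succ k.succ)) ψ
        (starConf c m) M = ∑ a : Fin 3, ∑ b : Fin 3,
          (if (a : ℕ) + b = M then (binomWeight 2 a * binomWeight 2 b) •
            ψ (starConf c (Function.update m i (Function.update (Function.update (m i) k.castSucc a)
            k.succ b))) else 0) := by
      intro c m M
      rw [edgeSum]
      refine Finset.sum_congr rfl fun a _ => Finset.sum_congr rfl fun b _ => ?_
      split_ifs
      · rw [smul_eq_mul, mul_assoc]
        have := update_starConf_leg c (Function.update m i (Function.update (m i) k.castSucc a))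
          i k.succ b
        rw [Function.update_self, Function.update_idem,
          ← update_starConf_leg c m i k.castSucc a] at this
        exact congrArg (fun τ => binomWeight 2 a * (binomWeight 2 b * ψ τ)) this
      · rfl
    constructor
    · intro h c m l M
      have := h (starConf c (Function.update m i l)) M
      rw [e] at this
      simpa using this
    · intro h σ M
      obtain ⟨c, m, rfl⟩ := exists_eq_starConf σ
      rw [e]
      exact h c m (m i) M
  refine forall_congr' fun i => ?_
  rw [Fin.forall_fin_succ, hcentre, and_comm]
  simp only [hchain, forall_and]
  refine and_congr_left fun _ => ⟨fun h m c k hk l M => ?_, fun h k c m l M => ?_⟩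
  · exact h ⟨k, by omega⟩ c m l M
  · exact h m c k (by omega) l M

/-- The kernel of the Hamiltonian of a star, read in coordinates. -/
theorem starHam_mulVec_eq_zero_iff_starCond {ψ : SpinConfig (starSpin (n + 1)) → ℂ} :
    starHam (starSpin (n + 1)) id *ᵥ ψ = 0 ↔
      StarCond fun c m₀ m₁ m₂ => ψ (starConf c ![m₀, m₁, m₂]) := by
  rw [starHam_mulVec_eq_zero_iff_legs]
  have u0 : ∀ (m : Fin 3 → Fin (n + 1) → Fin 3) l, Function.update m 0 l = ![l, m 1, m 2] :=
    fun m l => by funext i; fin_cases i <;> simp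
  have u1 : ∀ (m : Fin 3 → Fin (n + 1) → Fin 3) l, Function.update m 1 l = ![m 0, l, m 2] :=
    fun m l => by funext i; fin_cases i <;> simp
  have u2 : ∀ (m : Fin 3 → Fin (n + 1) → Fin 3) l, Function.update m 2 l = ![m 0, m 1, l] :=
    fun m l => by funext i; fin_cases i <;> simp
  constructor
  · intro h
    refine ⟨fun c m₁ m₂ => ?_, fun c m₀ m₂ => ?_, fun c m₀ m₁ => ?_, fun m₁ m₂ => ?_,
      fun m₀ m₂ => ?_, fun m₀ m₁ => ?_⟩
    · have := (h 0 ![m₁, m₁, m₂]).1 c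
      simp only [u0] at this
      exact this
    · have := (h 1 ![m₀, m₀, m₂]).1 c
      simp only [u1] at this
      exact this
    · have := (h 2 ![m₀, m₁, m₁]).1 c
      simp only [u2] at this
      exact this
    · have := (h 0 ![m₁, m₁, m₂]).2
      simp only [u0] at this
      exact this
    · have := (h 1 ![m₀, m₀, m₂]).2
      simp only [u1] at this
      exact this
    · have := (h 2 ![m₀, m₁, m₁]).2
      simp only [u2] at this
      exact this
  · intro h i m
    fin_cases i
    · simp only [Fin.zero_eta, u0]
      exact ⟨fun c => h.chain₀ c _ _, h.centre₀ _ _⟩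
    · simp only [Fin.mk_one, u1]
      exact ⟨fun c => h.chain₁ c _ _, h.centre₁ _ _⟩
    · simp only [Fin.reduceFinMk, u2]
      exact ⟨fun c => h.chain₂ c _ _, h.centre₂ _ _⟩

/-- The same for spins that equal those of the star, with a parametrization `cf` of the
configurations by the values at the sites. -/
theorem starHam_mulVec_eq_zero_iff_of_eq {twoS : StarSite (n + 1) → ℕ}
    (h : twoS = starSpin (n + 1)) (cf : Fin 4 → (Fin 3 → Fin (n + 1) → Fin 3) → SpinConfig twoS)
    (h0 : ∀ c m, (cf c m (Sum.inl ()) : ℕ) = c)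
    (h1 : ∀ c m p, (cf c m (Sum.inr p) : ℕ) = m p.1 p.2) {ψ : SpinConfig twoS → ℂ} :
    starHam twoS id *ᵥ ψ = 0 ↔ StarCond fun c m₀ m₁ m₂ => ψ (cf c ![m₀, m₁, m₂]) := by
  subst h
  have : cf = starConf := by
    funext c m s
    rcases s with _ | p
    · exact Fin.ext (h0 c m)
    · exact Fin.ext (h1 c m p)
  rw [this, starHam_mulVec_eq_zero_iff_starCond]

end StarKernel

/-! ### Two overlapping stars -/

section Reversal

/-- The sign of a spin 1/2 under the rotation that exchanges its two components. -/
def flipSign (s : Fin 2) : ℂ := ![1, -1] s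

theorem flipSign_mul_self (s : Fin 2) : flipSign s * flipSign s = 1 := by
  fin_cases s <;> simp [flipSign]

/-- The anti-automorphism of the two-by-two matrices that sends the AKLT matrices to their
negatives: it is what the reflection of a chain does to its matrix. -/
noncomputable def flipMat (A : Matrix (Fin 2) (Fin 2) ℂ) : Matrix (Fin 2) (Fin 2) ℂ :=
  of fun s t => flipSign s * flipSign t * A (Fin.rev t) (Fin.rev s)

theorem flipMat_mul (A B : Matrix (Fin 2) (Fin 2) ℂ) :
    flipMat (A * B) = flipMat B * flipMat A := by
  ext s t
  fin_cases s <;> fin_cases t <;>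
    simp [flipMat, flipSign, Matrix.mul_apply, Fin.sum_univ_two] <;> ring

theorem flipMat_one : flipMat 1 = 1 := by
  ext s t
  fin_cases s <;> fin_cases t <;> simp [flipMat, flipSign]

theorem flipMat_bondMat (a : Fin 3) : flipMat (bondMat a) = -bondMat a := by
  ext s t
  fin_cases a <;> fin_cases s <;> fin_cases t <;> simp [flipMat, flipSign, bondMat]

theorem flipMat_prod_map_bondMat (l : List (Fin 3)) :
    flipMat (l.map bondMat).prod = (-1 : ℂ) ^ l.length • (l.reverse.map bondMat).prod := by
  induction l with
  | nil => simp [flipMat_one]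
  | cons a l ih =>
    rw [List.map_cons, List.prod_cons, flipMat_mul, ih, flipMat_bondMat]
    simp [pow_succ]

/-- Reversal of a chain exchanges its ends, up to signs. -/
theorem chainMat_comp_rev {n : ℕ} (m : Fin n → Fin 3) (s t : Fin 2) :
    chainMat (m ∘ Fin.rev) s t =
      (-1) ^ n * (flipSign s * flipSign t * chainMat m (Fin.rev t) (Fin.rev s)) := by
  have h := flipMat_prod_map_bondMat (List.ofFn m)
  have e1 : (List.ofFn m).map bondMat = List.ofFn fun k => bondMat (m k) := by
    rw [List.map_ofFn]; rfl
  have e2 : (List.ofFn m).reverse.map bondMat = List.ofFn fun k => bondMat ((m ∘ Fin.rev) k) := by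
    rw [List.map_reverse, e1]
    refine List.ext_getElem (by simp) fun i h1 h2 => ?_
    simp only [List.getElem_reverse, List.getElem_ofFn, List.length_ofFn, Function.comp_apply]
    congr 2
    rw [Fin.ext_iff, Fin.val_rev]
    simp only []
    omega
  rw [e1, e2, List.length_ofFn] at h
  have h' := congrFun (congrFun h s) t
  change flipSign s * flipSign t * chainMat m (Fin.rev t) (Fin.rev s) =
    (-1) ^ n * chainMat (m ∘ Fin.rev) s t at h'
  rw [h', ← mul_assoc, ← mul_pow]
  simp

theorem NearIsometry.flip {β κ : Type*} [Fintype β] [Fintype κ] {T : Fin 2 → β → κ → ℂ} {ν : ℝ}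
    (h : NearIsometry T ν) : NearIsometry (fun t b l => flipSign t * T (Fin.rev t) b l) ν := by
  intro z
  have := h fun s b => flipSign (Fin.rev s) * z (Fin.rev s) b
  simpa [Fin.sum_univ_two, flipSign, add_comm] using this

end Reversal

section StarTensor

variable {n : ℕ}

/-- The normalization of the states `starState`. -/
noncomputable def starNorm (n : ℕ) : ℂ := ((Real.sqrt (chainNorm n) : ℝ) : ℂ) ^ 3 * ((Real.sqrt 2 : ℝ) : ℂ)

theorem sqrt_chainNorm_ne_zero (hn : 3 ≤ n) : ((Real.sqrt (chainNorm n) : ℝ) : ℂ) ≠ 0 := by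
  have := chainNorm_ge hn
  rw [Complex.ofReal_ne_zero, Real.sqrt_ne_zero (by linarith)]
  linarith

theorem starNorm_ne_zero (hn : 3 ≤ n) : starNorm n ≠ 0 :=
  mul_ne_zero (pow_ne_zero _ (sqrt_chainNorm_ne_zero hn)) sqrt_two_ne_zero

theorem chainMat_eq_chainTensor (hn : 3 ≤ n) (m : Fin n → Fin 3) (s t : Fin 2) :
    chainMat m s t = ((Real.sqrt (chainNorm n) : ℝ) : ℂ) * chainTensor n m s t := by
  rw [chainTensor, ← mul_assoc, Complex.ofReal_inv, mul_inv_cancel₀ (sqrt_chainNorm_ne_zero hn),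
    one_mul]

/-- A star as a corner with one further leg; the corner consists of the centre and the legs `1` and
`2`. -/
theorem starState_eq (hn : 3 ≤ n) (ζ : Fin 2 → Fin 2 → Fin 2 → ℂ) (c : Fin 4)
    (m₀ m₁ m₂ : Fin n → Fin 3) : starState ζ c m₀ m₁ m₂ =
      ∑ s, ∑ t, chainTensor n m₀ s t * ∑ b : Fin 2 × Fin 2,
        cornerTensor (chainTensor n) s b (c, m₁, m₂) * (starNorm n * ζ t b.1 b.2) := by
  rw [starState]
  refine Finset.sum_congr rfl fun s _ => Finset.sum_congr rfl fun t _ => ?_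
  rw [chainMat_eq_chainTensor hn, mul_right_comm, mul_comm]
  congr 1
  have h2 : ((Real.sqrt 2 : ℝ) : ℂ)⁻¹ * ((Real.sqrt 2 : ℝ) : ℂ) = 1 := inv_mul_cancel₀ sqrt_two_ne_zero
  set k : ℂ := ((Real.sqrt (chainNorm n) : ℝ) : ℂ) with hk
  have e : ∀ b : Fin 2 × Fin 2,
      cornerTensor (chainTensor n) s b (c, m₁, m₂) * (starNorm n * ζ t b.1 b.2) =
        k ^ 3 * ∑ q, ∑ r, centreTensor s q r c * (chainTensor n m₁ q b.1 * chainTensor n m₂ r b.2) *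
          ζ t b.1 b.2 := by
    intro b
    rw [cornerTensor, starNorm, ← hk, Complex.ofReal_inv]
    simp only [← Finset.sum_mul]
    linear_combination (k ^ 3 * (∑ q, ∑ r, centreTensor s q r c *
      (chainTensor n m₁ q b.1 * chainTensor n m₂ r b.2)) * ζ t b.1 b.2) * h2
  simp only [e, ← Finset.mul_sum, Fintype.sum_prod_type, chainMat_eq_chainTensor hn, ← hk]
  simp only [Fin.sum_univ_two]
  ring

theorem starState_comp_rev_eq (hn : 3 ≤ n) (ζ : Fin 2 → Fin 2 → Fin 2 → ℂ) (c : Fin 4)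
    (m₀ m₁ m₂ : Fin n → Fin 3) : starState ζ c (m₀ ∘ Fin.rev) m₁ m₂ =
      ∑ s, ∑ t, chainTensor n m₀ s t * ∑ b : Fin 2 × Fin 2,
        flipSign t * cornerTensor (chainTensor n) (Fin.rev t) b (c, m₁, m₂) *
          (starNorm n * ((-1) ^ n * flipSign s) * ζ (Fin.rev s) b.1 b.2) := by
  have e : ∀ s t, chainTensor n (m₀ ∘ Fin.rev) s t =
      (-1) ^ n * (flipSign s * flipSign t * chainTensor n m₀ (Fin.rev t) (Fin.rev s)) := by
    intro s t
    rw [chainTensor, chainTensor, chainMat_comp_rev]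
    ring
  rw [starState_eq hn]
  simp only [e, Fin.sum_univ_two, Fin.isValue, Fintype.sum_prod_type, flipSign]
  simp
  ring

end StarTensor

section DoubleStarSites

/-- The sites of two stars that share a leg: two centres and five legs. The leg `0` is shared,
the legs `1`, `2` belong to the left star and the legs `3`, `4` to the right star. -/
abbrev DoubleStarSite (n : ℕ) : Type := Bool ⊕ (Fin 5 × Fin n)

/-- Twice the spin at the sites of a double star. -/
def doubleStarSpin (n : ℕ) : DoubleStarSite n → ℕ := Sum.elim (fun _ => 3) (fun _ => 2)

/-- The sites of the left star. -/
def leftStar {n : ℕ} : StarSite n → DoubleStarSite n :=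
  Sum.map (fun _ => false) fun p => (![0, 1, 2] p.1, p.2)

/-- The sites of the right star; the shared leg is numbered from the other end. -/
def rightStar {n : ℕ} : StarSite n → DoubleStarSite n :=
  Sum.map (fun _ => true) fun p => (![0, 3, 4] p.1, if p.1 = 0 then Fin.rev p.2 else p.2)

theorem leftStar_injective {n : ℕ} : Function.Injective (leftStar (n := n)) := by
  refine Function.Injective.sumMap (fun _ _ _ => rfl) ?_
  rintro ⟨i, k⟩ ⟨j, l⟩ h
  obtain ⟨h1, h2⟩ := Prod.mk.inj h
  have : Function.Injective ![(0 : Fin 5), 1, 2] := by decide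
  obtain rfl := this h1
  rw [show k = l from h2]

theorem rightStar_injective {n : ℕ} : Function.Injective (rightStar (n := n)) := by
  refine Function.Injective.sumMap (fun _ _ _ => rfl) ?_
  rintro ⟨i, k⟩ ⟨j, l⟩ h
  obtain ⟨h1, h2⟩ := Prod.mk.inj h
  have : Function.Injective ![(0 : Fin 5), 3, 4] := by decide
  obtain rfl := this h1
  dsimp only at h2
  split_ifs at h2
  · rw [Fin.rev_injective h2]
  · rw [h2]

/-- The spins at the sites that belong to one of the two stars only: the centre and two legs. -/
abbrev CornerConf (n : ℕ) : Type := Fin 4 × (Fin n → Fin 3) × (Fin n → Fin 3)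

/-- The configurations of a double star: the left corner, the shared leg and the right corner. -/
def doubleStarConf {n : ℕ} :
    (CornerConf n × (Fin n → Fin 3) × CornerConf n) ≃ SpinConfig (doubleStarSpin n) where
  toFun p := fun
    | Sum.inl b => (if b then p.2.2.1 else p.1.1 : Fin 4)
    | Sum.inr q => (![p.2.1, p.1.2.1, p.1.2.2, p.2.2.2.1, p.2.2.2.2] q.1 q.2 : Fin 3)
  invFun σ := ((σ (Sum.inl false), fun k => σ (Sum.inr (1, k)), fun k => σ (Sum.inr (2, k))),
    fun k => σ (Sum.inr (0, k)),
    (σ (Sum.inl true), fun k => σ (Sum.inr (3, k)), fun k => σ (Sum.inr (4, k))))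
  left_inv p := rfl
  right_inv σ := by
    funext s
    rcases s with b | ⟨j, k⟩
    · cases b <;> rfl
    · fin_cases j <;> rfl

variable {n : ℕ}

theorem leftStar_mulVec_eq_zero_iff {ψ : SpinConfig (doubleStarSpin (n + 1)) → ℂ} :
    starHam (doubleStarSpin (n + 1)) leftStar *ᵥ ψ = 0 ↔
      ∀ r, StarCond fun c m₀ m₁ m₂ => ψ (doubleStarConf ((c, m₁, m₂), m₀, r)) := by
  rw [show starHam (doubleStarSpin (n + 1)) leftStar = starHam _ (leftStar ∘ id) from rfl,
    ← embed_starHam leftStar_injective, embed_mulVec_eq_zero leftStar_injective]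
  let cf : Fin 4 → (Fin 3 → Fin (n + 1) → Fin 3) →
      SpinConfig fun s => doubleStarSpin (n + 1) (leftStar s) := fun c m s =>
    match s with
    | Sum.inl _ => c
    | Sum.inr p => m p.1 p.2
  have h := fun ψ => starHam_mulVec_eq_zero_iff_of_eq
    (twoS := fun s => doubleStarSpin (n + 1) (leftStar s))
    (funext fun s => by rcases s with _ | _ <;> rfl) cf (fun _ _ => rfl) (fun _ _ _ => rfl) (ψ := ψ)
  simp only [h]
  have e : ∀ p c m₀ m₁ m₂, glue leftStar (doubleStarConf p) (cf c ![m₀, m₁, m₂]) =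
      doubleStarConf ((c, m₁, m₂), m₀, p.2.2) := by
    intro p c m₀ m₁ m₂
    have := eq_glue leftStar_injective (σ := doubleStarConf p)
      (τ := doubleStarConf ((c, m₁, m₂), m₀, p.2.2)) fun w hw => by
        rcases w with b | ⟨j, k⟩
        · cases b
          · exact absurd ⟨Sum.inl (), rfl⟩ hw
          · rfl
        · fin_cases j
          · exact absurd ⟨Sum.inr (0, k), rfl⟩ hw
          · exact absurd ⟨Sum.inr (1, k), rfl⟩ hw
          · exact absurd ⟨Sum.inr (2, k), rfl⟩ hw
          · rfl
          · rfl
    rw [← this]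
    congr 1
    funext s
    rcases s with _ | ⟨j, k⟩
    · rfl
    · fin_cases j <;> rfl
  constructor
  · intro h r
    have := h (doubleStarConf ((0, fun _ => 0, fun _ => 0), fun _ => 0, r))
    simpa only [e] using this
  · intro h σ
    obtain ⟨p, rfl⟩ := doubleStarConf.surjective σ
    simpa only [e] using h p.2.2

theorem rightStar_mulVec_eq_zero_iff {ψ : SpinConfig (doubleStarSpin (n + 1)) → ℂ} :
    starHam (doubleStarSpin (n + 1)) rightStar *ᵥ ψ = 0 ↔
      ∀ l, StarCond fun c m₀ m₁ m₂ => ψ (doubleStarConf (l, m₀ ∘ Fin.rev, (c, m₁, m₂))) := by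
  rw [show starHam (doubleStarSpin (n + 1)) rightStar = starHam _ (rightStar ∘ id) from rfl,
    ← embed_starHam rightStar_injective, embed_mulVec_eq_zero rightStar_injective]
  let cf : Fin 4 → (Fin 3 → Fin (n + 1) → Fin 3) →
      SpinConfig fun s => doubleStarSpin (n + 1) (rightStar s) := fun c m s =>
    match s with
    | Sum.inl _ => c
    | Sum.inr p => m p.1 p.2
  have h := fun ψ => starHam_mulVec_eq_zero_iff_of_eq
    (twoS := fun s => doubleStarSpin (n + 1) (rightStar s))
    (funext fun s => by rcases s with _ | _ <;> rfl) cf (fun _ _ => rfl) (fun _ _ _ => rfl) (ψ := ψ)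
  simp only [h]
  have e : ∀ p c m₀ m₁ m₂, glue rightStar (doubleStarConf p) (cf c ![m₀, m₁, m₂]) =
      doubleStarConf (p.1, m₀ ∘ Fin.rev, (c, m₁, m₂)) := by
    intro p c m₀ m₁ m₂
    have := eq_glue rightStar_injective (σ := doubleStarConf p)
      (τ := doubleStarConf (p.1, m₀ ∘ Fin.rev, (c, m₁, m₂))) fun w hw => by
        rcases w with b | ⟨j, k⟩
        · cases b
          · rfl
          · exact absurd ⟨Sum.inl (), rfl⟩ hw
        · fin_cases j
          · exact absurd ⟨Sum.inr (0, Fin.rev k), by simp [rightStar]⟩ hw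
          · rfl
          · rfl
          · exact absurd ⟨Sum.inr (1, k), rfl⟩ hw
          · exact absurd ⟨Sum.inr (2, k), rfl⟩ hw
    rw [← this]
    congr 1
    funext s
    rcases s with _ | ⟨j, k⟩
    · rfl
    · fin_cases j
      · change m₀ k = m₀ (Fin.rev (Fin.rev k))
        rw [Fin.rev_rev]
      · rfl
      · rfl
  constructor
  · intro h l
    have := h (doubleStarConf (l, fun _ => 0, (0, fun _ => 0, fun _ => 0)))
    simpa only [e] using this
  · intro h σ
    obtain ⟨p, rfl⟩ := doubleStarConf.surjective σ
    simpa only [e] using h p.1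

end DoubleStarSites

section DoubleStarGap

variable {n : ℕ}

/-- The tensor of the right corner of a double star, in the coordinates of the shared leg. -/
noncomputable def rightCornerTensor (n : ℕ) (t : Fin 2) (b : Fin 2 × Fin 2) (r : CornerConf n) : ℂ :=
  flipSign t * cornerTensor (chainTensor n) (Fin.rev t) b r

theorem leftStar_mulVec_eq_zero_iff_exists {ψ : SpinConfig (doubleStarSpin (n + 3)) → ℂ} :
    starHam (doubleStarSpin (n + 3)) leftStar *ᵥ ψ = 0 ↔
      ∃ ξ : EuclideanSpace ℂ ((Fin 2 × Fin 2) × Fin 2 × CornerConf (n + 3)), ∀ p,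
        ψ (doubleStarConf p) =
          leftMap (chainTensor (n + 3)) (cornerTensor (chainTensor (n + 3))) ξ p := by
  rw [leftStar_mulVec_eq_zero_iff (n := n + 2)]
  constructor
  · intro h
    choose ζ hζ using fun r => (h r).exists_eq_starState
    refine ⟨WithLp.toLp 2 fun i => starNorm (n + 3) * ζ i.2.2 i.2.1 i.1.1 i.1.2, ?_⟩
    rintro ⟨⟨c, m₁, m₂⟩, m₀, r⟩
    exact (hζ r c m₀ m₁ m₂).trans (starState_eq (by omega) _ _ _ _ _)
  · rintro ⟨ξ, hξ⟩ r
    have e : (fun c m₀ m₁ m₂ => ψ (doubleStarConf ((c, m₁, m₂), m₀, r))) =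
        starState fun t u v => (starNorm (n + 3))⁻¹ * ξ ((u, v), t, r) := by
      funext c m₀ m₁ m₂
      rw [hξ, starState_eq (by omega)]
      simp only [mul_inv_cancel_left₀ (starNorm_ne_zero (n := n + 3) (by omega))]
      rfl
    rw [e]
    exact starCond_starState _

theorem rightStar_mulVec_eq_zero_iff_exists {ψ : SpinConfig (doubleStarSpin (n + 3)) → ℂ} :
    starHam (doubleStarSpin (n + 3)) rightStar *ᵥ ψ = 0 ↔
      ∃ η : EuclideanSpace ℂ (CornerConf (n + 3) × Fin 2 × (Fin 2 × Fin 2)), ∀ p,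
        ψ (doubleStarConf p) =
          rightMap (chainTensor (n + 3)) (rightCornerTensor (n + 3)) η p := by
  rw [rightStar_mulVec_eq_zero_iff (n := n + 2)]
  constructor
  · intro h
    choose ζ hζ using fun l => (h l).exists_eq_starState
    refine ⟨WithLp.toLp 2 fun i => starNorm (n + 3) * ((-1) ^ (n + 3) * flipSign i.2.1) *
      ζ i.1 (Fin.rev i.2.1) i.2.2.1 i.2.2.2, ?_⟩
    rintro ⟨l, m₀, c, m₁, m₂⟩
    have := hζ l c (m₀ ∘ Fin.rev) m₁ m₂
    rw [starState_comp_rev_eq (by omega), Function.comp_assoc, Fin.rev_involutive.comp_self] at this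
    exact this
  · rintro ⟨η, hη⟩ l
    have e : (fun c m₀ m₁ m₂ => ψ (doubleStarConf (l, m₀ ∘ Fin.rev, (c, m₁, m₂)))) =
        starState fun t u v => (starNorm (n + 3))⁻¹ * ((-1) ^ (n + 3) * flipSign (Fin.rev t)) *
          η (l, Fin.rev t, (u, v)) := by
      funext c m₀ m₁ m₂
      have := starState_comp_rev_eq (n := n + 3) (by omega)
        (fun t u v => (starNorm (n + 3))⁻¹ * ((-1) ^ (n + 3) * flipSign (Fin.rev t)) *
          η (l, Fin.rev t, (u, v))) c (m₀ ∘ Fin.rev) m₁ m₂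
      rw [Function.comp_assoc, Fin.rev_involutive.comp_self] at this
      rw [hη]
      refine Eq.trans ?_ this.symm
      have e1 : ∀ (s : Fin 2) (x : ℂ), starNorm (n + 3) * ((-1) ^ (n + 3) * flipSign s) *
          ((starNorm (n + 3))⁻¹ * ((-1) ^ (n + 3) * flipSign s) * x) = x := by
        intro s x
        have h1 := mul_inv_cancel₀ (starNorm_ne_zero (n := n + 3) (by omega))
        have h2 : ((-1 : ℂ) ^ (n + 3)) * (-1) ^ (n + 3) = 1 := by rw [← mul_pow]; simp
        linear_combination ((-1) ^ (n + 3) * (-1) ^ (n + 3) * (flipSign s * flipSign s) * x) * h1 +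
          (flipSign s * flipSign s * x) * h2 + x * flipSign_mul_self s
      simp only [Fin.rev_rev, e1]
      rfl
    rw [e]
    exact starCond_starState _

/-- The ground spaces of two stars that share a leg are nearly orthogonal outside their
intersection. -/
theorem anticommutator_doubleStar :
    let P := kerProjCompl (starHam (doubleStarSpin (n + 3)) leftStar)
    let Q := kerProjCompl (starHam (doubleStarSpin (n + 3)) rightStar)
    (P * Q + Q * P + ((3 / 10 : ℝ) : ℂ) • (P + Q)).PosSemidef := by
  intro P Q
  refine anticommutator_kerProjCompl _ _ (by norm_num) fun x y hx hy hxy => ?_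
  let U : EuclideanSpace ℂ (SpinConfig (doubleStarSpin (n + 3))) ≃ₗᵢ[ℂ]
      EuclideanSpace ℂ (CornerConf (n + 3) × (Fin (n + 3) → Fin 3) × CornerConf (n + 3)) :=
    LinearIsometryEquiv.piLpCongrLeft 2 ℂ ℂ doubleStarConf.symm
  have hU : ∀ z p, U z p = z (doubleStarConf p) := fun z p => rfl
  obtain ⟨ξ, hξ⟩ := leftStar_mulVec_eq_zero_iff_exists.1 hx
  obtain ⟨η, hη⟩ := rightStar_mulVec_eq_zero_iff_exists.1 hy
  have hx' : U x = leftMap (chainTensor (n + 3)) (cornerTensor (chainTensor (n + 3))) ξ := by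
    ext p; rw [hU, hξ]
  have hy' : U y = rightMap (chainTensor (n + 3)) (rightCornerTensor (n + 3)) η := by
    ext p; rw [hU, hη]
  have hM := gramCond_chainTensor (n := n + 3) (by omega)
  have hb := abs_chainRatio_le (n := n + 3) (by omega)
  have hT := nearIsometry_cornerTensor hM hb
  rw [← U.inner_map_map, ← U.norm_map x, ← U.norm_map y, hx', hy']
  refine norm_inner_leftMap_rightMap_le hM hb hT hT.flip ξ η fun ω => ?_
  have h0 := hxy (U.symm (bothMap (chainTensor (n + 3)) (cornerTensor (chainTensor (n + 3)))
    (rightCornerTensor (n + 3)) ω)) ?_ ?_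
  · rw [← U.inner_map_map, U.apply_symm_apply, hy'] at h0
    exact h0
  · rw [leftStar_mulVec_eq_zero_iff_exists]
    refine ⟨extendRight (rightCornerTensor (n + 3)) ω, fun p => ?_⟩
    rw [leftMap_extendRight, ← hU, U.apply_symm_apply]
  · rw [rightStar_mulVec_eq_zero_iff_exists]
    refine ⟨extendLeft (cornerTensor (chainTensor (n + 3))) ω, fun p => ?_⟩
    rw [rightMap_extendLeft, ← hU, U.apply_symm_apply]

/-- The bound for two stars that share a leg, at any place of a larger system. -/
theorem anticommutator_starHam {V : Type*} [Fintype V] [DecidableEq V] {twoS : V → ℕ}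
    {f : DoubleStarSite (n + 3) → V} (hf : Function.Injective f)
    (hspin : (fun s => twoS (f s)) = doubleStarSpin (n + 3)) :
    let P := kerProjCompl (starHam twoS (f ∘ leftStar))
    let Q := kerProjCompl (starHam twoS (f ∘ rightStar))
    (P * Q + Q * P + ((3 / 10 : ℝ) : ℂ) • (P + Q)).PosSemidef := by
  intro P Q
  have key : ∀ twoS' : DoubleStarSite (n + 3) → ℕ, twoS' = doubleStarSpin (n + 3) →
      let P := kerProjCompl (starHam twoS' leftStar)
      let Q := kerProjCompl (starHam twoS' rightStar)
      (P * Q + Q * P + ((3 / 10 : ℝ) : ℂ) • (P + Q)).PosSemidef := by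
    rintro _ rfl
    exact anticommutator_doubleStar
  have := embed_posSemidef hf (key _ hspin)
  simpa only [embed_add, embed_mul hf, embed_smul, embed_kerProjCompl hf, embed_starHam hf]
    using this

end DoubleStarGap

/-! ### Valence bond states -/

section ValenceBond

open MvPolynomial

variable {V J : Type*} [Fintype V] [DecidableEq V] [Fintype J]

/-- The product of the valence bonds `X (b j) - X (a j)`. A state of spins `twoS v / 2` is a
polynomial of degree at most `twoS v` in the variable `X v`, and a difference `X y - X x`
stands for a singlet of one spin 1/2 at `x` and one at `y`. -/
noncomputable def bondPolynomial (a b : J → V) : MvPolynomial V ℂ :=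
  ∏ j, (X (b j) - X (a j))

theorem bondPolynomial_ne_zero {a b : J → V} (hab : ∀ j, a j ≠ b j) : bondPolynomial a b ≠ 0 := by
  refine Finset.prod_ne_zero_iff.2 fun j _ => ?_
  rw [sub_ne_zero]
  exact fun h => hab j (X_injective h).symm

theorem degreeOf_bondPolynomial_le (a b : J → V) (v : V) : degreeOf v (bondPolynomial a b) ≤
    ∑ j, ((if a j = v then 1 else 0) + if b j = v then 1 else 0) := by
  refine (degreeOf_prod_le _ _ _).trans (Finset.sum_le_sum fun j _ => ?_)
  refine (degreeOf_sub_le _ _ _).trans ?_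
  rw [degreeOf_X, degreeOf_X]
  simp only [eq_comm (a := v)]
  omega

/-- The coefficients of a multiple of `X y - X x` cancel when the variables `x` and `y` are
identified. -/
theorem sum_antidiagonal_coeff_eq_zero {x y : V} (hxy : x ≠ y) (r : MvPolynomial V ℂ)
    {s : V →₀ ℕ} (hx : s x = 0) (hy : s y = 0) (M : ℕ) :
    ∑ p ∈ Finset.HasAntidiagonal.antidiagonal M,
      coeff (s + Finsupp.single x p.1 + Finsupp.single y p.2) ((X y - X x) * r) = 0 := by
  simp only [sub_mul, coeff_sub, Finset.sum_sub_distrib]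
  rcases M with _ | M
  · simp [coeff_X_mul', hx, hy]
  · rw [Finset.Nat.sum_antidiagonal_succ', Finset.Nat.sum_antidiagonal_succ (n := M)]
    have e1 : coeff (s + Finsupp.single x (M + 1) + Finsupp.single y 0) (X y * r) = 0 := by
      rw [coeff_X_mul', if_neg]
      simp [hy, hxy]
    have e2 : coeff (s + Finsupp.single x 0 + Finsupp.single y (M + 1)) (X x * r) = 0 := by
      rw [coeff_X_mul', if_neg]
      simp [hx, hxy.symm]
    have e3 : ∀ k l, coeff (s + Finsupp.single x k + Finsupp.single y (l + 1)) (X y * r) =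
        coeff (s + Finsupp.single x k + Finsupp.single y l) r := by
      intro k l
      rw [← coeff_X_mul _ y r, Finsupp.single_add]
      congr 1
      abel
    have e4 : ∀ k l, coeff (s + Finsupp.single x (k + 1) + Finsupp.single y l) (X x * r) =
        coeff (s + Finsupp.single x k + Finsupp.single y l) r := by
      intro k l
      rw [← coeff_X_mul _ x r, Finsupp.single_add]
      congr 1
      abel
    simp only [e1, e2, e3, e4, sub_self]

variable {twoS : V → ℕ}

/-- The exponents of the monomial that stands for a configuration. -/
noncomputable def confExponent (σ : SpinConfig twoS) : V →₀ ℕ :=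
  Finsupp.equivFunOnFinite.symm fun v => (σ v : ℕ)

/-- The state that a polynomial stands for: its coefficients, divided by the weights of the
components of the spins. -/
noncomputable def polynomialState (p : MvPolynomial V ℂ) (σ : SpinConfig twoS) : ℂ :=
  coeff (confExponent σ) p * ∏ v, (binomWeight (twoS v) (σ v))⁻¹

theorem polynomialState_ne_zero {p : MvPolynomial V ℂ} (hp : p ≠ 0)
    (hdeg : ∀ v, degreeOf v p ≤ twoS v) : polynomialState (twoS := twoS) p ≠ 0 := by
  obtain ⟨d, hd⟩ := ne_zero_iff.1 hp
  have hle : ∀ v, d v < twoS v + 1 := fun v =>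
    Nat.lt_succ_of_le ((monomial_le_degreeOf v (mem_support_iff.2 hd)).trans (hdeg v))
  intro h
  have h1 := congrFun h fun v => ⟨d v, hle v⟩
  have h2 : confExponent (twoS := twoS) (fun v => ⟨d v, hle v⟩) = d := by
    ext v; rfl
  rw [polynomialState, h2] at h1
  refine mul_ne_zero hd (Finset.prod_ne_zero_iff.2 fun v _ => inv_ne_zero ?_) h1
  exact binomWeight_ne_zero (Nat.le_of_lt_succ (hle v))

theorem sum_fin_ite_eq_sum_antidiagonal (d e M : ℕ) (c : ℕ → ℕ → ℂ) (hd : ∀ k l, d < k → c k l = 0)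
    (he : ∀ k l, e < l → c k l = 0) :
    ∑ k : Fin (d + 1), ∑ l : Fin (e + 1), (if (k : ℕ) + l = M then c k l else 0) =
      ∑ p ∈ Finset.HasAntidiagonal.antidiagonal M, c p.1 p.2 := by
  rw [Fin.sum_univ_eq_sum_range
    (fun k => ∑ l : Fin (e + 1), (if k + (l : ℕ) = M then c k l else 0)) (d + 1)]
  refine (Finset.sum_congr rfl fun k _ => Fin.sum_univ_eq_sum_range
    (fun l => if k + l = M then c k l else 0) (e + 1)).trans ?_
  rw [← Finset.sum_product', ← Finset.sum_filter]
  refine Finset.sum_subset (fun p hp => ?_) fun p hp hp' => ?_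
  · simp only [Finset.mem_filter] at hp
    simpa using hp.2
  · rw [Finset.HasAntidiagonal.mem_antidiagonal] at hp
    simp only [Finset.mem_filter, Finset.mem_product, Finset.mem_range, hp, and_true,
      not_and_or, not_lt] at hp'
    rcases hp' with h | h
    · exact hd _ _ (by omega)
    · exact he _ _ (by omega)

/-- A state divisible by the bond `X y - X x` has no component of largest total spin at `x` and `y`. -/
theorem edgeSum_polynomialState_eq_zero {x y : V} (hxy : x ≠ y) (r : MvPolynomial V ℂ)
    (hdeg : ∀ v, degreeOf v ((X y - X x) * r) ≤ twoS v) (σ : SpinConfig twoS) (M : ℕ) :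
    edgeSum x y (polynomialState ((X y - X x) * r)) σ M = 0 := by
  set p := (X y - X x) * r with hp
  set s : V →₀ ℕ := ((confExponent σ).erase x).erase y with hs
  have hsx : s x = 0 := by simp [hs, Finsupp.erase, hxy]
  have hsy : s y = 0 := by simp [hs]
  have hs' : ∀ v, v ≠ x → v ≠ y → s v = σ v := by
    intro v hx hy
    rw [hs, Finsupp.erase_ne hy, Finsupp.erase_ne hx]
    rfl
  set c : ℂ := ∏ v ∈ (Finset.univ.erase x).erase y, (binomWeight (twoS v) (σ v))⁻¹ with hc
  have e : ∀ (k : Fin (twoS x + 1)) (l : Fin (twoS y + 1)), binomWeight (twoS x) k *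
      (binomWeight (twoS y) l *
        polynomialState p (Function.update (Function.update σ x k) y l)) =
      c * coeff (s + Finsupp.single x (k : ℕ) + Finsupp.single y (l : ℕ)) p := by
    intro k l
    set τ := Function.update (Function.update σ x k) y l with hτ
    have hτx : τ x = k := by rw [hτ, Function.update_of_ne hxy, Function.update_self]
    have hτy : τ y = l := by rw [hτ, Function.update_self]
    have hτv : ∀ v, v ≠ x → v ≠ y → τ v = σ v := fun v hx hy => by
      rw [hτ, Function.update_of_ne hy, Function.update_of_ne hx]
    have e1 : confExponent τ = s + Finsupp.single x (k : ℕ) + Finsupp.single y (l : ℕ) := by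
      ext v
      change (τ v : ℕ) = s v + Finsupp.single x (k : ℕ) v + Finsupp.single y (l : ℕ) v
      by_cases hx : v = x
      · subst hx
        rw [hτx, hsx]
        simp [hxy.symm]
      · by_cases hy : v = y
        · subst hy
          rw [hτy, hsy]
          simp [hxy]
        · rw [hτv v hx hy, hs' v hx hy]
          simp [Ne.symm hx, Ne.symm hy]
    have e2 : ∏ v, (binomWeight (twoS v) (τ v))⁻¹ =
        (binomWeight (twoS x) k)⁻¹ * ((binomWeight (twoS y) l)⁻¹ * c) := by
      rw [← Finset.mul_prod_erase _ _ (Finset.mem_univ x),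
        ← Finset.mul_prod_erase _ _ (Finset.mem_erase.2 ⟨hxy.symm, Finset.mem_univ y⟩), hτx, hτy, hc]
      congr 2
      refine Finset.prod_congr rfl fun v hv => ?_
      simp only [Finset.mem_erase] at hv
      rw [hτv v hv.2.1 hv.1]
    rw [polynomialState, e1, e2]
    have hk := binomWeight_ne_zero (Nat.le_of_lt_succ k.2)
    have hl := binomWeight_ne_zero (Nat.le_of_lt_succ l.2)
    field_simp
  rw [edgeSum]
  simp only [e]
  have hcoeff : ∀ v (t : V →₀ ℕ), twoS v < t v → coeff t p = 0 := by
    intro v t ht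
    by_contra h
    exact absurd ((monomial_le_degreeOf v (mem_support_iff.2 h)).trans (hdeg v)) (by omega)
  rw [sum_fin_ite_eq_sum_antidiagonal (twoS x) (twoS y) M
    (fun k l => c * coeff (s + Finsupp.single x k + Finsupp.single y l) p)
    (fun k l hk => by rw [hcoeff x _ (by simpa [hsx, hxy.symm] using hk), mul_zero])
    (fun k l hl => by rw [hcoeff y _ (by simpa [hsy, hxy] using hl), mul_zero]),
    ← Finset.mul_sum, hp, sum_antidiagonal_coeff_eq_zero hxy r hsx hsy, mul_zero]

/-- The valence bond state is a common ground state of all edge projections. -/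
theorem exists_ne_zero_edgeProj_mulVec_eq_zero {a b : J → V} (hab : ∀ j, a j ≠ b j)
    (hdeg : ∀ v, ∑ j, ((if a j = v then 1 else 0) + if b j = v then 1 else 0) ≤ twoS v) :
    ∃ ψ : SpinConfig twoS → ℂ, ψ ≠ 0 ∧ ∀ j, edgeProj twoS (a j) (b j) *ᵥ ψ = 0 := by
  classical
  have hdeg' : ∀ v, degreeOf v (bondPolynomial a b) ≤ twoS v := fun v =>
    (degreeOf_bondPolynomial_le a b v).trans (hdeg v)
  refine ⟨polynomialState (bondPolynomial a b),
    polynomialState_ne_zero (bondPolynomial_ne_zero hab) hdeg', fun j => ?_⟩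
  rw [edgeProj_mulVec_eq_zero (hab j)]
  intro σ M
  have e : bondPolynomial a b =
      (X (b j) - X (a j)) * ∏ i ∈ Finset.univ.erase j, (X (b i) - X (a i)) :=
    (Finset.mul_prod_erase _ _ (Finset.mem_univ j)).symm
  rw [e] at hdeg' ⊢
  exact edgeSum_polynomialState_eq_zero (hab j) _ hdeg' σ M

/-- The state with the largest third component at all sites has the largest total spin at
each edge. -/
theorem edgeProj_ne_zero {x y : V} (hxy : x ≠ y) : edgeProj twoS x y ≠ 0 := by
  intro h
  have h1 := (edgeProj_mulVec_eq_zero (twoS := twoS) hxy (fun _ => 1)).1 (by rw [h, zero_mulVec])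
    (fun _ => 0) 0
  rw [edgeSum, Fin.sum_univ_succ, Fin.sum_univ_succ] at h1
  simp [binomWeight] at h1

end ValenceBond

/-! ### From local gaps to the spectral gap -/

section SpectralGap

variable {ι W : Type*} [Fintype ι] [DecidableEq ι] [Fintype W] [DecidableEq W]

theorem posSemidef_smul_of_nonneg {A : Matrix ι ι ℂ} (hA : A.PosSemidef) {c : ℝ} (hc : 0 ≤ c) :
    ((c : ℂ) • A).PosSemidef :=
  hA.smul (by exact_mod_cast hc)

/-- Knabe's argument: if the negative part of the anticommutator of two of the projections is
small for neighbours, and zero for all other pairs, then the square of the sum of the projections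
is large. -/
theorem sq_sub_smul_posSemidef (P : W → Matrix ι ι ℂ) (hPP : ∀ w, P w * P w = P w)
    (hP : ∀ w, (P w).PosSemidef) (N : W → W → Prop) [DecidableRel N] (hirr : ∀ w, ¬ N w w)
    (hsymm : ∀ w w', N w w' → N w' w) (d : ℕ)
    (hdeg : ∀ w, (Finset.univ.filter (N w)).card ≤ d) {ε : ℝ} (hε : 0 ≤ ε)
    (h : ∀ w w', w ≠ w' →
      (P w * P w' + P w' * P w + ((if N w w' then ε else 0 : ℝ) : ℂ) • (P w + P w')).PosSemidef) :
    ((∑ w, P w) * (∑ w, P w) - ((1 - d * ε : ℝ) : ℂ) • ∑ w, P w).PosSemidef := by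
  set c : W → W → ℂ := fun w w' => ((if N w w' then ε else 0 : ℝ) : ℂ) with hc
  set D : W → ℝ := fun w => (Finset.univ.filter (N w)).card with hD
  have hcD : ∀ w, ∑ w', c w w' = ((D w * ε : ℝ) : ℂ) := by
    intro w
    rw [hc, hD]
    push_cast
    simp only [apply_ite Complex.ofReal, Complex.ofReal_zero]
    rw [← Finset.sum_filter, Finset.sum_const, nsmul_eq_mul]
  have hcs : ∀ w w', c w w' = c w' w := fun w w' => by
    simp only [hc, show N w w' ↔ N w' w from ⟨hsymm _ _, hsymm _ _⟩]
  set R : W → W → Matrix ι ι ℂ := fun w w' =>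
    (P w * P w' + P w' * P w + c w w' • (P w + P w')) - if w = w' then (2 : ℂ) • P w else 0 with hR
  have hRpos : ∀ w w', (R w w').PosSemidef := by
    intro w w'
    by_cases hw : w = w'
    · subst hw
      have : R w w = 0 := by
        simp only [hR, hc, if_neg (hirr w), if_true, hPP, two_smul]
        simp
      rw [this]
      exact PosSemidef.zero
    · simp only [hR, if_neg hw, sub_zero]
      exact h w w' hw
  have hsum : ∑ w, ∑ w', R w w' = (2 : ℂ) • ((∑ w, P w) * (∑ w, P w)) - (2 : ℂ) • ∑ w, P w +
      (2 : ℂ) • ∑ w, ((D w * ε : ℝ) : ℂ) • P w := by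
    have e1 : ∑ w, ∑ w', P w * P w' = (∑ w, P w) * (∑ w, P w) := by
      rw [Finset.sum_mul]
      exact Finset.sum_congr rfl fun w _ => (Finset.mul_sum _ _ _).symm
    have e2 : ∑ w, ∑ w', P w' * P w = (∑ w, P w) * (∑ w, P w) := by
      rw [Finset.sum_comm, e1]
    have e3 : ∑ w, ∑ w', c w w' • P w = ∑ w, ((D w * ε : ℝ) : ℂ) • P w :=
      Finset.sum_congr rfl fun w _ => by rw [← Finset.sum_smul, hcD]
    have e4 : ∑ w, ∑ w', c w w' • P w' = ∑ w, ((D w * ε : ℝ) : ℂ) • P w := by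
      rw [Finset.sum_comm, ← e3]
      exact Finset.sum_congr rfl fun w _ => Finset.sum_congr rfl fun w' _ => by rw [hcs]
    have e5 : ∑ w, ∑ w', (if w = w' then (2 : ℂ) • P w else 0) = (2 : ℂ) • ∑ w, P w := by
      rw [Finset.smul_sum]
      exact Finset.sum_congr rfl fun w _ => by simp
    simp only [hR, smul_add, Finset.sum_sub_distrib, Finset.sum_add_distrib, e1, e2, e3, e4, e5]
    module
  have hfin : (∑ w, P w) * (∑ w, P w) - ((1 - d * ε : ℝ) : ℂ) • ∑ w, P w =
      ((1 / 2 : ℝ) : ℂ) • ∑ w, ∑ w', R w w' + ∑ w, (((d - D w) * ε : ℝ) : ℂ) • P w := by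
    have e1 : ∑ w, (((d - D w) * ε : ℝ) : ℂ) • P w =
        ((d * ε : ℝ) : ℂ) • ∑ w, P w - ∑ w, ((D w * ε : ℝ) : ℂ) • P w := by
      rw [Finset.smul_sum, ← Finset.sum_sub_distrib]
      exact Finset.sum_congr rfl fun w _ => by
        rw [← sub_smul]
        push_cast
        ring_nf
    rw [hsum, e1]
    push_cast
    module
  rw [hfin]
  refine PosSemidef.add (posSemidef_smul_of_nonneg (posSemidef_sum _ fun w _ =>
    posSemidef_sum _ fun w' _ => hRpos w w') (by norm_num)) (posSemidef_sum _ fun w _ =>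
    posSemidef_smul_of_nonneg (hP w) (mul_nonneg ?_ hε))
  rw [sub_nonneg]
  exact Nat.cast_le.2 (hdeg w)

theorem spectrum_toEuclideanCLM (H : Matrix ι ι ℂ) :
    spectrum ℝ (toEuclideanCLM (n := ι) (𝕜 := ℂ) H) = spectrum ℝ H :=
  AlgEquiv.spectrum_eq
    ((toEuclideanCLM (n := ι) (𝕜 := ℂ)).toAlgEquiv.restrictScalars ℝ) H

/-- A positive semidefinite `H ≠ 0` with a kernel whose nonzero eigenvalues are at least `g` has
a spectral gap of at least `g`. -/
theorem le_spectralGap {H : Matrix ι ι ℂ} (hH : H.PosSemidef) {g : ℝ}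
    (hgap : (H - (g : ℂ) • kerProjCompl H).PosSemidef) {ψ : ι → ℂ} (hψ : ψ ≠ 0)
    (hHψ : H *ᵥ ψ = 0) (hH0 : H ≠ 0) :
    g ≤ spectralGap (toEuclideanCLM (n := ι) (𝕜 := ℂ) H) := by
  have hspec : spectrum ℝ (toEuclideanCLM (n := ι) (𝕜 := ℂ) H) = Set.range hH.1.eigenvalues := by
    rw [spectrum_toEuclideanCLM, hH.1.spectrum_real_eq_range_eigenvalues]
  have h0 : (0 : ℝ) ∈ Set.range hH.1.eigenvalues := by
    rw [← hH.1.spectrum_real_eq_range_eigenvalues, spectrum.zero_mem_iff,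
      isUnit_iff_isUnit_det, isUnit_iff_ne_zero, not_not]
    exact exists_mulVec_eq_zero_iff.1 ⟨ψ, hψ, hHψ⟩
  have hground : groundEnergy (toEuclideanCLM (n := ι) (𝕜 := ℂ) H) = 0 := by
    rw [groundEnergy, hspec]
    refine IsLeast.csInf_eq ⟨h0, ?_⟩
    rintro _ ⟨i, rfl⟩
    exact hH.eigenvalues_nonneg i
  have hle : ∀ i, hH.1.eigenvalues i ≠ 0 → g ≤ hH.1.eigenvalues i := by
    intro i hi
    obtain ⟨v, hvv, hv⟩ := exists_unit_eigenvector hH.1 i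
    have h1 : kerProj H *ᵥ v = 0 := by
      have h2 : kerProj H * H = 0 := by
        have := congrArg conjTranspose (mul_kerProj H)
        rwa [conjTranspose_mul, hH.1.eq, (kerProj_isHermitian H).eq, conjTranspose_zero] at this
      have h3 : (hH.1.eigenvalues i : ℂ) • (kerProj H *ᵥ v) = 0 := by
        rw [← mulVec_smul, ← hv, mulVec_mulVec, h2, zero_mulVec]
      exact (smul_eq_zero.1 h3).resolve_left (by exact_mod_cast hi)
    have := hgap.dotProduct_mulVec_nonneg v
    rw [sub_mulVec, smul_mulVec, kerProjCompl, sub_mulVec, one_mulVec, h1, sub_zero, hv,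
      ← sub_smul, dotProduct_smul, hvv, smul_eq_mul, mul_one, sub_nonneg] at this
    exact_mod_cast this
  rw [spectralGap, hground, hspec]
  refine le_csInf ?_ ?_
  · have : ∃ i, hH.1.eigenvalues i ≠ 0 := by
      by_contra hcon
      push Not at hcon
      exact hH0 (hH.1.eigenvalues_eq_zero_iff.1 (funext hcon))
    obtain ⟨i, hi⟩ := this
    exact ⟨_, _, ⟨i, rfl⟩, hi, rfl⟩
  · rintro _ ⟨_, ⟨i, rfl⟩, hi, rfl⟩
    rw [sub_zero]
    exact hle i hi

/-- A Hamiltonian `H` that is bounded below by a multiple of a sum of projections with the same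
kernel inherits the gap of this sum. -/
theorem sub_smul_kerProjCompl_posSemidef {H K : Matrix ι ι ℂ} {a b : ℝ} (ha : 0 ≤ a)
    (hHK : (H - (a : ℂ) • K).PosSemidef) (hK : (K - (b : ℂ) • kerProjCompl K).PosSemidef)
    (hker : ∀ x, K *ᵥ x = 0 ↔ H *ᵥ x = 0) :
    (H - ((a * b : ℝ) : ℂ) • kerProjCompl H).PosSemidef := by
  have e : kerProjCompl K = kerProjCompl H := by
    rw [kerProjCompl, kerProjCompl, eq_kerProj (h := H) (kerProj_isHermitian K) (kerProj_mul_self K)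
      fun x => (kerProj_mulVec_eq_self K x).trans (hker x)]
  have := hHK.add (posSemidef_smul_of_nonneg hK ha)
  rw [e] at this
  convert this using 1
  push_cast
  module

end SpectralGap

/-! ### The decorated honeycomb lattice -/

section Lattice

variable {L : AddSubgroup (ℤ × ℤ)} {n : ℕ}

/-- The translation from `A q` to the end point of the edge number `i` at `A q`, modulo `L`. -/
abbrev cellShift (L : AddSubgroup (ℤ × ℤ)) (i : Fin 3) : HexCell L :=
  QuotientAddGroup.mk (hexShift i)

theorem decoratedEdge_zero (q : HexCell L) (i : Fin 3) :
    decoratedEdge L n q i 0 = Sum.inl (q, false) := rfl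

theorem decoratedEdge_castSucc_succ (q : HexCell L) (i : Fin 3) (j : Fin n) :
    decoratedEdge L n q i j.castSucc.succ = Sum.inr (q, i, j) := by
  rw [decoratedEdge, Fin.cons_succ, Fin.snoc_castSucc]

theorem decoratedEdge_last (q : HexCell L) (i : Fin 3) :
    decoratedEdge L n q i (Fin.last n).succ = Sum.inl (q + cellShift L i, true) := by
  rw [decoratedEdge, Fin.cons_succ, Fin.snoc_last]

theorem decoratedEdge_eq_inr_iff {q q' : HexCell L} {i i' : Fin 3} {t : Fin (n + 2)} {j : Fin n} :
    decoratedEdge L n q' i' t = Sum.inr (q, i, j) ↔ q' = q ∧ i' = i ∧ t = j.castSucc.succ := by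
  refine Fin.cases ?_ (fun t => Fin.lastCases ?_ (fun t => ?_) t) t
  · rw [decoratedEdge_zero]
    simp only [reduceCtorEq, false_iff, not_and]
    exact fun _ _ => (Fin.succ_ne_zero _).symm
  · rw [decoratedEdge_last]
    simp [Fin.ext_iff, j.2.ne']
  · rw [decoratedEdge_castSucc_succ]
    simp

theorem decoratedEdge_eq_inl_false_iff {q q' : HexCell L} {i' : Fin 3} {t : Fin (n + 2)} :
    decoratedEdge L n q' i' t = Sum.inl (q, false) ↔ q' = q ∧ t = 0 := by
  refine Fin.cases ?_ (fun t => Fin.lastCases ?_ (fun t => ?_) t) t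
  · rw [decoratedEdge_zero]
    simp
  · rw [decoratedEdge_last]
    simp
  · rw [decoratedEdge_castSucc_succ]
    simp

theorem decoratedEdge_eq_inl_true_iff {q q' : HexCell L} {i' : Fin 3} {t : Fin (n + 2)} :
    decoratedEdge L n q' i' t = Sum.inl (q, true) ↔
      q' + cellShift L i' = q ∧ t = (Fin.last n).succ := by
  refine Fin.cases ?_ (fun t => Fin.lastCases ?_ (fun t => ?_) t) t
  · rw [decoratedEdge_zero]
    simp [Fin.ext_iff]
  · rw [decoratedEdge_last]
    simp
  · rw [decoratedEdge_castSucc_succ]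
    simp [Fin.ext_iff, t.2.ne]

theorem decoratedEdge_injective (q : HexCell L) (i : Fin 3) :
    Function.Injective (decoratedEdge L n q i) := by
  intro s t h
  revert h
  refine Fin.cases (fun h => ?_) (fun s => Fin.lastCases (fun h => ?_) (fun s h => ?_) s) s
  · exact (decoratedEdge_eq_inl_false_iff.1 h.symm).2.symm
  · rw [decoratedEdge_last] at h
    exact (decoratedEdge_eq_inl_true_iff.1 h.symm).2.symm
  · rw [decoratedEdge_castSucc_succ] at h
    exact (decoratedEdge_eq_inr_iff.1 h.symm).2.2.symm

theorem decoratedEdge_castSucc_ne_succ (q : HexCell L) (i : Fin 3) (k : Fin (n + 1)) :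
    decoratedEdge L n q i k.castSucc ≠ decoratedEdge L n q i k.succ :=
  (decoratedEdge_injective q i).ne (Fin.castSucc_lt_succ).ne

theorem decoratedHoneycomb_adj {x y : DecoratedSite L n} : (decoratedHoneycomb L n).Adj x y ↔
    ∃ q i, ∃ k : Fin (n + 1),
      (x = decoratedEdge L n q i k.castSucc ∧ y = decoratedEdge L n q i k.succ) ∨
      (y = decoratedEdge L n q i k.castSucc ∧ x = decoratedEdge L n q i k.succ) := by
  rw [decoratedHoneycomb, SimpleGraph.fromRel_adj]
  constructor
  · rintro ⟨-, ⟨q, i, k, h⟩ | ⟨q, i, k, h⟩⟩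
    · exact ⟨q, i, k, Or.inl h⟩
    · exact ⟨q, i, k, Or.inr h⟩
  · rintro ⟨q, i, k, ⟨rfl, rfl⟩ | ⟨rfl, rfl⟩⟩
    · exact ⟨decoratedEdge_castSucc_ne_succ q i k, Or.inl ⟨q, i, k, rfl, rfl⟩⟩
    · exact ⟨(decoratedEdge_castSucc_ne_succ q i k).symm, Or.inr ⟨q, i, k, rfl, rfl⟩⟩

/-- The edges of the decorated lattice, numbered along the chains. -/
def bond (p : HexCell L × Fin 3 × Fin (n + 1)) : Sym2 (DecoratedSite L n) :=
  s(decoratedEdge L n p.1 p.2.1 p.2.2.castSucc, decoratedEdge L n p.1 p.2.1 p.2.2.succ)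

theorem mem_edgeSet_decoratedHoneycomb {e : Sym2 (DecoratedSite L n)} :
    e ∈ (decoratedHoneycomb L n).edgeSet ↔ ∃ p, bond p = e := by
  induction e with
  | h x y =>
    rw [SimpleGraph.mem_edgeSet, decoratedHoneycomb_adj]
    constructor
    · rintro ⟨q, i, k, ⟨rfl, rfl⟩ | ⟨rfl, rfl⟩⟩
      · exact ⟨(q, i, k), rfl⟩
      · exact ⟨(q, i, k), Sym2.eq_swap⟩
    · rintro ⟨⟨q, i, k⟩, h⟩
      rw [bond, Sym2.eq_iff] at h
      rcases h with ⟨h1, h2⟩ | ⟨h1, h2⟩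
      · exact ⟨q, i, k, Or.inl ⟨h1.symm, h2.symm⟩⟩
      · exact ⟨q, i, k, Or.inr ⟨h1.symm, h2.symm⟩⟩

theorem bond_injective : Function.Injective (bond (L := L) (n := n + 1)) := by
  rintro ⟨q, i, k⟩ ⟨q', i', k'⟩ h
  rw [bond, bond, Sym2.eq_iff] at h
  dsimp only at h
  revert h
  refine Fin.cases ?_ (fun j => ?_) k
  · rintro (⟨h1, h2⟩ | ⟨h1, -⟩)
    · obtain ⟨rfl, h3⟩ := decoratedEdge_eq_inl_false_iff.1 h1.symm
      have h4 := decoratedEdge_castSucc_succ q' i (0 : Fin (n + 1))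
      obtain ⟨-, rfl, -⟩ := decoratedEdge_eq_inr_iff.1 (h2.symm.trans h4)
      rw [Fin.castSucc_eq_zero_iff.1 h3]
    · exact absurd (decoratedEdge_eq_inl_false_iff.1 h1.symm).2 (Fin.succ_ne_zero _)
  · have h4 := decoratedEdge_castSucc_succ q i j
    rintro (⟨h1, -⟩ | ⟨h1, h2⟩)
    · obtain ⟨rfl, rfl, h3⟩ := decoratedEdge_eq_inr_iff.1 (h1.symm.trans h4)
      rw [Fin.castSucc_injective _ (h3.trans (Fin.succ_castSucc j))]
    · obtain ⟨rfl, rfl, h3⟩ := decoratedEdge_eq_inr_iff.1 (h1.symm.trans h4)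
      have h5 := decoratedEdge_injective _ _ h2
      simp only [Fin.ext_iff, Fin.val_succ, Fin.val_castSucc] at h3 h5
      omega

/-- The degree of each vertex is twice its spin, so that half the sum of the degrees of the end points
of an edge is their largest total spin. -/
theorem card_neighborSet_decoratedHoneycomb (v : DecoratedSite L (n + 1)) :
    Nat.card ((decoratedHoneycomb L (n + 1)).neighborSet v) = decoratedTwoSpin L (n + 1) v := by
  rcases v with ⟨q, _ | _⟩ | ⟨q, i, j⟩
  · have e : (decoratedHoneycomb L (n + 1)).neighborSet (Sum.inl (q, false)) =
        Set.range fun i : Fin 3 => (Sum.inr (q, i, 0) : DecoratedSite L (n + 1)) := by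
      ext y
      rw [SimpleGraph.mem_neighborSet, decoratedHoneycomb_adj]
      constructor
      · rintro ⟨q', i, k, ⟨h1, rfl⟩ | ⟨-, h1⟩⟩
        · obtain ⟨rfl, h2⟩ := decoratedEdge_eq_inl_false_iff.1 h1.symm
          rw [Fin.castSucc_eq_zero_iff.1 h2]
          exact ⟨i, (decoratedEdge_castSucc_succ q' i 0).symm⟩
        · exact absurd (decoratedEdge_eq_inl_false_iff.1 h1.symm).2 (Fin.succ_ne_zero _)
      · rintro ⟨i, rfl⟩
        exact ⟨q, i, 0, Or.inl ⟨rfl, (decoratedEdge_castSucc_succ q i 0).symm⟩⟩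
    rw [e, Nat.card_range_of_injective fun i j h => by simpa using h]
    simp [decoratedTwoSpin]
  · have e : (decoratedHoneycomb L (n + 1)).neighborSet (Sum.inl (q, true)) =
        Set.range fun i : Fin 3 =>
          (Sum.inr (q - cellShift L i, i, Fin.last n) : DecoratedSite L (n + 1)) := by
      ext y
      rw [SimpleGraph.mem_neighborSet, decoratedHoneycomb_adj]
      constructor
      · rintro ⟨q', i, k, ⟨h1, -⟩ | ⟨rfl, h1⟩⟩
        · have := (decoratedEdge_eq_inl_true_iff.1 h1.symm).2
          simp only [Fin.ext_iff, Fin.val_succ, Fin.val_castSucc, Fin.val_last] at this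
          omega
        · obtain ⟨rfl, h2⟩ := decoratedEdge_eq_inl_true_iff.1 h1.symm
          rw [Fin.succ_injective _ h2]
          refine ⟨i, ?_⟩
          simp only [add_sub_cancel_right]
          exact (decoratedEdge_castSucc_succ q' i (Fin.last n)).symm
      · rintro ⟨i, rfl⟩
        refine ⟨q - cellShift L i, i, Fin.last _, Or.inr ⟨?_, ?_⟩⟩
        · exact (decoratedEdge_castSucc_succ _ i (Fin.last n)).symm
        · rw [decoratedEdge_last, sub_add_cancel]
    rw [e, Nat.card_range_of_injective fun i j h => by
      simp only [Sum.inr.injEq, Prod.mk.injEq] at h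
      exact h.2.1]
    simp [decoratedTwoSpin]
  · have e : (decoratedHoneycomb L (n + 1)).neighborSet (Sum.inr (q, i, j)) =
        {decoratedEdge L (n + 1) q i j.castSucc.castSucc,
          decoratedEdge L (n + 1) q i j.succ.succ} := by
      ext y
      rw [SimpleGraph.mem_neighborSet, decoratedHoneycomb_adj]
      constructor
      · rintro ⟨q', i', k, ⟨h1, rfl⟩ | ⟨rfl, h1⟩⟩
        · obtain ⟨rfl, rfl, h2⟩ := decoratedEdge_eq_inr_iff.1 h1.symm
          rw [Fin.castSucc_injective _ (h2.trans (Fin.succ_castSucc j))]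
          exact Or.inr rfl
        · obtain ⟨rfl, rfl, h2⟩ := decoratedEdge_eq_inr_iff.1 h1.symm
          rw [Fin.succ_injective _ h2]
          exact Or.inl rfl
      · rintro (rfl | rfl)
        · exact ⟨q, i, j.castSucc, Or.inr ⟨rfl, (decoratedEdge_castSucc_succ q i j).symm⟩⟩
        · exact ⟨q, i, j.succ, Or.inl ⟨(decoratedEdge_castSucc_succ q i j).symm, rfl⟩⟩
    rw [e, Nat.card_coe_set_eq, Set.ncard_pair]
    · rfl
    · refine (decoratedEdge_injective q i).ne ?_
      simp only [ne_eq, Fin.ext_iff, Fin.val_succ, Fin.val_castSucc]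
      omega

end Lattice

section Hamiltonian

variable {L : AddSubgroup (ℤ × ℤ)} [L.FiniteIndex] {n : ℕ}

/-- The projection for the edge number `k` of the chain that replaces the edge number `i`
at `A q`. -/
noncomputable def bondProj (q : HexCell L) (i : Fin 3) (k : Fin (n + 1)) :
    Matrix (SpinConfig (decoratedTwoSpin L n)) (SpinConfig (decoratedTwoSpin L n)) ℂ :=
  edgeProj (decoratedTwoSpin L n) (decoratedEdge L n q i k.castSucc) (decoratedEdge L n q i k.succ)

theorem bondProj_posSemidef (q : HexCell L) (i : Fin 3) (k : Fin (n + 1)) :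
    (bondProj q i k).PosSemidef :=
  edgeProj_posSemidef _ _ _

/-- The matrix of the Hamiltonian. -/
noncomputable def hamMatrix (L : AddSubgroup (ℤ × ℤ)) [L.FiniteIndex] (n : ℕ) :
    Matrix (SpinConfig (decoratedTwoSpin L n)) (SpinConfig (decoratedTwoSpin L n)) ℂ :=
  ∑ q, ∑ i, ∑ k, bondProj q i k

/-- The Hamiltonian as a sum over the cells, the edges at each `A q` and the steps along a chain. -/
theorem decoratedAKLT_eq : decoratedAKLT L (n + 1) =
    toEuclideanCLM (n := SpinConfig (decoratedTwoSpin L (n + 1))) (𝕜 := ℂ)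
      (hamMatrix L (n + 1)) := by
  classical
  have e : (Finset.univ.filter fun e => e ∈ (decoratedHoneycomb L (n + 1)).edgeSet) =
      Finset.univ.image (bond (L := L) (n := n + 1)) := by
    ext e
    simp only [Finset.mem_filter, Finset.mem_univ, true_and, Finset.mem_image]
    exact mem_edgeSet_decoratedHoneycomb
  have h : ∀ p : HexCell L × Fin 3 × Fin (n + 1 + 1),
      (edgeSpinSubspace (decoratedTwoSpin L (n + 1)) (bond p)
        ((edgeDegreeSum (decoratedHoneycomb L (n + 1)) (bond p) : ℝ) / 2)).starProjection =
      toEuclideanCLM (n := SpinConfig (decoratedTwoSpin L (n + 1))) (𝕜 := ℂ)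
        (bondProj p.1 p.2.1 p.2.2) := by
    intro p
    have hne := decoratedEdge_castSucc_ne_succ p.1 p.2.1 p.2.2
    refine starProjection_edgeSpinSubspace _ hne ?_
    rw [edgeDegreeSum, show (Finset.univ.filter fun v => v ∈ bond p) =
      {decoratedEdge L (n + 1) p.1 p.2.1 p.2.2.castSucc,
        decoratedEdge L (n + 1) p.1 p.2.1 p.2.2.succ} by ext v; simp [bond],
      Finset.sum_pair hne, card_neighborSet_decoratedHoneycomb,
      card_neighborSet_decoratedHoneycomb]
    push_cast
    rfl
  rw [decoratedAKLT, akltHamiltonian]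
  calc _ = ∑ e ∈ Finset.univ.image (bond (L := L) (n := n + 1)),
        (edgeSpinSubspace (decoratedTwoSpin L (n + 1)) e
          ((edgeDegreeSum (decoratedHoneycomb L (n + 1)) e : ℝ) / 2)).starProjection := by
        rw [← e]
    _ = _ := by
        rw [Finset.sum_image bond_injective.injOn, hamMatrix]
        simp only [h, map_sum, Fintype.sum_prod_type]

theorem hamMatrix_posSemidef : (hamMatrix L n).PosSemidef :=
  posSemidef_sum _ fun _ _ => posSemidef_sum _ fun _ _ => posSemidef_sum _ fun _ _ =>
    bondProj_posSemidef _ _ _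

theorem hamMatrix_mulVec_eq_zero_iff {x : SpinConfig (decoratedTwoSpin L n) → ℂ} :
    hamMatrix L n *ᵥ x = 0 ↔ ∀ q i k, bondProj q i k *ᵥ x = 0 := by
  rw [hamMatrix, sum_mulVec_eq_zero_iff fun _ _ => posSemidef_sum _ fun _ _ =>
    posSemidef_sum _ fun _ _ => bondProj_posSemidef _ _ _]
  simp only [Finset.mem_univ, true_imp_iff]
  refine forall_congr' fun q => ?_
  rw [sum_mulVec_eq_zero_iff fun _ _ => posSemidef_sum _ fun _ _ => bondProj_posSemidef _ _ _]
  simp only [Finset.mem_univ, true_imp_iff]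
  refine forall_congr' fun i => ?_
  rw [sum_mulVec_eq_zero_iff fun _ _ => bondProj_posSemidef _ _ _]
  simp only [Finset.mem_univ, true_imp_iff]

theorem hamMatrix_ne_zero : hamMatrix L n ≠ 0 := by
  intro h
  refine edgeProj_ne_zero (twoS := decoratedTwoSpin L n)
    (decoratedEdge_castSucc_ne_succ (0 : HexCell L) 0 0) (Matrix.ext_of_mulVec_single fun τ => ?_)
  rw [zero_mulVec]
  exact hamMatrix_mulVec_eq_zero_iff.1 (by rw [h, zero_mulVec]) 0 0 0

/-- The ground energy is zero: each vertex has as many edges as spins 1/2, which leaves room for one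
valence bond on each edge. -/
theorem exists_ne_zero_hamMatrix_mulVec_eq_zero :
    ∃ ψ : SpinConfig (decoratedTwoSpin L n) → ℂ, ψ ≠ 0 ∧ hamMatrix L n *ᵥ ψ = 0 := by
  suffices hdeg : _ by
    obtain ⟨ψ, hψ, h⟩ := exists_ne_zero_edgeProj_mulVec_eq_zero (twoS := decoratedTwoSpin L n)
      (a := fun p : HexCell L × Fin 3 × Fin (n + 1) => decoratedEdge L n p.1 p.2.1 p.2.2.castSucc)
      (b := fun p => decoratedEdge L n p.1 p.2.1 p.2.2.succ)
      (fun p => decoratedEdge_castSucc_ne_succ _ _ _) hdeg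
    exact ⟨ψ, hψ, hamMatrix_mulVec_eq_zero_iff.2 fun q i k => h (q, i, k)⟩
  · intro v
    rw [Finset.sum_add_distrib, Finset.sum_boole, Finset.sum_boole]
    rcases v with ⟨q, _ | _⟩ | ⟨q, i, j⟩
    · have h1 : (Finset.univ.filter fun p : HexCell L × Fin 3 × Fin (n + 1) =>
          decoratedEdge L n p.1 p.2.1 p.2.2.castSucc = Sum.inl (q, false)) ⊆
            Finset.univ.image fun i : Fin 3 => (q, i, (0 : Fin (n + 1))) := by
        rintro ⟨q', i, k⟩ hp
        have hp' : decoratedEdge L n q' i k.castSucc = _ := (Finset.mem_filter.1 hp).2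
        obtain ⟨rfl, hk⟩ := decoratedEdge_eq_inl_false_iff.1 hp'
        rw [Fin.castSucc_eq_zero_iff.1 hk]
        exact Finset.mem_image_of_mem _ (Finset.mem_univ i)
      have h2 : (Finset.univ.filter fun p : HexCell L × Fin 3 × Fin (n + 1) =>
          decoratedEdge L n p.1 p.2.1 p.2.2.succ = Sum.inl (q, false)) = ∅ := by
        refine Finset.filter_false_of_mem fun p _ hp => ?_
        exact absurd (decoratedEdge_eq_inl_false_iff.1 hp).2 (Fin.succ_ne_zero _)
      rw [h2]
      exact (Finset.card_le_card h1).trans Finset.card_image_le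
    · have h1 : (Finset.univ.filter fun p : HexCell L × Fin 3 × Fin (n + 1) =>
          decoratedEdge L n p.1 p.2.1 p.2.2.succ = Sum.inl (q, true)) ⊆
            Finset.univ.image fun i : Fin 3 => (q - cellShift L i, i, Fin.last n) := by
        rintro ⟨q', i, k⟩ hp
        have hp' : decoratedEdge L n q' i k.succ = _ := (Finset.mem_filter.1 hp).2
        obtain ⟨rfl, hk⟩ := decoratedEdge_eq_inl_true_iff.1 hp'
        rw [Fin.succ_injective _ hk]
        exact Finset.mem_image.2 ⟨i, Finset.mem_univ i, by rw [add_sub_cancel_right]⟩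
      have h2 : (Finset.univ.filter fun p : HexCell L × Fin 3 × Fin (n + 1) =>
          decoratedEdge L n p.1 p.2.1 p.2.2.castSucc = Sum.inl (q, true)) = ∅ := by
        refine Finset.filter_false_of_mem fun p _ hp => ?_
        have := (decoratedEdge_eq_inl_true_iff.1 hp).2
        simp only [Fin.ext_iff, Fin.val_succ, Fin.val_castSucc, Fin.val_last] at this
        omega
      rw [h2, Finset.card_empty]
      simp only [Nat.cast_zero, zero_add]
      exact (Finset.card_le_card h1).trans Finset.card_image_le
    · have h1 : (Finset.univ.filter fun p : HexCell L × Fin 3 × Fin (n + 1) =>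
          decoratedEdge L n p.1 p.2.1 p.2.2.castSucc = Sum.inr (q, i, j)) ⊆ {(q, i, j.succ)} := by
        rintro ⟨q', i', k⟩ hp
        have hp' : decoratedEdge L n q' i' k.castSucc = _ := (Finset.mem_filter.1 hp).2
        obtain ⟨rfl, rfl, hk⟩ := decoratedEdge_eq_inr_iff.1 hp'
        rw [Fin.castSucc_injective _ (hk.trans (Fin.succ_castSucc j))]
        exact Finset.mem_singleton_self _
      have h2 : (Finset.univ.filter fun p : HexCell L × Fin 3 × Fin (n + 1) =>
          decoratedEdge L n p.1 p.2.1 p.2.2.succ = Sum.inr (q, i, j)) ⊆ {(q, i, j.castSucc)} := by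
        rintro ⟨q', i', k⟩ hp
        have hp' : decoratedEdge L n q' i' k.succ = _ := (Finset.mem_filter.1 hp).2
        obtain ⟨rfl, rfl, hk⟩ := decoratedEdge_eq_inr_iff.1 hp'
        rw [Fin.succ_injective _ hk]
        exact Finset.mem_singleton_self _
      exact Nat.add_le_add (Finset.card_le_card h1) (Finset.card_le_card h2)

end Hamiltonian

/-! ### The stars of the decorated lattice -/

section LegPermutation

variable {V : Type*} [Fintype V] [DecidableEq V] {n : ℕ}

/-- The permutation of the sites of a star given by a permutation of its legs. -/
def legPerm (e : Equiv.Perm (Fin 3)) : StarSite n → StarSite n :=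
  Sum.map id (Prod.map e id)

theorem legPerm_legSite (e : Equiv.Perm (Fin 3)) (i : Fin 3) (k : Fin (n + 1)) :
    legPerm e (legSite i k) = legSite (e i) k := by
  refine Fin.cases rfl (fun k => rfl) k

theorem starHam_comp_legPerm (twoS : V → ℕ) (F : StarSite n → V) (e : Equiv.Perm (Fin 3)) :
    starHam twoS (F ∘ legPerm e) = starHam twoS F := by
  simp only [starHam, Function.comp_apply, legPerm_legSite]
  exact Equiv.sum_comp e fun i => ∑ k : Fin n,
    edgeProj twoS (F (legSite i k.castSucc)) (F (legSite i k.succ))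

end LegPermutation

section StarGap

variable {V : Type*} [Fintype V] [DecidableEq V] {n : ℕ} {twoS : V → ℕ}

/-- The gap of a star does not depend on the place of the star. -/
theorem exists_starHam_gap (n : ℕ) : ∃ g : ℝ, 0 < g ∧ ∀ {V : Type} [Fintype V] [DecidableEq V]
    {twoS : V → ℕ} {F : StarSite n → V}, Function.Injective F →
    (fun s => twoS (F s)) = starSpin n →
    (starHam twoS F - (g : ℂ) • kerProjCompl (starHam twoS F)).PosSemidef := by
  obtain ⟨g, hg, h⟩ := exists_gap (starHam_posSemidef (starSpin n) id)
  refine ⟨g, hg, fun {V} _ _ {twoS F} hF hspin => ?_⟩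
  have key : ∀ twoS' : StarSite n → ℕ, twoS' = starSpin n →
      (starHam twoS' id - (g : ℂ) • kerProjCompl (starHam twoS' id)).PosSemidef := by
    rintro _ rfl
    exact h
  have := embed_posSemidef hF (key _ hspin)
  simpa only [embed_sub, embed_smul, embed_kerProjCompl hF, embed_starHam hF, Function.comp_id]
    using this

/-- The projections of disjoint stars commute, so their product is positive semidefinite. -/
theorem anticommutator_starHam_of_disjoint {F G : StarSite n → V} (hF : Function.Injective F)
    (hG : Function.Injective G) (hFG : ∀ x y, F x ≠ G y) :
    (kerProjCompl (starHam twoS F) * kerProjCompl (starHam twoS G) +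
      kerProjCompl (starHam twoS G) * kerProjCompl (starHam twoS F)).PosSemidef := by
  set P := kerProjCompl (starHam twoS F) with hP
  set Q := kerProjCompl (starHam twoS G) with hQ
  have hcomm : P * Q = Q * P := by
    have := embed_commute hF hG hFG (kerProjCompl (starHam (fun s => twoS (F s)) id))
      (kerProjCompl (starHam (fun s => twoS (G s)) id))
    rw [embed_kerProjCompl hF, embed_kerProjCompl hG, embed_starHam hF, embed_starHam hG] at this
    exact this
  have hpos : (P * Q).PosSemidef := by
    have e : P * Q = (P * Q)ᴴ * (P * Q) := by
      rw [conjTranspose_mul, (kerProjCompl_isHermitian _).eq, (kerProjCompl_isHermitian _).eq,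
        Matrix.mul_assoc, ← Matrix.mul_assoc P P, kerProjCompl_mul_self, hcomm,
        ← Matrix.mul_assoc, kerProjCompl_mul_self]
    rw [e]
    exact posSemidef_conjTranspose_mul_self _
  rw [← hcomm]
  exact hpos.add hpos

end StarGap

section LatticeStar

variable {L : AddSubgroup (ℤ × ℤ)} {n : ℕ}

/-- The star whose centre is the vertex `w` of the honeycomb lattice: the legs are the sites
on the edges at `w`. -/
def latticeStar (w : HexCell L × Bool) : StarSite n → DecoratedSite L n :=
  Sum.map (fun _ => w) fun p =>
    if w.2 then (w.1 - cellShift L p.1, p.1, Fin.rev p.2) else (w.1, p.1, p.2)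

theorem latticeStar_injective (w : HexCell L × Bool) :
    Function.Injective (latticeStar (n := n) w) := by
  refine Function.Injective.sumMap (fun _ _ _ => rfl) ?_
  rintro ⟨i, k⟩ ⟨j, l⟩ h
  dsimp only at h
  split_ifs at h
  · obtain ⟨h1, h2⟩ := Prod.mk.inj (Prod.mk.inj h).2
    rw [h1, Fin.rev_injective h2]
  · exact (Prod.mk.inj h).2

theorem latticeStar_spin (w : HexCell L × Bool) :
    (fun s => decoratedTwoSpin L n (latticeStar w s)) = starSpin n := by
  funext s
  rcases s with _ | _ <;> rfl

theorem latticeStar_false_legSite (q : HexCell L) (i : Fin 3) (k : Fin (n + 1)) :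
    latticeStar (q, false) (legSite i k) = decoratedEdge L n q i k.castSucc :=
  Fin.cases rfl (fun k => (decoratedEdge_castSucc_succ q i k).symm) k

theorem latticeStar_true_legSite (q : HexCell L) (i : Fin 3) (k : Fin (n + 1)) :
    latticeStar (q, true) (legSite i k) =
      decoratedEdge L n (q - cellShift L i) i (Fin.rev k.castSucc) := by
  refine Fin.cases ?_ (fun k => ?_) k
  · rw [Fin.castSucc_zero, Fin.rev_zero, ← Fin.succ_last, decoratedEdge_last, sub_add_cancel]
    rfl
  · rw [show Fin.rev k.succ.castSucc = (Fin.rev k).castSucc.succ by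
      simp only [Fin.ext_iff, Fin.val_rev, Fin.val_succ, Fin.val_castSucc]
      omega, decoratedEdge_castSucc_succ]
    rfl

/-- Two vertices of the honeycomb lattice are neighbours. -/
def HexAdj (w w' : HexCell L × Bool) : Prop :=
  ∃ q i, (w = (q, false) ∧ w' = (q + cellShift L i, true)) ∨
    (w' = (q, false) ∧ w = (q + cellShift L i, true))

theorem HexAdj.symm {w w' : HexCell L × Bool} (h : HexAdj w w') : HexAdj w' w := by
  obtain ⟨q, i, h⟩ := h
  exact ⟨q, i, h.symm⟩

theorem not_hexAdj_self (w : HexCell L × Bool) : ¬ HexAdj w w := by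
  rintro ⟨q, i, ⟨h1, h2⟩ | ⟨h1, h2⟩⟩
  · exact absurd (congrArg Prod.snd (h1.symm.trans h2)) (by simp)
  · exact absurd (congrArg Prod.snd (h1.symm.trans h2)) (by simp)

open Classical in
theorem card_hexAdj_le [L.FiniteIndex] (w : HexCell L × Bool) :
    (Finset.univ.filter (HexAdj w)).card ≤ 3 := by
  have h : Finset.univ.filter (HexAdj w) ⊆ Finset.univ.image fun i : Fin 3 =>
      if w.2 then (w.1 - cellShift L i, false) else (w.1 + cellShift L i, true) := by
    intro w' hw'
    obtain ⟨q, i, ⟨rfl, rfl⟩ | ⟨rfl, rfl⟩⟩ := (Finset.mem_filter.1 hw').2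
    · exact Finset.mem_image.2 ⟨i, Finset.mem_univ i, rfl⟩
    · exact Finset.mem_image.2 ⟨i, Finset.mem_univ i, by simp⟩
  exact (Finset.card_le_card h).trans Finset.card_image_le

/-- The stars of two vertices that are not neighbours have no common site. -/
theorem latticeStar_ne {w w' : HexCell L × Bool} (hw : w ≠ w') (hadj : ¬ HexAdj w w')
    (x y : StarSite n) : latticeStar w x ≠ latticeStar w' y := by
  intro h
  rcases x with _ | ⟨i, k⟩ <;> rcases y with _ | ⟨j, l⟩
  · exact hw (Sum.inl.inj h)
  · exact absurd h (by simp [latticeStar])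
  · exact absurd h (by simp [latticeStar])
  · have h := Sum.inr.inj h
    rcases w with ⟨q, _ | _⟩ <;> rcases w' with ⟨q', _ | _⟩
    · have h1 : q = q' := (Prod.mk.inj h).1
      exact hw (by rw [h1])
    · have h1 : q = q' - cellShift L j := (Prod.mk.inj h).1
      exact hadj ⟨q, j, Or.inl ⟨rfl, by rw [h1, sub_add_cancel]⟩⟩
    · have h1 : q - cellShift L i = q' := (Prod.mk.inj h).1
      exact hadj ⟨q', i, Or.inr ⟨rfl, by rw [← h1, sub_add_cancel]⟩⟩
    · have h1 : q - cellShift L i = q' - cellShift L j := (Prod.mk.inj h).1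
      have h2 : i = j := (Prod.mk.inj (Prod.mk.inj h).2).1
      rw [h2] at h1
      exact hw (by rw [sub_left_injective h1])

/-- The edges of the honeycomb lattice that carry the legs of the double star at `A q` and its
neighbour number `i`. -/
def doubleStarLeg (q : HexCell L) (i : Fin 3) : Fin 5 → HexCell L × Fin 3 :=
  ![(q, i), (q, i + 1), (q, i + 2), (q + cellShift L i - cellShift L (i + 1), i + 1),
    (q + cellShift L i - cellShift L (i + 2), i + 2)]

/-- Without multiple edges, the stars of two neighbours share one leg only. -/
theorem doubleStarLeg_injective (hL : NoMultipleEdges L) (q : HexCell L) (i : Fin 3) :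
    Function.Injective (doubleStarLeg q i) := by
  have h1 : i + 1 ≠ i := by revert i; decide
  have h2 : i + 2 ≠ i := by revert i; decide
  have h3 : i + 1 ≠ i + 2 := by revert i; decide
  have hs : ∀ j, j ≠ i → q + cellShift L i - cellShift L j ≠ q := by
    intro j hj h
    rw [add_sub_assoc, add_eq_left, sub_eq_zero] at h
    exact hj (hL h).symm
  have h4 := hs _ h1
  have h5 := hs _ h2
  intro j l h
  fin_cases j <;> fin_cases l <;>
    first
    | rfl
    | (exfalso
       simp [doubleStarLeg, h1, h2, h3, h1.symm, h2.symm, h3.symm, h4, h5, h4.symm, h5.symm] at h)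

/-- The double star at `A q` and its neighbour number `i`. -/
def latticeDoubleStar (q : HexCell L) (i : Fin 3) : DoubleStarSite n → DecoratedSite L n :=
  Sum.map (fun b => if b then (q + cellShift L i, true) else (q, false)) fun p =>
    ((doubleStarLeg q i p.1).1, (doubleStarLeg q i p.1).2, if p.1 ≤ 2 then p.2 else Fin.rev p.2)

theorem latticeDoubleStar_injective (hL : NoMultipleEdges L) (q : HexCell L) (i : Fin 3) :
    Function.Injective (latticeDoubleStar (n := n) q i) := by
  refine Function.Injective.sumMap ?_ ?_
  · rintro (_ | _) (_ | _) h <;> simp at h ⊢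
  · rintro ⟨j, k⟩ ⟨j', l⟩ h
    obtain ⟨h1, h⟩ := Prod.mk.inj h
    obtain ⟨h2, h⟩ := Prod.mk.inj h
    obtain rfl := doubleStarLeg_injective hL q i (Prod.ext h1 h2)
    dsimp only at h
    split_ifs at h
    · rw [h]
    · rw [Fin.rev_injective h]

theorem latticeDoubleStar_spin (q : HexCell L) (i : Fin 3) :
    (fun s => decoratedTwoSpin L n (latticeDoubleStar q i s)) = doubleStarSpin n := by
  funext s
  rcases s with _ | _ <;> rfl

theorem latticeDoubleStar_comp_leftStar (q : HexCell L) (i : Fin 3) :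
    latticeDoubleStar (n := n) q i ∘ leftStar =
      latticeStar (q, false) ∘ legPerm (Equiv.addLeft i) := by
  funext s
  rcases s with _ | ⟨j, k⟩
  · rfl
  · fin_cases j <;> simp [latticeDoubleStar, leftStar, latticeStar, legPerm, doubleStarLeg]

theorem latticeDoubleStar_comp_rightStar (q : HexCell L) (i : Fin 3) :
    latticeDoubleStar (n := n) q i ∘ rightStar =
      latticeStar (q + cellShift L i, true) ∘ legPerm (Equiv.addLeft i) := by
  funext s
  rcases s with _ | ⟨j, k⟩
  · rfl
  · fin_cases j <;> simp [latticeDoubleStar, rightStar, latticeStar, legPerm, doubleStarLeg]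

end LatticeStar

section Gap

variable {L : AddSubgroup (ℤ × ℤ)} [L.FiniteIndex] {n : ℕ}

/-- The Hamiltonian of the star of the vertex `w`. -/
noncomputable def latticeStarHam (n : ℕ) (w : HexCell L × Bool) :
    Matrix (SpinConfig (decoratedTwoSpin L n)) (SpinConfig (decoratedTwoSpin L n)) ℂ :=
  starHam (decoratedTwoSpin L n) (latticeStar w)

theorem edgeProj_comm {V : Type*} [Fintype V] [DecidableEq V] (twoS : V → ℕ) (x y : V) :
    edgeProj twoS x y = edgeProj twoS y x := by
  rw [edgeProj, edgeProj, edgeDefect, edgeDefect, add_comm (twoS x : ℝ)]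
  simp only [add_comm (siteOp twoS x _)]

theorem latticeStarHam_false (q : HexCell L) :
    latticeStarHam n (q, false) = ∑ i, ∑ k : Fin n, bondProj q i k.castSucc := by
  simp only [latticeStarHam, starHam, latticeStar_false_legSite]
  rfl

theorem latticeStarHam_true (q : HexCell L) :
    latticeStarHam n (q, true) =
      ∑ i, ∑ k : Fin n, bondProj (q - cellShift L i) i k.succ := by
  simp only [latticeStarHam, starHam, latticeStar_true_legSite]
  refine Finset.sum_congr rfl fun i _ => ?_
  rw [← Equiv.sum_comp Fin.revPerm]
  refine Finset.sum_congr rfl fun k _ => ?_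
  rw [edgeProj_comm, bondProj]
  congr 2 <;> simp [Fin.ext_iff, Fin.val_rev] <;> omega

theorem sum_latticeStarHam : ∑ w, latticeStarHam (L := L) n w =
    ∑ q, ∑ i, (∑ k : Fin n, bondProj q i k.castSucc + ∑ k : Fin n, bondProj q i k.succ) := by
  have e : ∑ q : HexCell L, latticeStarHam n (q, true) =
      ∑ q : HexCell L, ∑ i, ∑ k : Fin n, bondProj q i k.succ := by
    simp only [latticeStarHam_true]
    rw [Finset.sum_comm]
    refine Eq.trans (Finset.sum_congr rfl fun i _ => ?_) Finset.sum_comm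
    exact Equiv.sum_comp (Equiv.subRight (cellShift L i)) fun q => ∑ k : Fin n, bondProj q i k.succ
  simp only [Fintype.sum_prod_type, Fintype.sum_bool, Finset.sum_add_distrib, latticeStarHam_false]
  rw [e, add_comm]

/-- Each edge belongs to at most two stars. -/
theorem two_smul_hamMatrix_sub_posSemidef :
    ((2 : ℂ) • hamMatrix L n - ∑ w, latticeStarHam n w).PosSemidef := by
  have e : (2 : ℂ) • hamMatrix L n - ∑ w, latticeStarHam n w =
      ∑ q : HexCell L, ∑ i, (bondProj q i 0 + bondProj q i (Fin.last n)) := by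
    rw [sum_latticeStarHam, hamMatrix, Finset.smul_sum, ← Finset.sum_sub_distrib]
    refine Finset.sum_congr rfl fun q _ => ?_
    rw [Finset.smul_sum, ← Finset.sum_sub_distrib]
    refine Finset.sum_congr rfl fun i _ => ?_
    rw [two_smul]
    nth_rewrite 1 [Fin.sum_univ_succ]
    rw [Fin.sum_univ_castSucc]
    abel
  rw [e]
  exact posSemidef_sum _ fun q _ => posSemidef_sum _ fun i _ =>
    (bondProj_posSemidef _ _ _).add (bondProj_posSemidef _ _ _)

/-- Each edge belongs to a star, so the common ground states of all stars are those of the Hamiltonian. -/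
theorem sum_kerProjCompl_mulVec_eq_zero_iff {x : SpinConfig (decoratedTwoSpin L (n + 1)) → ℂ} :
    (∑ w, kerProjCompl (latticeStarHam (L := L) (n + 1) w)) *ᵥ x = 0 ↔
      hamMatrix L (n + 1) *ᵥ x = 0 := by
  rw [sum_mulVec_eq_zero_iff fun _ _ => kerProjCompl_posSemidef _, hamMatrix_mulVec_eq_zero_iff]
  simp only [Finset.mem_univ, true_imp_iff, kerProjCompl_mulVec_eq_zero]
  constructor
  · intro h
    have hpos : ∀ (q : HexCell L) (i : Fin 3) (f : Fin (n + 1) → Fin (n + 1 + 1)),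
        (∑ k, bondProj q i (f k)).PosSemidef := fun q i f =>
      posSemidef_sum _ fun _ _ => bondProj_posSemidef _ _ _
    have hA : ∀ (q : HexCell L) i (k : Fin (n + 1)), bondProj q i k.castSucc *ᵥ x = 0 := by
      intro q i k
      have h1 := h (q, false)
      rw [latticeStarHam_false, sum_mulVec_eq_zero_iff fun i _ => hpos _ _ _] at h1
      have h2 := h1 i (Finset.mem_univ i)
      rw [sum_mulVec_eq_zero_iff fun k _ => bondProj_posSemidef _ _ _] at h2
      exact h2 k (Finset.mem_univ k)
    have hB : ∀ (q : HexCell L) i (k : Fin (n + 1)), bondProj q i k.succ *ᵥ x = 0 := by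
      intro q i k
      have h1 := h (q + cellShift L i, true)
      rw [latticeStarHam_true, sum_mulVec_eq_zero_iff fun i _ => hpos _ _ _] at h1
      have h2 := h1 i (Finset.mem_univ i)
      rw [sum_mulVec_eq_zero_iff fun k _ => bondProj_posSemidef _ _ _, add_sub_cancel_right] at h2
      exact h2 k (Finset.mem_univ k)
    intro q i k
    exact Fin.cases (hA q i 0) (hB q i) k
  · rintro h ⟨q, _ | _⟩
    · rw [latticeStarHam_false, sum_mulVec]
      refine Finset.sum_eq_zero fun i _ => ?_
      rw [sum_mulVec]
      exact Finset.sum_eq_zero fun k _ => h _ _ _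
    · rw [latticeStarHam_true, sum_mulVec]
      refine Finset.sum_eq_zero fun i _ => ?_
      rw [sum_mulVec]
      exact Finset.sum_eq_zero fun k _ => h _ _ _

open Classical in
theorem anticommutator_latticeStarHam (hL : NoMultipleEdges L) (w w' : HexCell L × Bool)
    (hw : w ≠ w') :
    (kerProjCompl (latticeStarHam (n + 3) w) * kerProjCompl (latticeStarHam (n + 3) w') +
      kerProjCompl (latticeStarHam (n + 3) w') * kerProjCompl (latticeStarHam (n + 3) w) +
      ((if HexAdj w w' then 3 / 10 else 0 : ℝ) : ℂ) • (kerProjCompl (latticeStarHam (n + 3) w) +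
        kerProjCompl (latticeStarHam (n + 3) w'))).PosSemidef := by
  have key : ∀ (q : HexCell L) i,
      (kerProjCompl (latticeStarHam (n + 3) (q, false)) *
        kerProjCompl (latticeStarHam (n + 3) (q + cellShift L i, true)) +
      kerProjCompl (latticeStarHam (n + 3) (q + cellShift L i, true)) *
        kerProjCompl (latticeStarHam (n + 3) (q, false)) +
      ((3 / 10 : ℝ) : ℂ) • (kerProjCompl (latticeStarHam (n + 3) (q, false)) +
        kerProjCompl (latticeStarHam (n + 3) (q + cellShift L i, true)))).PosSemidef := by
    intro q i
    have := anticommutator_starHam (twoS := decoratedTwoSpin L (n + 3))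
      (latticeDoubleStar_injective hL q i) (latticeDoubleStar_spin q i)
    simpa only [latticeDoubleStar_comp_leftStar, latticeDoubleStar_comp_rightStar,
      starHam_comp_legPerm, latticeStarHam] using this
  by_cases hadj : HexAdj w w'
  · rw [if_pos hadj]
    obtain ⟨q, i, ⟨rfl, rfl⟩ | ⟨rfl, rfl⟩⟩ := hadj
    · exact key q i
    · have := key q i
      rwa [add_comm (kerProjCompl (latticeStarHam (n + 3) (q, false)) * _),
        add_comm (kerProjCompl (latticeStarHam (n + 3) (q, false)))] at this
  · rw [if_neg hadj, Complex.ofReal_zero, zero_smul, add_zero]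
    exact anticommutator_starHam_of_disjoint (latticeStar_injective w) (latticeStar_injective w')
      (latticeStar_ne hw hadj)

/-- The gap of the sum of the star projections is at least `1 - 3 * (3 / 10)`, as each star has
at most three neighbours. -/
theorem sum_kerProjCompl_gap (hL : NoMultipleEdges L) :
    (∑ w, kerProjCompl (latticeStarHam (L := L) (n + 3) w) - ((1 / 10 : ℝ) : ℂ) •
      kerProjCompl (∑ w, kerProjCompl (latticeStarHam (L := L) (n + 3) w))).PosSemidef := by
  classical
  refine gap_of_sq (posSemidef_sum _ fun w _ => kerProjCompl_posSemidef _) ?_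
  have := sq_sub_smul_posSemidef (fun w => kerProjCompl (latticeStarHam (L := L) (n + 3) w))
    (fun w => kerProjCompl_mul_self _) (fun w => kerProjCompl_posSemidef _) HexAdj not_hexAdj_self
    (fun _ _ => HexAdj.symm) 3 card_hexAdj_le (ε := 3 / 10) (by norm_num)
    (anticommutator_latticeStarHam hL)
  norm_num at this ⊢
  exact this

end Gap

theorem mainTheorem1 (n : ℕ) (hn : 3 ≤ n) :
    ∃ γ : ℝ, 0 < γ ∧ ∀ (L : AddSubgroup (ℤ × ℤ)) [L.FiniteIndex], NoMultipleEdges L →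
      γ ≤ spectralGap (decoratedAKLT L n) := by
  obtain ⟨n, rfl⟩ : ∃ m, n = m + 3 := ⟨n - 3, by omega⟩
  obtain ⟨g, hg, hgap⟩ := exists_starHam_gap (n + 3)
  -- `g / 2`, as each edge lies in at most two stars; `1 / 10` is the gap of the star projections
  refine ⟨g / 2 * (1 / 10), by positivity, fun L _ hL => ?_⟩
  obtain ⟨ψ, hψ, hψ0⟩ := exists_ne_zero_hamMatrix_mulVec_eq_zero (L := L) (n := n + 3)
  rw [decoratedAKLT_eq (n := n + 2)]
  refine le_spectralGap hamMatrix_posSemidef ?_ hψ hψ0 hamMatrix_ne_zero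
  refine sub_smul_kerProjCompl_posSemidef (by positivity) ?_ (sum_kerProjCompl_gap hL)
    fun x => sum_kerProjCompl_mulVec_eq_zero_iff
  have e : hamMatrix L (n + 3) - ((g / 2 : ℝ) : ℂ) •
      ∑ w, kerProjCompl (latticeStarHam (L := L) (n + 3) w) =
      ((1 / 2 : ℝ) : ℂ) • ((2 : ℂ) • hamMatrix L (n + 3) - ∑ w, latticeStarHam (n + 3) w) +
      ((1 / 2 : ℝ) : ℂ) • ∑ w, (latticeStarHam (L := L) (n + 3) w -
        (g : ℂ) • kerProjCompl (latticeStarHam (n + 3) w)) := by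
    rw [Finset.sum_sub_distrib, ← Finset.smul_sum]
    push_cast
    module
  rw [e]
  exact (posSemidef_smul_of_nonneg two_smul_hamMatrix_sub_posSemidef (by norm_num)).add
    (posSemidef_smul_of_nonneg (posSemidef_sum _ fun w _ =>
      hgap (latticeStar_injective w) (latticeStar_spin w)) (by norm_num))
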